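/- **Setting.** Let $E=\mathcal S(\mathbb R)\subset E_0=L^2(\mathbb R,dt)\subset E^*=\mathcal S^*(\mathbb R)$ (real spaces), let $A=1+t^2-d^2/dt^2$, and let $(e_j)_{j\ge 0}\subset E$ be the orthonormal basis of $E_0$ of Hermite functions, $Ae_j=(2j+2)e_j$. The subscript $c$ denotes complexification. For $p\ge 0$ let $E^*_{p,c}$ be the Hilbert space of all $x\in E^*_c$ with $|x|_{-p}:=|A^{-p}x|_0=\bigl(\sum_j(2j+2)^{-2p}|\langle x,e_j\rangle|^2\bigr)^{1/2}<\infty$. Let $\mu$ be the standard Gaussian measure on $E^*$, $\int_{E^*} e^{i\langle x,\xi\rangle}\mu(dx)=e^{-|\xi|_0^2/2}$ for $\xi\in E$. Every $\varphi\in L^2(E^*,\mu;\mathbb C)$ has a unique Wiener–Itô expansion $\varphi=\sum_{n\ge 0}\langle:\!\cdot^{\otimes n}\!:,f_n\rangle$ with $f_n\in E_{0,c}^{\widehat\otimes n}$. Let $C^{(2)}_{+,1/2,1}$ be the class of positive continuous functions $u$ on $[0,\infty)$ such that $\lim_{r\to\infty}\frac{\log u(r)}{\sqrt r}=\infty$,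 the limit $\lim_{r\to\infty}\frac{\log u(r)}{r}$ exists and is finite, and $x\mapsto\log u(x^2)$ is convex on $[0,\infty)$. Put $\ell_u(t)=\inf_{r>0}u(r)r^{-t}$ and $$\|\varphi\|_{u,p}=\Bigl(\sum_{n=0}^\infty\frac{1}{\ell_u(n)}\,|(A^{\otimes n})^pf_n|_0^2\Bigr)^{1/2}\in[0,\infty],\qquad [E]_u=\{\varphi\in L^2(\mu):\ \|\varphi\|_{u,p}<\infty\ \text{for all } p\ge 0\}.$$ Let $\mathcal A_u$ be the space of all functions $\Phi$ on $E^*_c$ such that, for every $p\ge 0$, $\Phi$ is analytic (holomorphic) on the Hilbert space $E^*_{p,c}$ and $|\Phi(x)|^2\le C\,u(|x|_{-p}^2)$ for all $x\in E^*_{p,c}$, with some constant $C=C(p,\Phi)\ge 0$. Put $$|||\Phi|||_{\mathcal A_{u,p}}=\sup_{x\in E^*_{p,c}}|\Phi(x)|\,u(|x|_{-p}^2)^{-1/2}.$$ **Proposition 4.4.** Let $u\in C^{(2)}_{+,1/2,1}$. Then $\mathcal A_u=[E]_u$ as vector spaces, in the following sense: for every $\Phi\in\mathcal A_u$ the restriction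 $\Phi|_{E^*}$ is ($\mu$-a.e. equal to) an element of $[E]_u$, and $\Phi\mapsto\Phi|_{E^*}$ is a linear bijection of $\mathcal A_u$ onto $[E]_u$. With this identification the families of norms $\{|||\cdot|||_{\mathcal A_{u,p}};\,p\ge 1\}$ and $\{\|\cdot\|_{u,p};\,p\ge 1\}$ are equivalent: for every real $p\ge 1$ there are a real $q\ge 1$ and a constant $C\ge 0$ (depending only on $u$ and $p$) such that for all $\Phi\in\mathcal A_u$ $$|||\Phi|||_{\mathcal A_{u,p}}\le C\,\|\Phi|_{E^*}\|_{u,q},$$ and for every real $p\ge 1$ there are a real $q\ge 1$ and a constant $C\ge 0$ such that for all $\Phi\in\mathcal A_u$ $$\|\Phi|_{E^*}\|_{u,p}\le C\,|||\Phi|||_{\mathcal A_{u,q}}.$$ -/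

import Mathlib

open MeasureTheory ProbabilityTheory Filter Topology
open scoped SchwartzMap ENNReal NNReal

namespace WhiteNoise
noncomputable section

/-!
# White noise spaces

Contents: the Hermite functions and the operator `A = 1 + t² - d²/dt²` on `S(ℝ)`; the white noise
measure on `S*(ℝ)`; the weight functions; the space `[E]_u` built from the Wiener–Itô expansion;
the space `A_u` of holomorphic functions on the complexified spaces `E*_{p,c}`.
-/

/-! ### Hermite functions -/

theorem pow_mul_exp_bound (P : Polynomial ℝ) :
    ∃ C : ℝ, ∀ t : ℝ, |P.eval t| * Real.exp (-(t ^ 2 / 2)) ≤ C := by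
  have key : ∀ n : ℕ, ∃ C : ℝ, ∀ t : ℝ, |t| ^ n * Real.exp (-(t ^ 2 / 2)) ≤ C := by
    intro n
    refine ⟨(n.factorial : ℝ) * Real.exp (1 / 2), fun t => ?_⟩
    have h1 : |t| ^ n / n.factorial ≤ Real.exp |t| :=
      Real.pow_div_factorial_le_exp _ (abs_nonneg t) n
    have hf : (0 : ℝ) < n.factorial := by positivity
    rw [div_le_iff₀ hf] at h1
    have h2 : Real.exp |t| * Real.exp (-(t ^ 2 / 2)) ≤ Real.exp (1 / 2) := by
      rw [← Real.exp_add]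
      apply Real.exp_le_exp.mpr
      nlinarith [sq_nonneg (|t| - 1), sq_abs t]
    calc |t| ^ n * Real.exp (-(t ^ 2 / 2))
        ≤ Real.exp |t| * n.factorial * Real.exp (-(t ^ 2 / 2)) := by gcongr
      _ = n.factorial * (Real.exp |t| * Real.exp (-(t ^ 2 / 2))) := by ring
      _ ≤ _ := by gcongr
  choose C hC using key
  refine ⟨∑ i ∈ P.support, |P.coeff i| * C i, fun t => ?_⟩
  rw [Polynomial.eval_eq_sum, Polynomial.sum]
  calc _ ≤ (∑ i ∈ P.support, |P.coeff i * t ^ i|) * Real.exp (-(t ^ 2 / 2)) := by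
        gcongr; exact Finset.abs_sum_le_sum_abs _ _
    _ = ∑ i ∈ P.support, |P.coeff i| * (|t| ^ i * Real.exp (-(t ^ 2 / 2))) := by
        rw [Finset.sum_mul]; refine Finset.sum_congr rfl fun i _ => ?_
        rw [abs_mul, abs_pow]; ring
    _ ≤ _ := by gcongr with i _; exact hC i t

/-- The Gaussian `t ↦ exp (-t² / 2)` as a Schwartz function. -/
def gaussian : 𝓢(ℝ, ℝ) where
  toFun t := Real.exp (-(t ^ 2 / 2))
  smooth' := by fun_prop
  decay' k n := by
    obtain ⟨C, hC⟩ := pow_mul_exp_bound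
      (Polynomial.X ^ k * (Polynomial.hermite n).map (Int.castRingHom ℝ))
    refine ⟨C, fun t => ?_⟩
    rw [norm_iteratedFDeriv_eq_norm_iteratedDeriv, iteratedDeriv_eq_iterate,
      Polynomial.deriv_gaussian_eq_hermite_mul_gaussian]
    refine le_trans (le_of_eq ?_) (hC t)
    rw [Polynomial.eval_mul, Polynomial.eval_pow, Polynomial.eval_X, Polynomial.eval_map]
    simp only [norm_mul, norm_pow, Real.norm_eq_abs, abs_mul, abs_pow, abs_neg, abs_one, one_pow,
      one_mul, Real.abs_exp, Polynomial.aeval_def]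
    rw [mul_assoc]
    rfl

/-- Multiplication by the coordinate `t` on real Schwartz functions. -/
def mulT : 𝓢(ℝ, ℝ) →L[ℝ] 𝓢(ℝ, ℝ) := SchwartzMap.smulLeftCLM ℝ (fun t : ℝ => t)

/-- The derivative `d/dt` on real Schwartz functions. -/
def ddt : 𝓢(ℝ, ℝ) →L[ℝ] 𝓢(ℝ, ℝ) := SchwartzMap.derivCLM ℝ ℝ

/-- The operator `A = 1 + t² - d²/dt²` on real Schwartz functions. -/
def opA : 𝓢(ℝ, ℝ) →L[ℝ] 𝓢(ℝ, ℝ) :=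
  ContinuousLinearMap.id ℝ _ + mulT.comp mulT - ddt.comp ddt

/-- The normalized Hermite functions `e_j`, through the creation operator:
`e_0(t) = π^{-1/4} exp (-t²/2)` and `e_{j+1} = (2(j+1))^{-1/2} (t - d/dt) e_j`.
They form an orthonormal basis of `L²(ℝ)` (`hermiteBasis`), and `A e_j = (2j+2) e_j`
(`opA_hermiteFun`). -/
def hermiteFun : ℕ → 𝓢(ℝ, ℝ)
  | 0 => (Real.sqrt (Real.sqrt Real.pi))⁻¹ • gaussian
  | j + 1 => (Real.sqrt (2 * (j + 1)))⁻¹ • (mulT (hermiteFun j) - ddt (hermiteFun j))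

theorem mulT_apply (f : 𝓢(ℝ, ℝ)) (t : ℝ) : mulT f t = t * f t := by
  simp only [mulT]
  rw [SchwartzMap.smulLeftCLM_apply_apply (by fun_prop)]; rfl

theorem ddt_apply (f : 𝓢(ℝ, ℝ)) (t : ℝ) : ddt f t = deriv f t := rfl

theorem ddt_mulT (f : 𝓢(ℝ, ℝ)) : ddt (mulT f) = f + mulT (ddt f) := by
  ext t
  have h : (mulT f : ℝ → ℝ) = fun t => t * f t := by ext t; exact mulT_apply f t
  rw [ddt_apply, h, add_apply, mulT_apply, ddt_apply]
  have : HasDerivAt (fun t : ℝ => t * f t) (1 * f t + t * deriv f t) t :=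
    (hasDerivAt_id t).mul (f.hasDerivAt t)
  rw [this.deriv, one_mul]

theorem lower_zero : mulT (hermiteFun 0) + ddt (hermiteFun 0) = 0 := by
  have : mulT gaussian + ddt gaussian = 0 := by
    ext t
    rw [add_apply, mulT_apply, ddt_apply]
    have h : HasDerivAt (fun t : ℝ => Real.exp (-(t ^ 2 / 2))) (-t * gaussian t) t := by
      have h1 : HasDerivAt (fun t : ℝ => -(t ^ 2 / 2)) (-t) t := by
        have := ((hasDerivAt_pow 2 t).div_const 2).neg
        refine this.congr_deriv ?_
        simp
      refine h1.exp.congr_deriv ?_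
      show Real.exp _ * -t = -t * Real.exp _
      ring
    have h2 : deriv gaussian t = -t * gaussian t := h.deriv
    rw [h2]; simp
  simp only [hermiteFun, map_smul, ← smul_add, this, smul_zero]

theorem ladder_comm (f : 𝓢(ℝ, ℝ)) : mulT (mulT f - ddt f) + ddt (mulT f - ddt f)
    = (2 : ℝ) • f + (mulT (mulT f + ddt f) - ddt (mulT f + ddt f)) := by
  simp only [map_sub, map_add, ddt_mulT]
  module

theorem raise (j : ℕ) : mulT (hermiteFun j) - ddt (hermiteFun j)
    = Real.sqrt (2 * ((j : ℝ) + 1)) • hermiteFun (j + 1) := by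
  have hs' : Real.sqrt (2 * ((j : ℝ) + 1)) ≠ 0 := by positivity
  rw [hermiteFun, smul_smul, mul_inv_cancel₀ hs', one_smul]

theorem lower_succ (j : ℕ) : mulT (hermiteFun (j + 1)) + ddt (hermiteFun (j + 1)) =
    Real.sqrt (2 * (j + 1)) • hermiteFun j := by
  have hs : Real.sqrt (2 * ((j : ℝ) + 1)) ≠ 0 := by positivity
  have e : Real.sqrt (2 * ((j : ℝ) + 1)) = (Real.sqrt (2 * ((j : ℝ) + 1)))⁻¹ * (2 * (j + 1)) := by
    field_simp; rw [Real.sq_sqrt (by positivity)]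
  rw [e, mul_smul]
  conv_lhs => rw [hermiteFun]
  simp only [map_smul]
  rw [← smul_add]
  congr 1
  rw [ladder_comm]
  induction j with
  | zero => rw [lower_zero]; simp
  | succ j ih =>
    have hs' : Real.sqrt (2 * ((j : ℝ) + 1)) ≠ 0 := by positivity
    have ih' : mulT (hermiteFun (j + 1)) + ddt (hermiteFun (j + 1)) =
        Real.sqrt (2 * (j + 1)) • hermiteFun j := by
      have e : Real.sqrt (2 * ((j : ℝ) + 1))
          = (Real.sqrt (2 * ((j : ℝ) + 1)))⁻¹ * (2 * (j + 1)) := by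
        field_simp; rw [Real.sq_sqrt (by positivity)]
      rw [e, mul_smul, ← ih hs' e]
      conv_lhs => rw [hermiteFun]
      simp only [map_smul]
      rw [← smul_add, ladder_comm]
    rw [ih', map_smul, map_smul, ← smul_sub, raise, smul_smul,
      Real.mul_self_sqrt (by positivity)]
    push_cast
    module

theorem opA_hermiteFun (j : ℕ) : opA (hermiteFun j) = (2 * j + 2 : ℝ) • hermiteFun j := by
  have h : opA (hermiteFun j) = mulT (mulT (hermiteFun j) - ddt (hermiteFun j))
      + ddt (mulT (hermiteFun j) - ddt (hermiteFun j)) := by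
    simp only [opA, map_sub, ddt_mulT, add_apply,
      sub_apply, ContinuousLinearMap.comp_apply, ContinuousLinearMap.id_apply]
    module
  rw [h, raise, map_smul, map_smul, ← smul_add, lower_succ, smul_smul,
    Real.mul_self_sqrt (by positivity)]
  congr 1; ring


/-- The `L²(ℝ)` scalar product of two real Schwartz functions. -/
def dotp (f g : 𝓢(ℝ, ℝ)) : ℝ := ∫ t, f t * g t

theorem dotp_eq_inner (f g : 𝓢(ℝ, ℝ)) :
    dotp f g = inner ℝ (f.toLp 2 volume) (g.toLp 2 volume) := by
  rw [L2.inner_def]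
  apply integral_congr_ae
  filter_upwards [f.coeFn_toLp 2 volume, g.coeFn_toLp 2 volume] with t hf hg
  rw [hf, hg]
  simp [mul_comm]

theorem toLp_add (f g : 𝓢(ℝ, ℝ)) :
    (f + g).toLp 2 volume = f.toLp 2 volume + g.toLp 2 volume := rfl

theorem toLp_smul (c : ℝ) (g : 𝓢(ℝ, ℝ)) :
    (c • g).toLp 2 volume = c • g.toLp 2 volume := rfl

theorem dotp_comm (f g : 𝓢(ℝ, ℝ)) : dotp f g = dotp g f := by
  simp only [dotp, mul_comm]

theorem dotp_add_left (f g h : 𝓢(ℝ, ℝ)) : dotp (f + g) h = dotp f h + dotp g h := by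
  simp only [dotp_eq_inner, toLp_add, inner_add_left]

theorem dotp_smul_left (c : ℝ) (f g : 𝓢(ℝ, ℝ)) : dotp (c • f) g = c * dotp f g := by
  simp only [dotp_eq_inner, toLp_smul, real_inner_smul_left]

theorem dotp_sub_left (f g h : 𝓢(ℝ, ℝ)) : dotp (f - g) h = dotp f h - dotp g h := by
  have : f - g = f + (-1 : ℝ) • g := by module
  rw [this, dotp_add_left, dotp_smul_left]; ring

theorem dotp_mulT (f g : 𝓢(ℝ, ℝ)) : dotp (mulT f) g = dotp f (mulT g) := by
  simp only [dotp, mulT_apply]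
  congr 1; ext t; ring

theorem dotp_ddt (f g : 𝓢(ℝ, ℝ)) : dotp (ddt f) g = - dotp f (ddt g) := by
  have := SchwartzMap.integral_mul_deriv_eq_neg_deriv_mul f g
  simp only [dotp, ddt_apply]
  rw [this, neg_neg]

theorem dotp_opA (f g : 𝓢(ℝ, ℝ)) : dotp (opA f) g = dotp f (opA g) := by
  have h (f : 𝓢(ℝ, ℝ)) : opA f = f + mulT (mulT f) - ddt (ddt f) := rfl
  have h1 : dotp (mulT (mulT f)) g = dotp f (mulT (mulT g)) := by rw [dotp_mulT, dotp_mulT]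
  have h2 : dotp (ddt (ddt f)) g = dotp f (ddt (ddt g)) := by rw [dotp_ddt, dotp_ddt, neg_neg]
  rw [h, dotp_sub_left, dotp_add_left, h1, h2, h, dotp_comm f (_ - _), dotp_sub_left,
    dotp_add_left, dotp_comm g, dotp_comm f (mulT _), dotp_comm f (ddt _)]

theorem dotp_raise (f g : 𝓢(ℝ, ℝ)) : dotp (mulT f - ddt f) g = dotp f (mulT g + ddt g) := by
  rw [dotp_sub_left, dotp_mulT, dotp_ddt, dotp_comm f (_ + _), dotp_add_left, dotp_comm f,
    dotp_comm f]; ring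

theorem dotp_hermiteFun_self (j : ℕ) : dotp (hermiteFun j) (hermiteFun j) = 1 := by
  induction j with
  | zero =>
    simp only [hermiteFun]
    rw [dotp_smul_left, dotp_comm, dotp_smul_left]
    have : dotp gaussian gaussian = Real.sqrt Real.pi := by
      have h := integral_gaussian 1
      rw [div_one] at h
      rw [← h, dotp]
      congr 1; ext t
      show Real.exp _ * Real.exp _ = _
      rw [← Real.exp_add]; congr 1; ring
    rw [this, ← mul_assoc, ← mul_inv, Real.mul_self_sqrt (by positivity)]
    exact inv_mul_cancel₀ (by positivity)
  | succ j ih =>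
    have hs' : Real.sqrt (2 * ((j : ℝ) + 1)) ≠ 0 := by positivity
    conv_lhs => arg 1; rw [hermiteFun]
    rw [dotp_smul_left, dotp_raise, lower_succ, dotp_comm, dotp_smul_left, ih, mul_one,
      inv_mul_cancel₀ hs']

theorem dotp_hermiteFun_ne {j k : ℕ} (h : j ≠ k) : dotp (hermiteFun j) (hermiteFun k) = 0 := by
  have := dotp_opA (hermiteFun j) (hermiteFun k)
  rw [opA_hermiteFun, opA_hermiteFun, dotp_smul_left, dotp_comm _ (_ • _), dotp_smul_left,
    dotp_comm (hermiteFun k)] at this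
  have h2 : ((j : ℝ) - k) ≠ 0 := sub_ne_zero.mpr (by exact_mod_cast h)
  have h3 : ((j : ℝ) - k) * dotp (hermiteFun j) (hermiteFun k) = 0 := by linarith
  exact (mul_eq_zero.mp h3).resolve_left h2

/-- The Hermite functions as elements of `L²(ℝ)`. -/
def hermiteL2 (j : ℕ) : Lp ℝ 2 (volume : Measure ℝ) := (hermiteFun j).toLp 2 volume

theorem orthonormal_hermiteL2 : Orthonormal ℝ hermiteL2 := by
  rw [orthonormal_iff_ite]
  intro j k
  rw [hermiteL2, hermiteL2, ← dotp_eq_inner]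
  split_ifs with h
  · rw [h, dotp_hermiteFun_self]
  · exact dotp_hermiteFun_ne h

theorem mulT_mem_span {f : 𝓢(ℝ, ℝ)} (hf : f ∈ Submodule.span ℝ (Set.range hermiteFun)) :
    mulT f ∈ Submodule.span ℝ (Set.range hermiteFun) := by
  induction hf using Submodule.span_induction with
  | mem f h =>
    obtain ⟨j, rfl⟩ := h
    have hmem : ∀ j, hermiteFun j ∈ Submodule.span ℝ (Set.range hermiteFun) :=
      fun j => Submodule.subset_span ⟨j, rfl⟩
    have e : mulT (hermiteFun j) = (1 / 2 : ℝ) • ((mulT (hermiteFun j) - ddt (hermiteFun j))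
        + (mulT (hermiteFun j) + ddt (hermiteFun j))) := by module
    rw [e, raise]
    refine Submodule.smul_mem _ _ (Submodule.add_mem _ (Submodule.smul_mem _ _ (hmem _)) ?_)
    cases j with
    | zero => rw [lower_zero]; exact Submodule.zero_mem _
    | succ j => rw [lower_succ]; exact Submodule.smul_mem _ _ (hmem _)
  | zero => rw [map_zero]; exact Submodule.zero_mem _
  | add f g _ _ hf hg => rw [map_add]; exact Submodule.add_mem _ hf hg
  | smul c f _ hf => rw [map_smul]; exact Submodule.smul_mem _ _ hf

theorem mulT_iterate_apply (k : ℕ) (f : 𝓢(ℝ, ℝ)) (t : ℝ) : (mulT^[k] f) t = t ^ k * f t := by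
  induction k with
  | zero => simp
  | succ k ih => rw [Function.iterate_succ_apply', mulT_apply, ih]; ring

theorem mulT_iterate_mem (n : ℕ) :
    mulT^[n] gaussian ∈ Submodule.span ℝ (Set.range hermiteFun) := by
  induction n with
  | zero =>
    have h : (Real.sqrt (Real.sqrt Real.pi)) ≠ 0 := by positivity
    have : gaussian = (Real.sqrt (Real.sqrt Real.pi)) • hermiteFun 0 := by
      rw [hermiteFun, smul_smul, mul_inv_cancel₀ h, one_smul]
    simp only [Function.iterate_zero, id]
    rw [this]
    exact Submodule.smul_mem _ _ (Submodule.subset_span ⟨0, rfl⟩)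
  | succ n ih => rw [Function.iterate_succ_apply']; exact mulT_mem_span ih

theorem integrable_exp_mul (g : Lp ℝ 2 (volume : Measure ℝ)) (s : ℝ) :
    Integrable (fun t => Real.exp (s * |t|) * (g t * Real.exp (-(t ^ 2 / 2)))) := by
  have h1 : MemLp (fun t : ℝ => Real.exp (s * |t|) * Real.exp (-(t ^ 2 / 2))) 2 := by
    rw [memLp_two_iff_integrable_sq (by fun_prop)]
    refine ((integrable_exp_neg_mul_sq (b := 1 / 2) (by norm_num)).const_mul
      (Real.exp (2 * s ^ 2))).mono' (by fun_prop) (ae_of_all _ fun t => ?_)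
    rw [Real.norm_of_nonneg (by positivity), ← Real.exp_add, ← Real.exp_add, ← Real.exp_nat_mul]
    apply Real.exp_le_exp.mpr
    push_cast
    nlinarith [sq_nonneg (|t| - 2 * s), sq_abs t]
  have := h1.integrable_mul (Lp.memLp g)
  refine this.congr (ae_of_all _ fun t => ?_)
  simp only [Pi.mul_apply]; ring

theorem integral_moment_zero {g : Lp ℝ 2 (volume : Measure ℝ)}
    (hg : ∀ j, inner ℝ (hermiteL2 j) g = 0) (n : ℕ) :
    ∫ t, t ^ n * (g t * Real.exp (-(t ^ 2 / 2))) = 0 := by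
  have key : ∀ f ∈ Submodule.span ℝ (Set.range hermiteFun),
      inner ℝ (f.toLp 2 volume) g = 0 := by
    intro f hf
    induction hf using Submodule.span_induction with
    | mem f h => obtain ⟨j, rfl⟩ := h; exact hg j
    | zero =>
      have : (0 : 𝓢(ℝ, ℝ)).toLp 2 volume = 0 := (SchwartzMap.toLpCLM ℝ ℝ 2 volume).map_zero
      rw [this, inner_zero_left]
    | add f h _ _ h1 h2 => rw [toLp_add, inner_add_left, h1, h2, add_zero]
    | smul c f _ h => rw [toLp_smul, real_inner_smul_left, h, mul_zero]
  have := key _ (mulT_iterate_mem n)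
  rw [L2.inner_def] at this
  rw [← this]
  apply integral_congr_ae
  filter_upwards [(mulT^[n] gaussian).coeFn_toLp 2 volume] with t ht
  rw [ht, mulT_iterate_apply]
  simp only [RCLike.inner_apply, conj_trivial]
  show _ = g t * (t ^ n * Real.exp _)
  ring

theorem integral_cexp_zero {g : Lp ℝ 2 (volume : Measure ℝ)}
    (hg : ∀ j, inner ℝ (hermiteL2 j) g = 0) (s : ℝ) :
    ∫ t : ℝ, Complex.exp (t * s * Complex.I) * (g t * Real.exp (-(t ^ 2 / 2)) : ℝ) = 0 := by
  set f : ℝ → ℝ := fun t => g t * Real.exp (-(t ^ 2 / 2)) with hf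
  have hfm : AEStronglyMeasurable f volume := by
    have := Lp.aestronglyMeasurable g
    fun_prop
  have hsum : HasSum (fun n : ℕ => ∫ t : ℝ,
      ((t * s * Complex.I) ^ n / n.factorial) * (f t : ℂ))
      (∫ t : ℝ, Complex.exp (t * s * Complex.I) * (f t : ℂ)) := by
    refine hasSum_integral_of_dominated_convergence
      (fun n t => ((|s| * |t|) ^ n / n.factorial) * |f t|) (fun n => ?_) (fun n => ?_) ?_ ?_ ?_
    · have : AEStronglyMeasurable (fun t => (f t : ℂ)) volume :=
        Complex.continuous_ofReal.comp_aestronglyMeasurable hfm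
      exact AEStronglyMeasurable.mul (by fun_prop) this
    · refine ae_of_all _ fun t => le_of_eq ?_
      simp [mul_pow, mul_comm]
    · exact ae_of_all _ fun t => (Real.summable_pow_div_factorial _).mul_right _
    · refine (integrable_exp_mul g |s|).norm.congr (ae_of_all _ fun t => ?_)
      simp only
      rw [tsum_mul_right, norm_mul, Real.norm_of_nonneg (Real.exp_pos _).le, Real.norm_eq_abs,
        show Real.exp (|s| * |t|) = ∑' n : ℕ, (|s| * |t|) ^ n / n.factorial by
          rw [Real.exp_eq_exp_ℝ, NormedSpace.exp_eq_tsum_div]]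
    · refine ae_of_all _ fun t => HasSum.mul_right _ ?_
      have := NormedSpace.expSeries_div_hasSum_exp (𝔸 := ℂ) (t * s * Complex.I)
      rwa [← Complex.exp_eq_exp_ℂ] at this
  have hz : ∀ n : ℕ, ∫ t : ℝ, ((t * s * Complex.I) ^ n / n.factorial) * (f t : ℂ) = 0 := by
    intro n
    have h1 : ∀ t : ℝ, ((t * s * Complex.I) ^ n / n.factorial) * (f t : ℂ)
        = ((s * Complex.I) ^ n / n.factorial) * ((t ^ n * f t : ℝ) : ℂ) := by
      intro t; push_cast; ring
    simp_rw [h1]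
    rw [integral_const_mul, integral_complex_ofReal, integral_moment_zero hg n]
    simp
  simp_rw [hz] at hsum
  exact hsum.unique hasSum_zero

theorem eq_zero_of_inner_hermiteL2 {g : Lp ℝ 2 (volume : Measure ℝ)}
    (hg : ∀ j, inner ℝ (hermiteL2 j) g = 0) : g = 0 := by
  set f : ℝ → ℝ := fun t => g t * Real.exp (-(t ^ 2 / 2)) with hf
  have hfi : Integrable f := by simpa using integrable_exp_mul g 0
  have fin : ∀ h : ℝ → ℝ, Integrable h →
      IsFiniteMeasure (volume.withDensity fun t => ENNReal.ofReal (h t)) := by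
    intro h hh
    exact isFiniteMeasure_withDensity_ofReal hh.2
  have := fin f hfi
  have := fin (fun t => -f t) hfi.neg
  have hm : AEMeasurable f volume := hfi.aemeasurable
  have hm' : AEMeasurable (fun t => -f t) volume := hm.neg
  have heq : (volume.withDensity fun t => ENNReal.ofReal (f t))
      = volume.withDensity fun t => ENNReal.ofReal (-f t) := by
    apply Measure.ext_of_charFun
    ext s
    rw [charFun_apply, charFun_apply,
      integral_withDensity_eq_integral_toReal_smul₀ hm.ennreal_ofReal
        (ae_of_all _ fun t => ENNReal.ofReal_lt_top),
      integral_withDensity_eq_integral_toReal_smul₀ hm'.ennreal_ofReal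
        (ae_of_all _ fun t => ENNReal.ofReal_lt_top), ← sub_eq_zero, ← integral_sub]
    · rw [← integral_cexp_zero hg s]
      congr 1; ext t
      rw [← sub_smul, ENNReal.toReal_ofReal', ENNReal.toReal_ofReal', max_zero_sub_max_neg_zero_eq_self]
      simp [hf, mul_comm]
    all_goals
      refine (hfi.norm).mono' ?_ (ae_of_all _ fun t => ?_)
      · apply AEMeasurable.aestronglyMeasurable
        fun_prop
      · rw [norm_smul]
        have : ‖Complex.exp (((inner ℝ t s : ℝ) : ℂ) * Complex.I)‖ = 1 :=
          Complex.norm_exp_ofReal_mul_I _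
        rw [this, mul_one, ENNReal.toReal_ofReal', Real.norm_of_nonneg (le_max_right _ _),
          Real.norm_eq_abs]
        first
          | exact max_le (le_abs_self _) (abs_nonneg _)
          | exact max_le (neg_le_abs _) (abs_nonneg _)
  rw [withDensity_eq_iff_of_sigmaFinite hm.ennreal_ofReal hm'.ennreal_ofReal] at heq
  rw [Lp.eq_zero_iff_ae_eq_zero]
  filter_upwards [heq] with t ht
  have h0 : f t = 0 := by
    have := congrArg ENNReal.toReal ht
    rw [ENNReal.toReal_ofReal', ENNReal.toReal_ofReal'] at this
    have h2 := max_zero_sub_max_neg_zero_eq_self (f t)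
    rw [this, sub_self] at h2; exact h2.symm
  exact (mul_eq_zero.mp h0).resolve_right (Real.exp_pos _).ne'

/-- The Hermite functions form an orthonormal basis of `L²(ℝ)`. -/
def hermiteBasis : HilbertBasis ℕ ℝ (Lp ℝ 2 (volume : Measure ℝ)) :=
  HilbertBasis.mkOfOrthogonalEqBot orthonormal_hermiteL2 (by
    rw [Submodule.eq_bot_iff]
    intro g hg
    apply eq_zero_of_inner_hermiteL2
    intro j
    exact (Submodule.mem_orthogonal _ _).mp hg _ (Submodule.subset_span ⟨j, rfl⟩))

theorem hermiteBasis_apply (j : ℕ) : hermiteBasis j = hermiteL2 j := by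
  rw [hermiteBasis, HilbertBasis.coe_mkOfOrthogonalEqBot]

theorem repr_toLp (ξ : 𝓢(ℝ, ℝ)) (j : ℕ) :
    hermiteBasis.repr (ξ.toLp 2 volume) j = dotp ξ (hermiteFun j) := by
  rw [HilbertBasis.repr_apply_apply, hermiteBasis_apply, hermiteL2, ← dotp_eq_inner, dotp_comm]

theorem hasSum_sq (ξ : 𝓢(ℝ, ℝ)) :
    HasSum (fun j => dotp ξ (hermiteFun j) ^ 2) (∫ t, ξ t ^ 2) := by
  have := hermiteBasis.hasSum_inner_mul_inner (ξ.toLp 2 volume) (ξ.toLp 2 volume)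
  rw [← dotp_eq_inner] at this
  have e : dotp ξ ξ = ∫ t, ξ t ^ 2 := by simp only [dotp, sq]
  rw [← e]
  refine this.congr_fun fun j => ?_
  rw [hermiteBasis_apply, hermiteL2, ← dotp_eq_inner, ← dotp_eq_inner, dotp_comm (hermiteFun j), sq]


/-- The squared weighted norm `∑_j (2j+2)^p ⟨f, e_j⟩²`. -/
def weightedSq (p : ℕ) (f : 𝓢(ℝ, ℝ)) : ℝ≥0∞ :=
  ∑' j : ℕ, ENNReal.ofReal ((2 * j + 2) ^ p * dotp f (hermiteFun j) ^ 2)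

theorem weightedSq_zero (f : 𝓢(ℝ, ℝ)) : weightedSq 0 f = ENNReal.ofReal (∫ t, f t ^ 2) := by
  simp only [weightedSq, pow_zero, one_mul]
  rw [← (hasSum_sq f).tsum_eq, ENNReal.ofReal_tsum_of_nonneg (fun _ => sq_nonneg _)
    (hasSum_sq f).summable]

theorem weightedSq_add (p : ℕ) (f g : 𝓢(ℝ, ℝ)) :
    weightedSq p (f + g) ≤ 2 * (weightedSq p f + weightedSq p g) := by
  simp only [weightedSq]
  rw [← ENNReal.tsum_add, ← ENNReal.tsum_mul_left]
  refine ENNReal.tsum_le_tsum fun j => ?_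
  rw [← ENNReal.ofReal_add (by positivity) (by positivity), ← ENNReal.ofReal_ofNat,
    ← ENNReal.ofReal_mul (by norm_num), dotp_add_left, ← mul_add]
  apply ENNReal.ofReal_le_ofReal
  rw [mul_left_comm]
  gcongr
  nlinarith [sq_nonneg (dotp f (hermiteFun j) - dotp g (hermiteFun j))]

theorem weightedSq_smul (p : ℕ) (c : ℝ) (f : 𝓢(ℝ, ℝ)) :
    weightedSq p (c • f) = ENNReal.ofReal (c ^ 2) * weightedSq p f := by
  simp only [weightedSq]
  rw [← ENNReal.tsum_mul_left]
  congr 1; ext j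
  rw [← ENNReal.ofReal_mul (by positivity), dotp_smul_left]
  congr 1; ring

theorem dotp_sub_right (f g h : 𝓢(ℝ, ℝ)) : dotp f (g - h) = dotp f g - dotp f h := by
  rw [dotp_comm, dotp_sub_left, dotp_comm g, dotp_comm h]

theorem dotp_smul_right (c : ℝ) (f g : 𝓢(ℝ, ℝ)) : dotp f (c • g) = c * dotp f g := by
  rw [dotp_comm, dotp_smul_left, dotp_comm]

theorem weightedSq_raise (p : ℕ) (f : 𝓢(ℝ, ℝ)) :
    weightedSq p (mulT f - ddt f) ≤ 2 ^ p * weightedSq (p + 1) f := by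
  have h0 : dotp (mulT f - ddt f) (hermiteFun 0) = 0 := by
    rw [dotp_raise, lower_zero, dotp]; simp
  rw [weightedSq, tsum_eq_zero_add' ENNReal.summable, h0]
  simp only [weightedSq]
  rw [← ENNReal.tsum_mul_left]
  simp only [ne_eq, OfNat.ofNat_ne_zero, not_false_eq_true, zero_pow, mul_zero, ENNReal.ofReal_zero,
    zero_add]
  refine ENNReal.tsum_le_tsum fun j => ?_
  rw [← ENNReal.ofReal_ofNat, ← ENNReal.ofReal_pow (by norm_num), ← ENNReal.ofReal_mul (by positivity)]
  apply ENNReal.ofReal_le_ofReal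
  rw [dotp_raise, lower_succ, dotp_smul_right, mul_pow, Real.sq_sqrt (by positivity)]
  have hj : (0 : ℝ) ≤ j := Nat.cast_nonneg j
  have h1 : (2 * ((j + 1 : ℕ) : ℝ) + 2) ^ p ≤ 2 ^ p * (2 * j + 2) ^ p := by
    rw [← mul_pow]; push_cast; gcongr; linarith
  calc (2 * ((j + 1 : ℕ) : ℝ) + 2) ^ p * (2 * (j + 1) * dotp f (hermiteFun j) ^ 2)
      ≤ (2 ^ p * (2 * j + 2) ^ p) * (2 * (j + 1) * dotp f (hermiteFun j) ^ 2) := by gcongr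
    _ = _ := by ring

theorem weightedSq_lower (p : ℕ) (f : 𝓢(ℝ, ℝ)) :
    weightedSq p (mulT f + ddt f) ≤ weightedSq (p + 1) f := by
  have h : ∀ j, dotp (mulT f + ddt f) (hermiteFun j)
      = Real.sqrt (2 * (j + 1)) * dotp f (hermiteFun (j + 1)) := by
    intro j
    rw [dotp_comm, ← dotp_raise, raise, dotp_smul_left, dotp_comm]
  conv_rhs => rw [weightedSq, tsum_eq_zero_add' ENNReal.summable]
  refine le_trans ?_ le_add_self
  refine ENNReal.tsum_le_tsum fun j => ?_
  apply ENNReal.ofReal_le_ofReal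
  rw [h, mul_pow, Real.sq_sqrt (by positivity)]
  have hj : (0 : ℝ) ≤ j := Nat.cast_nonneg j
  have h1 : (2 * (j : ℝ) + 2) ^ p * (2 * (j + 1)) ≤ (2 * ((j + 1 : ℕ) : ℝ) + 2) ^ (p + 1) := by
    rw [pow_succ]; push_cast; gcongr <;> linarith
  rw [← mul_assoc]
  gcongr

theorem weightedSq_ladder (p : ℕ) (f : 𝓢(ℝ, ℝ)) :
    weightedSq p (mulT f) ≤ 2 ^ (p + 2) * weightedSq (p + 1) f ∧
    weightedSq p (ddt f) ≤ 2 ^ (p + 2) * weightedSq (p + 1) f := by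
  have e1 : mulT f = (1 / 2 : ℝ) • ((mulT f - ddt f) + (mulT f + ddt f)) := by module
  have e2 : ddt f = (1 / 2 : ℝ) • ((-1 : ℝ) • (mulT f - ddt f) + (mulT f + ddt f)) := by module
  have b : 2 * (weightedSq p (mulT f - ddt f) + weightedSq p (mulT f + ddt f))
      ≤ 2 ^ (p + 2) * weightedSq (p + 1) f := by
    have h1 := weightedSq_raise p f
    have h2 := weightedSq_lower p f
    have h3 : weightedSq (p + 1) f ≤ 2 ^ p * weightedSq (p + 1) f :=
      le_mul_of_one_le_left zero_le (one_le_pow₀ (by norm_num))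
    calc _ ≤ 2 * (2 ^ p * weightedSq (p + 1) f + 2 ^ p * weightedSq (p + 1) f) := by
          gcongr; exact h2.trans h3
      _ = _ := by ring
  have hc : ENNReal.ofReal ((1 / 2) ^ 2) ≤ 1 := by
    rw [ENNReal.ofReal_le_one]; norm_num
  have hm : weightedSq p ((-1 : ℝ) • (mulT f - ddt f)) = weightedSq p (mulT f - ddt f) := by
    rw [weightedSq_smul]; simp
  constructor
  · rw [e1, weightedSq_smul]
    exact (mul_le_of_le_one_left zero_le hc).trans ((weightedSq_add _ _ _).trans b)
  · conv_lhs => rw [e2]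
    rw [weightedSq_smul]
    refine (mul_le_of_le_one_left zero_le hc).trans ((weightedSq_add _ _ _).trans ?_)
    rw [hm]; exact b

theorem dotp_opA_iterate (k : ℕ) (f : 𝓢(ℝ, ℝ)) (j : ℕ) :
    dotp (opA^[k] f) (hermiteFun j) = (2 * j + 2) ^ k * dotp f (hermiteFun j) := by
  induction k with
  | zero => simp
  | succ k ih =>
    rw [Function.iterate_succ_apply', dotp_opA, opA_hermiteFun, dotp_smul_right, ih]; ring

theorem weightedSq_lt_top (p : ℕ) (f : 𝓢(ℝ, ℝ)) : weightedSq p f < ∞ := by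
  have h : weightedSq p f ≤ weightedSq 0 (opA^[p] f) := by
    refine ENNReal.tsum_le_tsum fun j => ENNReal.ofReal_le_ofReal ?_
    rw [dotp_opA_iterate, pow_zero, one_mul, mul_pow, ← pow_mul, mul_comm p 2]
    gcongr
    · linarith [(Nat.cast_nonneg j : (0 : ℝ) ≤ j)]
    · omega
  refine h.trans_lt ?_
  rw [weightedSq_zero]; exact ENNReal.ofReal_lt_top

/-- `N`-th partial sum of the Hermite expansion. -/
def partialSum (f : 𝓢(ℝ, ℝ)) (N : ℕ) : 𝓢(ℝ, ℝ) :=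
  ∑ j ∈ Finset.range N, dotp f (hermiteFun j) • hermiteFun j

theorem dotp_partialSum (f : 𝓢(ℝ, ℝ)) (N j : ℕ) : dotp (partialSum f N) (hermiteFun j)
    = if j < N then dotp f (hermiteFun j) else 0 := by
  induction N with
  | zero => simp [partialSum, dotp]
  | succ N ih =>
    rw [partialSum, Finset.sum_range_succ, dotp_add_left, ← partialSum, ih, dotp_smul_left]
    rcases lt_trichotomy j N with h | h | h
    · rw [dotp_hermiteFun_ne h.ne', if_pos h, if_pos (by omega)]; ring
    · subst h; rw [dotp_hermiteFun_self]; simp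
    · rw [dotp_hermiteFun_ne h.ne, if_neg (by omega), if_neg (by omega)]; ring

theorem tendsto_weightedSq (p : ℕ) (f : 𝓢(ℝ, ℝ)) :
    Tendsto (fun N => weightedSq p (partialSum f N - f)) atTop (𝓝 0) := by
  have h := ENNReal.tendsto_sum_nat_add
    (fun j : ℕ => ENNReal.ofReal ((2 * j + 2) ^ p * dotp f (hermiteFun j) ^ 2))
    (weightedSq_lt_top p f).ne
  refine h.congr fun N => ?_
  have e : ∀ j : ℕ, dotp (partialSum f N - f) (hermiteFun j) ^ 2
      = if j < N then 0 else dotp f (hermiteFun j) ^ 2 := by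
    intro j
    rw [dotp_sub_left, dotp_partialSum]
    split_ifs <;> ring
  rw [weightedSq, ← Summable.sum_add_tsum_nat_add' (k := N) (f := fun j : ℕ =>
    ENNReal.ofReal ((2 * j + 2) ^ p * dotp (partialSum f N - f) (hermiteFun j) ^ 2))
    ENNReal.summable, Finset.sum_eq_zero, zero_add]
  · congr 1; ext j
    rw [e, if_neg (by omega)]
  · intro j hj
    rw [e, if_pos (Finset.mem_range.mp hj)]; simp

/-- A sequence of Schwartz functions all of whose weighted norms tend to zero. -/
def IsNull (F : ℕ → 𝓢(ℝ, ℝ)) : Prop :=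
  ∀ p, Tendsto (fun N => weightedSq p (F N)) atTop (𝓝 0)

theorem isNull_of_le {F G : ℕ → 𝓢(ℝ, ℝ)} (hF : IsNull F)
    (h : ∀ p N, weightedSq p (G N) ≤ 2 ^ (p + 2) * weightedSq (p + 1) (F N)) : IsNull G := by
  intro p
  have := ENNReal.Tendsto.const_mul (a := 2 ^ (p + 2)) (hF (p + 1)) (Or.inr (by finiteness))
  rw [mul_zero] at this
  exact tendsto_of_tendsto_of_tendsto_of_le_of_le tendsto_const_nhds this (fun _ => zero_le)
    (fun N => h p N)

theorem IsNull.iterate {F : ℕ → 𝓢(ℝ, ℝ)} (hF : IsNull F) (k n : ℕ) :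
    IsNull fun N => mulT^[k] (ddt^[n] (F N)) := by
  induction k with
  | zero =>
    induction n with
    | zero => exact hF
    | succ n ih =>
      simp only [Function.iterate_succ_apply']
      exact isNull_of_le ih fun p N => (weightedSq_ladder p _).2
  | succ k ih =>
    simp only [Function.iterate_succ_apply']
    exact isNull_of_le ih fun p N => (weightedSq_ladder p _).1

theorem sq_apply_le (g : 𝓢(ℝ, ℝ)) (t : ℝ) :
    g t ^ 2 ≤ (∫ s, g s ^ 2) + ∫ s, ddt g s ^ 2 := by
  have hi : ∀ g : 𝓢(ℝ, ℝ), Integrable fun s => g s ^ 2 := fun g =>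
    (memLp_two_iff_integrable_sq g.continuous.aestronglyMeasurable).mp (g.memLp 2 volume)
  have hsum := (hi g).add (hi (ddt g))
  have hd : ∀ s, HasDerivAt (fun s => g s ^ 2) (2 * g s * ddt g s) s := by
    intro s
    have := (g.hasDerivAt s).fun_pow 2
    refine this.congr_deriv ?_
    rw [ddt_apply]; simp
  have hint : Integrable fun s => 2 * g s * ddt g s := by
    refine hsum.mono' ?_ (ae_of_all _ fun s => ?_)
    · exact Continuous.aestronglyMeasurable
        ((continuous_const.mul g.continuous).mul (ddt g).continuous)
    · simp only [Pi.add_apply, Real.norm_eq_abs]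
      rw [abs_le]
      constructor <;> nlinarith [sq_nonneg (g s - ddt g s), sq_nonneg (g s + ddt g s)]
  have hz : Tendsto (fun s => g s ^ 2) atBot (𝓝 0) := by
    have h1 : Tendsto g (cocompact ℝ) (𝓝 0) := g.tendsto_cocompact
    have h2 := (h1.mono_left atBot_le_cocompact).pow 2
    simpa using h2
  have := integral_Iic_of_hasDerivAt_of_tendsto' (a := t) (fun s _ => hd s) hint.integrableOn hz
  rw [sub_zero] at this
  rw [← this, ← integral_add (hi g) (hi (ddt g))]
  calc _ ≤ ∫ s in Set.Iic t, (g s ^ 2 + ddt g s ^ 2) :=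
        integral_mono hint.restrict hsum.restrict fun s => by
          nlinarith [sq_nonneg (g s - ddt g s)]
    _ ≤ _ := setIntegral_le_integral hsum (ae_of_all _ fun s => by positivity)

theorem ddt_iterate_apply (n : ℕ) (f : 𝓢(ℝ, ℝ)) (t : ℝ) :
    (ddt^[n] f) t = iteratedDeriv n f t := by
  induction n generalizing t with
  | zero => simp
  | succ n ih =>
    rw [Function.iterate_succ_apply', ddt_apply, iteratedDeriv_succ]
    congr 1; ext s; exact ih s

theorem IsNull.tendsto {F : ℕ → 𝓢(ℝ, ℝ)} (hF : IsNull F) : Tendsto F atTop (𝓝 0) := by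
  rw [(schwartz_withSeminorms ℝ ℝ ℝ).tendsto_nhds]
  rintro ⟨k, n⟩ ε hε
  have h0 := (hF.iterate k n) 0
  have h1 := (isNull_of_le (hF.iterate k n) fun p N => (weightedSq_ladder p _).2) 0
  simp only [weightedSq_zero] at h0 h1
  have h2 := h0.add h1
  rw [add_zero] at h2
  have hpos : (0 : ℝ≥0∞) < ENNReal.ofReal ((ε / 2) ^ 2) := by
    rw [ENNReal.ofReal_pos]; positivity
  filter_upwards [(tendsto_order.1 h2).2 _ hpos] with N hN
  rw [← ENNReal.ofReal_add (integral_nonneg fun _ => sq_nonneg _)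
    (integral_nonneg fun _ => sq_nonneg _)] at hN
  have hN' := (ENNReal.ofReal_lt_ofReal_iff (by positivity)).mp hN
  rw [sub_zero]
  refine lt_of_le_of_lt (SchwartzMap.seminorm_le_bound' ℝ k n (F N) (M := ε / 2)
    (by positivity) fun t => ?_) (by linarith)
  have h3 := (sq_apply_le (mulT^[k] (ddt^[n] (F N))) t).trans hN'.le
  rw [mulT_iterate_apply, ddt_iterate_apply] at h3
  have := abs_le_of_sq_le_sq h3 (by positivity)
  rwa [abs_mul, abs_pow] at this

/-- The Hermite expansion of a Schwartz function converges in `S(ℝ)`. -/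
theorem tendsto_partialSum (f : 𝓢(ℝ, ℝ)) : Tendsto (partialSum f) atTop (𝓝 f) := by
  have h : IsNull fun N => partialSum f N - f := fun p => tendsto_weightedSq p f
  have := h.tendsto.add_const f
  simpa using this

/-! ### The white noise measure -/

/-- The real space `E* = S*(ℝ)` of tempered distributions: the continuous linear functionals on the
space `E = S(ℝ)` of real Schwartz functions. -/
abbrev Dist : Type := 𝓢(ℝ, ℝ) →L[ℝ] ℝ

/-- The `σ`-algebra on `E*` generated by the evaluations `x ↦ ⟨x, ξ⟩`, `ξ ∈ E`. -/
instance : MeasurableSpace Dist := MeasurableSpace.comap (fun x ξ => x ξ) MeasurableSpace.pi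

open Classical in
/-- The tempered distribution `∑_j z_j e_j`, that is `ξ ↦ ∑_j z_j ⟨e_j, ξ⟩` (see `hasSum_synth`),
for a real sequence `z` with `∑_j (2j+2)^{-2} z_j² < ∞`. It is obtained by applying `A` to the element
`∑_j (2j+2)^{-1} z_j e_j` of `L²(ℝ)`. For other sequences, the value is `0`. -/
def synth (z : ℕ → ℝ) : Dist :=
  if h : Memℓp (fun j : ℕ => z j / (2 * j + 2)) 2 then
    (innerSL ℝ (hermiteBasis.repr.symm ⟨fun j : ℕ => z j / (2 * j + 2), h⟩)).comp
      ((SchwartzMap.toLpCLM ℝ ℝ 2 volume).comp opA)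
  else 0

theorem hasSum_synth {z : ℕ → ℝ} (h : Memℓp (fun j : ℕ => z j / (2 * j + 2)) 2) (ξ : 𝓢(ℝ, ℝ)) :
    HasSum (fun j => z j * dotp ξ (hermiteFun j)) (synth z ξ) := by
  rw [synth, dif_pos h]
  simp only [ContinuousLinearMap.comp_apply, innerSL_apply_apply, SchwartzMap.toLpCLM_apply]
  rw [← LinearIsometryEquiv.inner_map_map hermiteBasis.repr, LinearIsometryEquiv.apply_symm_apply]
  refine (lp.hasSum_inner _ _).congr_fun fun j => ?_
  have e : dotp (opA ξ) (hermiteFun j) = (2 * j + 2) * dotp ξ (hermiteFun j) := by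
    rw [dotp_opA, opA_hermiteFun, dotp_comm, dotp_smul_left, dotp_comm]
  rw [repr_toLp, e]
  have : (2 * j + 2 : ℝ) ≠ 0 := by positivity
  show _ = (2 * j + 2) * dotp ξ (hermiteFun j) * (z j / (2 * j + 2))
  field_simp

theorem memlp_iff (z : ℕ → ℝ) : Memℓp (fun j : ℕ => z j / (2 * j + 2)) 2 ↔
    ∑' j : ℕ, ENNReal.ofReal ((z j / (2 * j + 2)) ^ 2) ≠ ∞ := by
  rw [memℓp_gen_iff (by norm_num)]
  have : ∀ j : ℕ, ‖z j / (2 * j + 2)‖ ^ (2 : ℝ≥0∞).toReal = (z j / (2 * j + 2)) ^ 2 := by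
    intro j
    rw [ENNReal.toReal_ofNat, Real.rpow_ofNat, Real.norm_eq_abs, sq_abs]
  simp_rw [this]
  constructor
  · exact fun h => h.tsum_ofReal_ne_top
  · intro h
    have := ENNReal.summable_toReal h
    refine this.congr fun j => ?_
    rw [ENNReal.toReal_ofReal (by positivity)]

/-- The law of a sequence of independent standard normal random variables. -/
def iidGaussian : Measure (ℕ → ℝ) := Measure.infinitePi fun _ => gaussianReal 0 1

instance : IsProbabilityMeasure iidGaussian := by unfold iidGaussian; infer_instance

theorem measurableSet_memlp :
    MeasurableSet {z : ℕ → ℝ | Memℓp (fun j : ℕ => z j / (2 * j + 2)) 2} := by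
  simp_rw [memlp_iff]
  apply MeasurableSet.compl (s := {z : ℕ → ℝ | ∑' j : ℕ, ENNReal.ofReal ((z j / (2 * j + 2)) ^ 2) = ∞})
  exact measurableSet_eq_fun (by fun_prop) (by fun_prop)

theorem measurable_synth : Measurable synth := by
  rw [measurable_comap_iff, measurable_pi_iff]
  intro ξ
  refine measurable_of_tendsto_metrizable (f := fun N z =>
    Set.indicator {z : ℕ → ℝ | Memℓp (fun j : ℕ => z j / (2 * j + 2)) 2}
      (fun z => ∑ j ∈ Finset.range N, z j * dotp ξ (hermiteFun j)) z) (fun N => ?_) ?_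
  · exact Measurable.indicator (by fun_prop) measurableSet_memlp
  · rw [tendsto_pi_nhds]
    intro z
    by_cases h : Memℓp (fun j : ℕ => z j / (2 * j + 2)) 2
    · simp only [Set.indicator, Set.mem_ofPred_eq, h, if_true]
      exact (hasSum_synth h ξ).tendsto_sum_nat
    · simp [Set.indicator, h, synth]

theorem map_eval_iid (j : ℕ) : iidGaussian.map (fun z => z j) = gaussianReal 0 1 :=
  Measure.infinitePi_map_eval _ j

theorem ae_memlp : ∀ᵐ z : ℕ → ℝ ∂iidGaussian, Memℓp (fun j : ℕ => z j / (2 * j + 2)) 2 := by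
  simp_rw [memlp_iff]
  have hm : Measurable fun z : ℕ → ℝ => ∑' j : ℕ, ENNReal.ofReal ((z j / (2 * j + 2)) ^ 2) := by
    fun_prop
  suffices h : ∫⁻ z, ∑' j : ℕ, ENNReal.ofReal ((z j / (2 * j + 2)) ^ 2) ∂iidGaussian ≠ ∞ by
    filter_upwards [ae_lt_top hm h] with z hz using hz.ne
  rw [lintegral_tsum (fun j => Measurable.aemeasurable (by fun_prop))]
  have h2 : ∫⁻ x : ℝ, ENNReal.ofReal (x ^ 2) ∂(gaussianReal 0 1) = 1 := by
    rw [← ofReal_integral_eq_lintegral_ofReal]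
    · have := variance_id_gaussianReal (μ := 0) (v := 1)
      rw [variance_of_integral_eq_zero (by fun_prop) (by simp)] at this
      simp only [id] at this
      rw [this]; simp
    · exact (memLp_two_iff_integrable_sq (by fun_prop)).mp (memLp_id_gaussianReal 2)
    · exact ae_of_all _ fun x => sq_nonneg x
  have h1 : ∀ j : ℕ, ∫⁻ z, ENNReal.ofReal ((z j / (2 * j + 2)) ^ 2) ∂iidGaussian
      = ENNReal.ofReal ((1 / (2 * j + 2)) ^ 2) := by
    intro j
    have e : ∀ z : ℕ → ℝ, ENNReal.ofReal ((z j / (2 * j + 2)) ^ 2)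
        = ENNReal.ofReal ((1 / (2 * j + 2)) ^ 2) * ENNReal.ofReal (z j ^ 2) := by
      intro z
      rw [← ENNReal.ofReal_mul (by positivity)]; congr 1; ring
    simp_rw [e]
    rw [lintegral_const_mul _ (by fun_prop)]
    have := lintegral_map (μ := iidGaussian) (f := fun x : ℝ => ENNReal.ofReal (x ^ 2))
      (g := fun z : ℕ → ℝ => z j) (by fun_prop) (by fun_prop)
    rw [← this, map_eval_iid, h2, mul_one]
  simp_rw [h1]
  apply Summable.tsum_ofReal_ne_top
  have hs : Summable fun j : ℕ => 1 / ((j : ℝ) + 1) ^ 2 := by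
    have := (summable_nat_add_iff 1).mpr (Real.summable_one_div_nat_pow.mpr (one_lt_two))
    simpa using this
  refine (hs.mul_left (1 / 4)).congr fun j => ?_
  field_simp
  ring

/-- The standard Gaussian measure `μ` on `E*`: the law of `∑_j z_j e_j`, with `z_j` independent
standard normal variables. By `charFun_whiteNoise` it is the (unique) probability measure with
`∫ exp (i⟨x, ξ⟩) μ(dx) = exp (-|ξ|₀² / 2)`. -/
def whiteNoise : Measure Dist := iidGaussian.map synth

instance : IsProbabilityMeasure whiteNoise :=
  Measure.isProbabilityMeasure_map measurable_synth.aemeasurable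

theorem charFun_finset (c : ℕ → ℝ) (N : ℕ) :
    ∫ z, Complex.exp ((∑ j ∈ Finset.range N, z j * c j : ℝ) * Complex.I) ∂iidGaussian
      = Complex.exp (-(∑ j ∈ Finset.range N, c j ^ 2 : ℝ) / 2) := by
  have hind : iIndepFun (fun (j : ℕ) (z : ℕ → ℝ) => z j * c j) iidGaussian :=
    iIndepFun_infinitePi (X := fun j x => x * c j) (by fun_prop)
  have h := iIndepFun.charFun_map_fun_finsetSum_eq_prod (s := Finset.range N)
    (X := fun (j : ℕ) (z : ℕ → ℝ) => z j * c j) (P := iidGaussian)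
    (fun i _ => Measurable.aemeasurable (by fun_prop)) (hind.restrict _)
  have h1 := congrFun h 1
  rw [charFun_apply, integral_map (Measurable.aemeasurable (by fun_prop)) (by fun_prop)] at h1
  simp only [RCLike.inner_apply, conj_trivial, one_mul] at h1
  rw [h1, Finset.prod_apply]
  have : ∀ j, charFun (iidGaussian.map fun z => z j * c j) 1 = Complex.exp (-(c j ^ 2 : ℝ) / 2) := by
    intro j
    have e : iidGaussian.map (fun z => z j * c j) = (gaussianReal 0 1).map (fun x => x * c j) := by
      rw [← map_eval_iid j, Measure.map_map (by fun_prop) (by fun_prop)]; rfl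
    rw [e, gaussianReal_map_mul_const, charFun_gaussianReal]
    congr 1
    simp [neg_div]
  simp_rw [this]
  rw [← Complex.exp_sum]
  congr 1
  push_cast
  rw [← Finset.sum_div, Finset.sum_neg_distrib]

/-- The measure `whiteNoise` is the standard Gaussian measure: its characteristic functional is
`ξ ↦ exp (-|ξ|₀² / 2)`. -/
theorem charFun_whiteNoise (ξ : 𝓢(ℝ, ℝ)) :
    ∫ x : Dist, Complex.exp (Complex.I * (x ξ : ℝ)) ∂whiteNoise
      = Complex.exp (-(1 / 2) * (∫ t, ξ t ^ 2 : ℝ)) := by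
  have hξ : Measurable fun x : Dist => x ξ :=
    (measurable_pi_apply ξ).comp (comap_measurable fun (x : Dist) ξ => x ξ)
  have hm : Measurable fun x : Dist => Complex.exp (Complex.I * (x ξ : ℝ)) :=
    Complex.measurable_exp.comp ((Complex.measurable_ofReal.comp hξ).const_mul _)
  rw [whiteNoise, integral_map measurable_synth.aemeasurable hm.aestronglyMeasurable]
  have h1 : Tendsto (fun N : ℕ => ∫ z : ℕ → ℝ, Complex.exp
      ((∑ j ∈ Finset.range N, z j * dotp ξ (hermiteFun j) : ℝ) * Complex.I) ∂iidGaussian) atTop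
      (𝓝 (∫ z, Complex.exp (Complex.I * (synth z ξ : ℝ)) ∂iidGaussian)) := by
    refine tendsto_integral_of_dominated_convergence (fun _ => 1) (fun N => ?_)
      (integrable_const 1) (fun N => ae_of_all _ fun z => ?_) ?_
    · exact Measurable.aestronglyMeasurable (by fun_prop)
    · exact (Complex.norm_exp_ofReal_mul_I _).le
    · filter_upwards [ae_memlp] with z hz
      have := (hasSum_synth hz ξ).tendsto_sum_nat
      have hc : Continuous fun r : ℝ => Complex.exp ((r : ℂ) * Complex.I) := by fun_prop
      rw [mul_comm]
      exact (hc.tendsto _).comp this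
  refine tendsto_nhds_unique h1 ?_
  simp_rw [charFun_finset]
  have h2 := (hasSum_sq ξ).tendsto_sum_nat
  have hc : Continuous fun r : ℝ => Complex.exp (-(r : ℂ) / 2) := by fun_prop
  have h3 := (hc.tendsto _).comp h2
  have e : Complex.exp (-(1 / 2) * (∫ t, ξ t ^ 2 : ℝ))
      = Complex.exp (-((∫ t, ξ t ^ 2 : ℝ) : ℂ) / 2) := by congr 1; ring
  rw [e]
  exact h3

/-! ### Weight functions -/

/-- The class `C⁽²⁾_{+,1/2,1}` of weight functions on `[0, ∞)`; the values of `u` on the negative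
half-line play no role. -/
structure IsWeight (u : ℝ → ℝ) : Prop where
  continuousOn : ContinuousOn u (Set.Ici 0)
  pos : ∀ r, 0 ≤ r → 0 < u r
  growth : Tendsto (fun r => Real.log (u r) / Real.sqrt r) atTop atTop
  order_one : ∃ L : ℝ, Tendsto (fun r => Real.log (u r) / r) atTop (𝓝 L)
  convex : ConvexOn ℝ (Set.Ici 0) fun x => Real.log (u (x ^ 2))

/-- The Legendre transform `ℓ_u(t) = inf_{r > 0} u(r) / r^t`. -/
def legendre (u : ℝ → ℝ) (t : ℝ) : ℝ := ⨅ r : Set.Ioi (0 : ℝ), u r / (r : ℝ) ^ t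

/-! ### The Wiener–Itô expansion and the space `[E]_u` -/

/-- The Wick polynomial `⟨:x^{⊗n}:, e_{j_1} ⊗ ⋯ ⊗ e_{j_n}⟩ = ∏_k He_{n_k}(⟨x, e_k⟩)`, where `n_k` is the
number of indices `i` with `j_i = k` and `He_m` are the probabilists' Hermite polynomials. -/
def wick {n : ℕ} (j : Fin n → ℕ) (x : Dist) : ℝ :=
  ∏ k ∈ Finset.univ.image j,
    Polynomial.aeval (x (hermiteFun k))
      (Polynomial.hermite (Finset.univ.filter fun i => j i = k).card)

/-- Elements of the symmetric Hilbert tensor power `E_{0,c}^{⊗̂n}`, given by their coefficients in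
the orthonormal basis `e_{j_1} ⊗ ⋯ ⊗ e_{j_n}` of `E_{0,c}^{⊗n}`: symmetric square-summable families. -/
structure IsKernel {n : ℕ} (a : (Fin n → ℕ) → ℂ) : Prop where
  symm : ∀ (σ : Equiv.Perm (Fin n)) (j : Fin n → ℕ), a (j ∘ σ) = a j
  summable : Summable fun j => ‖a j‖ ^ 2

/-- `ψ = I_n(f_n) = ⟨:·^{⊗n}:, f_n⟩` in `L²(μ)`, for the kernel `f_n` with coefficients `a`. -/
def IsWienerIntegral {n : ℕ} (a : (Fin n → ℕ) → ℂ) (ψ : Lp ℂ 2 whiteNoise) : Prop :=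
  Tendsto (fun s : Finset (Fin n → ℕ) =>
    eLpNorm (fun x => ψ x - ∑ j ∈ s, a j * (wick j x : ℂ)) 2 whiteNoise) atTop (𝓝 0)

/-- The Wiener–Itô expansion `φ = ∑_n I_n(f_n)` of `φ ∈ L²(μ)`, with symmetric kernels `f_n`. -/
def IsWienerIto (φ : Lp ℂ 2 whiteNoise) (f : (n : ℕ) → (Fin n → ℕ) → ℂ) : Prop :=
  (∀ n, IsKernel (f n)) ∧ ∃ ψ : ℕ → Lp ℂ 2 whiteNoise,
    (∀ n, IsWienerIntegral (f n) (ψ n)) ∧ HasSum ψ φ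

/-- `|f_n|_p² = |(A^{⊗n})^p f_n|_0²`, where `(A^{⊗n})^p` multiplies the coefficient of
`e_{j_1} ⊗ ⋯ ⊗ e_{j_n}` by `∏_i (2 j_i + 2)^p`. -/
def kernelNormSq {n : ℕ} (p : ℝ) (a : (Fin n → ℕ) → ℂ) : ℝ≥0∞ :=
  ∑' j : Fin n → ℕ, ENNReal.ofReal (‖((∏ i, (2 * (j i : ℝ) + 2) ^ p : ℝ) : ℂ) * a j‖ ^ 2)

/-- `(∑_n ℓ_u(n)⁻¹ |f_n|_p²)^{1/2}`, for a sequence of kernels `f_n`. -/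
def kernelsNorm (u : ℝ → ℝ) (p : ℝ) (f : (n : ℕ) → (Fin n → ℕ) → ℂ) : ℝ≥0∞ :=
  (∑' n : ℕ, ENNReal.ofReal (1 / legendre u n) * kernelNormSq p (f n)) ^ (1 / 2 : ℝ)

/-- The norm `‖φ‖_{u,p} = (∑_n ℓ_u(n)⁻¹ |f_n|_p²)^{1/2}` of `φ ∈ L²(μ)`, with values in `[0, ∞]`,
where `f_n` are the kernels of the Wiener–Itô expansion of `φ`. As every `φ` has exactly one such
sequence of kernels, the infimum is over a single sequence. -/
def cksNorm (u : ℝ → ℝ) (p : ℝ) (φ : Lp ℂ 2 whiteNoise) : ℝ≥0∞ :=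
  ⨅ (f : (n : ℕ) → (Fin n → ℕ) → ℂ) (_ : IsWienerIto φ f), kernelsNorm u p f

theorem cksNorm_lt_top {u : ℝ → ℝ} {p : ℝ} {φ : Lp ℂ 2 whiteNoise} :
    cksNorm u p φ < ∞ ↔ ∃ f, IsWienerIto φ f ∧
      ∑' n : ℕ, ENNReal.ofReal (1 / legendre u n) * kernelNormSq p (f n) < ∞ := by
  simp only [cksNorm, kernelsNorm, iInf_lt_iff, exists_prop,
    ENNReal.rpow_lt_top_iff_of_pos (by norm_num : (0 : ℝ) < 1 / 2)]

theorem ofReal_norm_sq_add_le (z w : ℂ) : ENNReal.ofReal (‖z + w‖ ^ 2) ≤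
    2 * (ENNReal.ofReal (‖z‖ ^ 2) + ENNReal.ofReal (‖w‖ ^ 2)) := by
  rw [← ENNReal.ofReal_add (by positivity) (by positivity), ← ENNReal.ofReal_ofNat,
    ← ENNReal.ofReal_mul (by norm_num)]
  apply ENNReal.ofReal_le_ofReal
  have := norm_add_le z w
  nlinarith [sq_nonneg (‖z‖ - ‖w‖), norm_nonneg (z + w)]

theorem kernelNormSq_add {n : ℕ} (p : ℝ) (a b : (Fin n → ℕ) → ℂ) :
    kernelNormSq p (a + b) ≤ 2 * (kernelNormSq p a + kernelNormSq p b) := by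
  simp only [kernelNormSq]
  rw [← ENNReal.tsum_add, ← ENNReal.tsum_mul_left]
  refine ENNReal.tsum_le_tsum fun j => ?_
  rw [Pi.add_apply, mul_add]
  exact ofReal_norm_sq_add_le _ _

theorem kernelNormSq_smul {n : ℕ} (p : ℝ) (c : ℂ) (a : (Fin n → ℕ) → ℂ) :
    kernelNormSq p (c • a) = ENNReal.ofReal (‖c‖ ^ 2) * kernelNormSq p a := by
  simp only [kernelNormSq]
  rw [← ENNReal.tsum_mul_left]
  congr 1; ext j
  rw [← ENNReal.ofReal_mul (by positivity), Pi.smul_apply, smul_eq_mul, mul_left_comm, norm_mul,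
    mul_pow]

theorem measurable_eval (ξ : 𝓢(ℝ, ℝ)) : Measurable fun x : Dist => x ξ :=
  (measurable_pi_apply ξ).comp (comap_measurable fun (x : Dist) ξ => x ξ)

theorem measurable_wick {n : ℕ} (j : Fin n → ℕ) : Measurable fun x : Dist => (wick j x : ℂ) := by
  apply Complex.measurable_ofReal.comp
  unfold wick
  refine Finset.measurable_prod _ fun k _ => ?_
  exact (Polynomial.continuous_aeval _).measurable.comp (measurable_eval _)

theorem IsWienerIntegral.add {n : ℕ} {a b : (Fin n → ℕ) → ℂ} {φ ψ : Lp ℂ 2 whiteNoise}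
    (ha : IsWienerIntegral a φ) (hb : IsWienerIntegral b ψ) :
    IsWienerIntegral (a + b) (φ + ψ) := by
  have h := Tendsto.add ha hb
  rw [add_zero] at h
  refine tendsto_of_tendsto_of_tendsto_of_le_of_le tendsto_const_nhds h (fun _ => zero_le) ?_
  intro s
  have hm : ∀ a : (Fin n → ℕ) → ℂ, Measurable fun x => ∑ j ∈ s, a j * (wick j x : ℂ) := fun a =>
    Finset.measurable_sum _ fun j _ => (measurable_wick j).const_mul _
  refine le_trans (le_of_eq ?_) (eLpNorm_add_le
    ((Lp.aestronglyMeasurable φ).sub (hm a).aestronglyMeasurable)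
    ((Lp.aestronglyMeasurable ψ).sub (hm b).aestronglyMeasurable) (by norm_num))
  apply eLpNorm_congr_ae
  filter_upwards [Lp.coeFn_add φ ψ] with x hx
  simp only [hx, Pi.add_apply, add_mul, Finset.sum_add_distrib]
  ring

theorem IsWienerIntegral.smul {n : ℕ} {a : (Fin n → ℕ) → ℂ} {φ : Lp ℂ 2 whiteNoise} (c : ℂ)
    (ha : IsWienerIntegral a φ) : IsWienerIntegral (c • a) (c • φ) := by
  have h := ENNReal.Tendsto.const_mul (a := ‖c‖ₑ) ha (Or.inr enorm_ne_top)
  rw [mul_zero] at h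
  refine h.congr fun s => ?_
  rw [← eLpNorm_const_smul]
  apply eLpNorm_congr_ae
  filter_upwards [Lp.coeFn_smul c φ] with x hx
  simp only [hx, Pi.smul_apply, smul_eq_mul, mul_sub, Finset.mul_sum, mul_assoc]

theorem IsWienerIto.add {φ ψ : Lp ℂ 2 whiteNoise} {f g : (n : ℕ) → (Fin n → ℕ) → ℂ}
    (hf : IsWienerIto φ f) (hg : IsWienerIto ψ g) : IsWienerIto (φ + ψ) (f + g) := by
  obtain ⟨kf, F, hF, sF⟩ := hf
  obtain ⟨kg, G, hG, sG⟩ := hg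
  refine ⟨fun n => ⟨fun σ j => ?_, ?_⟩, F + G, fun n => (hF n).add (hG n), sF.add sG⟩
  · simp only [Pi.add_apply, (kf n).symm, (kg n).symm]
  · refine Summable.of_nonneg_of_le (fun _ => by positivity) (fun j => ?_)
      (((kf n).summable.add (kg n).summable).mul_left 2)
    have := norm_add_le (f n j) (g n j)
    simp only [Pi.add_apply]
    nlinarith [sq_nonneg (‖f n j‖ - ‖g n j‖), norm_nonneg (f n j + g n j)]

theorem IsWienerIto.smul {φ : Lp ℂ 2 whiteNoise} {f : (n : ℕ) → (Fin n → ℕ) → ℂ} (c : ℂ)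
    (hf : IsWienerIto φ f) : IsWienerIto (c • φ) (c • f) := by
  obtain ⟨kf, F, hF, sF⟩ := hf
  refine ⟨fun n => ⟨fun σ j => ?_, ?_⟩, c • F, fun n => (hF n).smul c, sF.const_smul c⟩
  · simp only [Pi.smul_apply, (kf n).symm]
  · refine ((kf n).summable.mul_left (‖c‖ ^ 2)).congr fun j => ?_
    simp [mul_pow]

theorem IsWienerIto.zero : IsWienerIto 0 0 := by
  refine ⟨fun n => ⟨fun _ _ => rfl, by simp⟩, 0, fun n => ?_, hasSum_zero⟩
  refine tendsto_const_nhds.congr fun s => ?_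
  rw [eq_comm]
  refine (eLpNorm_congr_ae (g := 0) ?_).trans eLpNorm_zero
  filter_upwards [Lp.coeFn_zero ℂ 2 whiteNoise] with x hx
  simpa using hx

/-- The space `[E]_u` of test functions: the projective limit, i.e. the intersection over `p ≥ 0`, of
the spaces `[E_p]_u = {φ ∈ L²(μ) ; ‖φ‖_{u,p} < ∞}`. -/
def testSpace (u : ℝ → ℝ) : Submodule ℂ (Lp ℂ 2 whiteNoise) where
  carrier := {φ | ∀ p : ℝ, 0 ≤ p → cksNorm u p φ < ∞}
  zero_mem' p _ := cksNorm_lt_top.mpr ⟨0, IsWienerIto.zero, by simp [kernelNormSq]⟩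
  add_mem' {φ ψ} hφ hψ p hp := by
    obtain ⟨f, hf, nf⟩ := cksNorm_lt_top.mp (hφ p hp)
    obtain ⟨g, hg, ng⟩ := cksNorm_lt_top.mp (hψ p hp)
    refine cksNorm_lt_top.mpr ⟨f + g, hf.add hg, ?_⟩
    refine lt_of_le_of_lt (ENNReal.tsum_le_tsum fun n =>
      mul_le_mul_right (kernelNormSq_add p (f n) (g n)) _) ?_
    simp_rw [mul_left_comm _ (2 : ℝ≥0∞), mul_add]
    rw [ENNReal.tsum_add, ENNReal.tsum_mul_left, ENNReal.tsum_mul_left]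
    exact ENNReal.add_lt_top.mpr ⟨ENNReal.mul_lt_top (by simp) nf, ENNReal.mul_lt_top (by simp) ng⟩
  smul_mem' c φ hφ p hp := by
    obtain ⟨f, hf, nf⟩ := cksNorm_lt_top.mp (hφ p hp)
    refine cksNorm_lt_top.mpr ⟨c • f, hf.smul c, ?_⟩
    simp_rw [Pi.smul_apply, kernelNormSq_smul, mul_left_comm _ (ENNReal.ofReal (‖c‖ ^ 2))]
    rw [ENNReal.tsum_mul_left]
    exact ENNReal.mul_lt_top (by simp) nf

/-! ### The complexified spaces `E*_{p,c}` and the space `A_u` -/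

/-- The complexification `E*_c` of `E*`: the continuous real-linear maps `S(ℝ) → ℂ`, i.e. `x + iy`
with `x, y ∈ E*`. -/
abbrev DistC : Type := 𝓢(ℝ, ℝ) →L[ℝ] ℂ

/-- The canonical inclusion of `E*` into `E*_c`. -/
def Dist.toC (x : Dist) : DistC := Complex.ofRealCLM.comp x

/-- The linear subspace `{x ∈ E*_c ; |x|_{-p} < ∞}`. -/
def distCpSubmodule (p : ℝ) : Submodule ℂ DistC where
  carrier := {x | Memℓp (fun j : ℕ => (((2 * j + 2 : ℝ) ^ (-p) : ℝ) : ℂ) * x (hermiteFun j)) 2}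
  zero_mem' := by
    refine (congrArg (fun s : ℕ → ℂ => Memℓp s 2) ?_).mp (zero_memℓp (E := fun _ : ℕ => ℂ))
    ext j; simp
  add_mem' {x y} hx hy := by
    refine (congrArg (fun s : ℕ → ℂ => Memℓp s 2) ?_).mp (Memℓp.add hx hy)
    ext j; simp [mul_add]
  smul_mem' c x hx := by
    refine (congrArg (fun s : ℕ → ℂ => Memℓp s 2) ?_).mp (Memℓp.const_smul hx c)
    ext j; simp [mul_left_comm]

/-- The complex Hilbert space `E*_{p,c}`, with the norm
`|x|_{-p} = |A^{-p} x|_0 = (∑_j (2j+2)^{-2p} |⟨x, e_j⟩|²)^{1/2}` (see `DistCp.norm_sq`). -/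
def DistCp (p : ℝ) : Type := distCpSubmodule p

namespace DistCp

variable {p : ℝ}

instance : AddCommGroup (DistCp p) := inferInstanceAs (AddCommGroup (distCpSubmodule p))
instance : Module ℂ (DistCp p) := inferInstanceAs (Module ℂ (distCpSubmodule p))

/-- The inclusion `E*_{p,c} ⊂ E*_c`. -/
def incl : DistCp p →ₗ[ℂ] DistC := (distCpSubmodule p).subtype

/-- The map `x ↦ A^{-p} x`, in Hermite coordinates. -/
def coords : DistCp p →ₗ[ℂ] lp (fun _ : ℕ => ℂ) 2 where
  toFun x := ⟨fun j : ℕ => (((2 * j + 2 : ℝ) ^ (-p) : ℝ) : ℂ) * incl x (hermiteFun j), x.2⟩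
  map_add' x y := by
    ext j
    exact mul_add _ (incl x (hermiteFun j)) (incl y (hermiteFun j))
  map_smul' c x := by
    ext j
    exact mul_left_comm _ c (incl x (hermiteFun j))

theorem coords_injective : Function.Injective (coords (p := p)) := by
  rw [injective_iff_map_eq_zero]
  intro x hx
  have h0 : ∀ j, incl x (hermiteFun j) = 0 := by
    intro j
    have h1 : (((2 * j + 2 : ℝ) ^ (-p) : ℝ) : ℂ) * incl x (hermiteFun j) = 0 :=
      congrFun (congrArg Subtype.val hx) j
    have h2 : (2 * j + 2 : ℝ) ^ (-p) ≠ 0 := by positivity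
    exact (mul_eq_zero.mp h1).resolve_left (by exact_mod_cast h2)
  have h : incl x = 0 := by
    ext f
    have h1 := ((incl x).continuous.tendsto f).comp (tendsto_partialSum f)
    refine tendsto_nhds_unique h1 (tendsto_const_nhds.congr fun N => ?_)
    simp [partialSum, h0]
  exact Subtype.val_injective h

instance : NormedAddCommGroup (DistCp p) := NormedAddCommGroup.induced _ _ coords coords_injective
instance : NormedSpace ℂ (DistCp p) := NormedSpace.induced ℂ _ _ coords

theorem norm_sq (x : DistCp p) :
    ‖x‖ ^ 2 = ∑' j : ℕ, (2 * j + 2 : ℝ) ^ (-2 * p) * ‖incl x (hermiteFun j)‖ ^ 2 := by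
  have h : ‖x‖ = ‖coords x‖ := rfl
  have h2 := lp.norm_rpow_eq_tsum (p := 2) (by norm_num) (coords x)
  rw [ENNReal.toReal_ofNat, Real.rpow_ofNat] at h2
  rw [h, h2]
  congr 1; ext j
  rw [Real.rpow_ofNat]
  show ‖(((2 * j + 2 : ℝ) ^ (-p) : ℝ) : ℂ) * incl x (hermiteFun j)‖ ^ 2 = _
  rw [norm_mul, mul_pow, Complex.norm_real, Real.norm_of_nonneg (by positivity), ← Real.rpow_natCast,
    ← Real.rpow_mul (by positivity)]
  congr 2; push_cast; ring

end DistCp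

/-- Membership in `A_{u,p}`. The function `Φ` on `E*_c` is analytic on the complex Hilbert space
`E*_{p,c}`, that is, holomorphic (complex Fréchet differentiable) there, and
`|Φ(x)|² ≤ C u(|x|_{-p}²)` on `E*_{p,c}`. -/
structure MemA (u : ℝ → ℝ) (p : ℝ) (Φ : DistC → ℂ) : Prop where
  analytic : Differentiable ℂ fun x : DistCp p => Φ x.incl
  growth : ∃ C : ℝ, 0 ≤ C ∧ ∀ x : DistCp p, ‖Φ x.incl‖ ^ 2 ≤ C * u (‖x‖ ^ 2)

/-- The norm `|||Φ|||_{A_{u,p}} = sup |Φ(x)| u(|x|_{-p}²)^{-1/2}` over `x ∈ E*_{p,c}`, with values in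
`[0, ∞]`. -/
def analyticNorm (u : ℝ → ℝ) (p : ℝ) (Φ : DistC → ℂ) : ℝ≥0∞ :=
  ⨆ x : DistCp p, ENNReal.ofReal (‖Φ x.incl‖ * u (‖x‖ ^ 2) ^ (-(1 / 2) : ℝ))

/-- The space `A_u`, the projective limit of the spaces `A_{u,p}`: the functions on
`E*_c = ⋃_p E*_{p,c}` that belong to `A_{u,p}` for every `p ≥ 0`. -/
def analyticSpace (u : ℝ → ℝ) : Submodule ℂ (DistC → ℂ) where
  carrier := {Φ | ∀ p : ℝ, 0 ≤ p → MemA u p Φ}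
  zero_mem' p _ := ⟨differentiable_const 0, 0, le_rfl, fun x => by simp⟩
  add_mem' {Φ Ψ} hΦ hΨ p hp := by
    obtain ⟨C, hC, h⟩ := (hΦ p hp).growth
    obtain ⟨D, hD, k⟩ := (hΨ p hp).growth
    refine ⟨(hΦ p hp).analytic.add (hΨ p hp).analytic, 2 * (C + D), by positivity, fun x => ?_⟩
    have := norm_add_le (Φ x.incl) (Ψ x.incl)
    have h1 := h x
    have h2 := k x
    simp only [Pi.add_apply]
    nlinarith [sq_nonneg (‖Φ x.incl‖ - ‖Ψ x.incl‖), norm_nonneg (Φ x.incl + Ψ x.incl)]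
  smul_mem' c Φ hΦ p hp := by
    obtain ⟨C, hC, h⟩ := (hΦ p hp).growth
    refine ⟨(hΦ p hp).analytic.const_smul c, ‖c‖ ^ 2 * C, by positivity, fun x => ?_⟩
    simp only [Pi.smul_apply, norm_smul, mul_pow, mul_assoc]
    exact mul_le_mul_of_nonneg_left (h x) (by positivity)

/-- Two families of (extended) norms on `V`, indexed by the real numbers `p ≥ 1`, are equivalent:
each norm of either family is dominated by a constant times some norm of the other family. -/
def EquivalentNormFamilies {V : Type*} (N M : ℝ → V → ℝ≥0∞) : Prop :=
  (∀ p : ℝ, 1 ≤ p → ∃ q : ℝ, 1 ≤ q ∧ ∃ C : ℝ≥0, ∀ v, N p v ≤ C * M q v) ∧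
  (∀ p : ℝ, 1 ≤ p → ∃ q : ℝ, 1 ≤ q ∧ ∃ C : ℝ≥0, ∀ v, M p v ≤ C * N q v)

end

end WhiteNoise

/-! Both spaces are described by coefficients indexed by finitely supported multi-indices α, under
one and the same condition. Put G(n) = ℓ_u(n)^{1/2} and wt(α) = ∏_k (2k+2)^{α_k}; the condition,
`Decays`, is |c_α| ≤ M G(|α|) wt(α)^{-q}, and it is required for every q ≥ 0 with M depending on q.
It characterizes the Taylor coefficients of the functions in A_u and also the Hermite coefficients
of the elements of [E]_u. Each passage between a norm and the condition loses only a fixed amount in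
q, and this is the equivalence of the norm families.

Losses are finite for two reasons. Since Σ_k (2k+2)^{-2} = π²/24 < 1, the series Σ_α wt(α)^{-2}
converges (`summable_wt`), so a sum over α costs 2 in the exponent. Since 2^{|α|} ≤ wt(α), a factor
K^{|α|} also costs only a shift of the exponent.

Taylor side: Cauchy's estimates on tori with radii proportional to (2k+2)^{p-1} in the span of
finitely many Hermite functions, optimized over the size of the torus, produce exactly G(n),
uniformly in the dimension (`decays_extendCoeff`, `exists_coeff`). Conversely G(n) r^n ≤ u(r²)^{1/2}
turns decay into growth (`norm_powerSum_le`).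

Bridge: monomials and Hermite polynomials are combinations of each other with triangular
coefficients of size at most C(n,m) √(n-m)!. These preserve the decay, up to a shift, because
ℓ_u(n+m) m! ≤ C K^m ℓ_u(n) (`exists_legendre_add_le`); here the growth of order at most one of log u
enters. Rearranging absolutely convergent double series then changes one expansion into the other
(`exists_hasSum_transform`).

L² side: the Hermite products are orthogonal under μ, so Wiener–Itô kernels are unique
(`IsWienerIto.unique`), and the pointwise Hermite series of Φ on E* agrees almost everywhere with
its L² sum (`ae_eq_of_hasSum_heL`). Thus the Hermite coefficients of Φ are, up to multiplicities,
the kernels of its restriction. -/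

namespace WhiteNoise
noncomputable section

/-! ### Estimates for the Legendre transform of a weight -/

namespace IsWeight

variable {u : ℝ → ℝ}

theorem exists_le (hu : IsWeight u) : ∃ m : ℝ, 0 < m ∧ ∀ r, 0 ≤ r → m ≤ u r := by
  have h1 := (hu.growth.eventually_ge_atTop 0).and (eventually_gt_atTop 0)
  obtain ⟨R, hR⟩ := h1.exists_forall_of_atTop
  obtain ⟨x, hx, hmin⟩ := (isCompact_Icc (a := (0 : ℝ)) (b := max R 0)).exists_isMinOn
    ⟨0, by simp⟩ (hu.continuousOn.mono Set.Icc_subset_Ici_self)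
  refine ⟨min 1 (u x), lt_min one_pos (hu.pos x hx.1), fun r hr => ?_⟩
  rcases le_or_gt r (max R 0) with h | h
  · exact (min_le_right _ _).trans (hmin ⟨hr, h⟩)
  · refine (min_le_left _ _).trans ?_
    obtain ⟨h2, h3⟩ := hR r ((le_max_left _ _).trans h.le)
    have h4 : 0 ≤ Real.log (u r) := by
      by_contra hneg
      exact absurd (div_neg_of_neg_of_pos (not_le.mp hneg) (Real.sqrt_pos.mpr h3)) (not_lt.mpr h2)
    exact (Real.log_nonneg_iff (hu.pos r hr)).mp h4

/-- A compact interval is handled by continuity, the rest by the finite limit of log u(r)/r. The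
bound feeds `exists_legendre_add_le`. -/
theorem exists_le_exp (hu : IsWeight u) :
    ∃ C a : ℝ, 0 < C ∧ 0 ≤ a ∧ ∀ r, 0 ≤ r → u r ≤ C * Real.exp (a * r) := by
  obtain ⟨L, hL⟩ := hu.order_one
  have h1 := (hL.eventually_le_const (lt_add_one L)).and (eventually_gt_atTop 0)
  obtain ⟨R, hR⟩ := h1.exists_forall_of_atTop
  obtain ⟨x, hx, hmax⟩ := (isCompact_Icc (a := (0 : ℝ)) (b := max R 0)).exists_isMaxOn
    ⟨0, by simp⟩ (hu.continuousOn.mono Set.Icc_subset_Ici_self)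
  refine ⟨max 1 (u x), |L + 1|, lt_max_of_lt_left one_pos, abs_nonneg _, fun r hr => ?_⟩
  rcases le_or_gt r (max R 0) with h | h
  · calc u r ≤ u x := hmax ⟨hr, h⟩
      _ ≤ max 1 (u x) * 1 := by rw [mul_one]; exact le_max_right _ _
      _ ≤ _ := by gcongr; exact Real.one_le_exp (by positivity)
  · obtain ⟨h2, h3⟩ := hR r ((le_max_left _ _).trans h.le)
    rw [div_le_iff₀ h3] at h2
    calc u r = Real.exp (Real.log (u r)) := (Real.exp_log (hu.pos r hr)).symm
      _ ≤ Real.exp (|L + 1| * r) := by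
        apply Real.exp_le_exp.mpr; refine h2.trans ?_; gcongr; exact le_abs_self _
      _ = 1 * Real.exp (|L + 1| * r) := (one_mul _).symm
      _ ≤ _ := by gcongr; exact le_max_left _ _

/-- Makes ℓ_u(n) strictly positive: for large r, u(r) ≥ exp √r, and the term of order 2n of the
exponential series at √r is r^n/(2n)!. -/
theorem exists_pow_le (hu : IsWeight u) (n : ℕ) :
    ∃ ε : ℝ, 0 < ε ∧ ∀ r, 0 < r → ε ≤ u r / r ^ n := by
  obtain ⟨m, hm, hle⟩ := hu.exists_le
  obtain ⟨R, hR⟩ := ((hu.growth.eventually_ge_atTop 1).and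
    (eventually_gt_atTop 0)).exists_forall_of_atTop
  have hR1 : (0 : ℝ) < max R 1 := lt_max_of_lt_right one_pos
  refine ⟨min (1 / (2 * n).factorial) (m / max R 1 ^ n), by positivity, fun r hr => ?_⟩
  rcases le_or_gt r (max R 1) with h | h
  · refine (min_le_right _ _).trans ?_
    have := hle r hr.le
    have hp : r ^ n ≤ max R 1 ^ n := by gcongr
    exact div_le_div₀ (hm.le.trans this) this (by positivity) hp
  · refine (min_le_left _ _).trans ?_
    obtain ⟨h2, -⟩ := hR r ((le_max_left _ _).trans h.le)
    rw [one_le_div (Real.sqrt_pos.mpr hr)] at h2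
    have h3 : Real.exp (Real.sqrt r) ≤ u r := by
      rw [← Real.exp_log (hu.pos r hr.le)]; exact Real.exp_le_exp.mpr h2
    have h4 := Real.pow_div_factorial_le_exp _ (Real.sqrt_nonneg r) (2 * n)
    rw [pow_mul, Real.sq_sqrt hr.le] at h4
    rw [le_div_iff₀ (by positivity)]
    refine le_trans (le_of_eq ?_) (h4.trans h3)
    ring

theorem bddBelow (hu : IsWeight u) (t : ℝ) :
    BddBelow (Set.range fun r : Set.Ioi (0 : ℝ) => u r / (r : ℝ) ^ t) := by
  refine ⟨0, ?_⟩
  rintro _ ⟨r, rfl⟩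
  have : (0 : ℝ) < r := r.2
  have := hu.pos r this.le
  positivity

theorem legendre_le (hu : IsWeight u) (n : ℕ) {r : ℝ} (hr : 0 < r) :
    legendre u n ≤ u r / r ^ n := by
  have := ciInf_le (hu.bddBelow n) ⟨r, hr⟩
  rwa [Real.rpow_natCast] at this

theorem le_legendre (n : ℕ) {a : ℝ} (h : ∀ r : ℝ, 0 < r → a ≤ u r / r ^ n) :
    a ≤ legendre u n := by
  have : Nonempty (Set.Ioi (0 : ℝ)) := ⟨⟨1, Set.mem_Ioi.mpr one_pos⟩⟩
  refine le_ciInf fun r => ?_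
  rw [Real.rpow_natCast]
  exact h r r.2

theorem legendre_pos (hu : IsWeight u) (n : ℕ) : 0 < legendre u n := by
  obtain ⟨ε, h, h2⟩ := hu.exists_pow_le n
  exact h.trans_le (le_legendre n h2)

theorem legendre_mul_pow_le (hu : IsWeight u) (n : ℕ) {r : ℝ} (hr : 0 ≤ r) :
    legendre u n * r ^ n ≤ u r := by
  rcases hr.eq_or_lt with rfl | h
  · rcases n with _ | n
    · rw [pow_zero, mul_one]
      -- The infimum runs over r > 0 only, so at r = 0 the bound comes from continuity of u there.
      have h1 : Tendsto u (𝓝[>] 0) (𝓝 (u 0)) :=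
        (hu.continuousOn 0 (by simp)).mono_left (nhdsWithin_mono _ Set.Ioi_subset_Ici_self)
      refine ge_of_tendsto h1 ?_
      filter_upwards [self_mem_nhdsWithin] with r hr
      have := hu.legendre_le 0 hr
      simpa using this
    · simpa using (hu.pos 0 le_rfl).le
  · rw [← le_div_iff₀ (by positivity)]; exact hu.legendre_le n h

/-- A shift of the index by m gains a factor 1/m!, up to a geometric factor. The left side is
compared with u(r)/r^n for each r. If r ≥ m+1, the test point r for ℓ_u(n+m) suffices, as m! ≤ r^m.
If r < m+1, the test point m+1 is used, with u(m+1) ≤ C e^{a(m+1)} and the positive lower bound of u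
at r. -/
theorem exists_legendre_add_le (hu : IsWeight u) : ∃ C K : ℝ, 1 ≤ C ∧ 1 ≤ K ∧ ∀ n m : ℕ,
    legendre u ((n + m : ℕ) : ℝ) * m.factorial ≤ C * K ^ m * legendre u n := by
  obtain ⟨μ, hμ, hmin⟩ := hu.exists_le
  obtain ⟨C, a, hC, ha, hexp⟩ := hu.exists_le_exp
  have hK : 1 ≤ Real.exp a := Real.one_le_exp ha
  refine ⟨max 1 (C * Real.exp a / μ), Real.exp a, le_max_left _ _, hK, fun n m => ?_⟩
  have hfac : (m.factorial : ℝ) ≤ ((m : ℝ) + 1) ^ m := by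
    calc (m.factorial : ℝ) ≤ (m : ℝ) ^ m := by exact_mod_cast Nat.factorial_le_pow m
      _ ≤ _ := by gcongr; linarith
  have hfp : (0 : ℝ) < m.factorial := by positivity
  have hpos : 0 < max 1 (C * Real.exp a / μ) * Real.exp a ^ m := by positivity
  rw [mul_comm (_ * _), ← div_le_iff₀ hpos]
  refine le_legendre n fun r hr => ?_
  have hur := hu.pos r hr.le
  rw [div_le_iff₀ hpos]
  rcases le_or_gt ((m : ℝ) + 1) r with h | h
  · have h1 := hu.legendre_le (n + m) hr
    have h2 : (m.factorial : ℝ) ≤ r ^ m := hfac.trans (by gcongr)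
    calc legendre u ((n + m : ℕ) : ℝ) * m.factorial ≤ u r / r ^ (n + m) * r ^ m := by gcongr
      _ = u r / r ^ n * (1 * 1) := by rw [pow_add]; field_simp
      _ ≤ _ := by
        gcongr
        · exact le_max_left _ _
        · exact one_le_pow₀ hK
  · have hm1 : (0 : ℝ) < m + 1 := by positivity
    have h1 := hu.legendre_le (n + m) hm1
    have h2 := hexp _ hm1.le
    have h3 := hmin r hr.le
    calc legendre u ((n + m : ℕ) : ℝ) * m.factorial
        ≤ (C * Real.exp (a * (m + 1))) / ((m : ℝ) + 1) ^ (n + m) * ((m : ℝ) + 1) ^ m := by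
          gcongr; exact h1.trans (by gcongr)
      _ = 1 / ((m : ℝ) + 1) ^ n * (C * Real.exp a / μ * Real.exp a ^ m) * μ := by
          rw [← Real.exp_nat_mul, mul_add, mul_one, Real.exp_add, mul_comm (m : ℝ) a, pow_add]
          field_simp
      _ ≤ 1 / r ^ n * (max 1 (C * Real.exp a / μ) * Real.exp a ^ m) * u r := by
          gcongr
          exact le_max_right _ _
      _ = _ := by ring

/-- `G n = ℓ_u(n)^{1/2}`. -/
def _root_.WhiteNoise.rootLegendre (u : ℝ → ℝ) (n : ℕ) : ℝ := Real.sqrt (legendre u n)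

theorem rootLegendre_pos (hu : IsWeight u) (n : ℕ) : 0 < rootLegendre u n :=
  Real.sqrt_pos.mpr (hu.legendre_pos n)

/-- The definition of ℓ_u at the point r², after a square root; this is how decay of coefficients
becomes growth governed by u(|x|²). -/
theorem rootLegendre_mul_pow_le (hu : IsWeight u) (n : ℕ) {r : ℝ} (hr : 0 ≤ r) :
    rootLegendre u n * r ^ n ≤ Real.sqrt (u (r ^ 2)) := by
  have h := hu.legendre_mul_pow_le n (sq_nonneg r)
  rw [rootLegendre, ← Real.sqrt_sq (pow_nonneg hr n), ← Real.sqrt_mul (hu.legendre_pos n).le]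
  apply Real.sqrt_le_sqrt
  rwa [← pow_mul, mul_comm n 2, pow_mul]

theorem exists_rootLegendre_add_le (hu : IsWeight u) : ∃ (C : ℝ) (κ : ℕ), 1 ≤ C ∧ ∀ n m : ℕ,
    rootLegendre u (n + m) * Real.sqrt m.factorial ≤ C * 2 ^ (κ * m) * rootLegendre u n := by
  obtain ⟨C, K, hC, hK, h⟩ := hu.exists_legendre_add_le
  -- The base K is replaced by a power of 2 so that `two_pow_degree_le_wt` can absorb it.
  obtain ⟨κ, hκ⟩ := pow_unbounded_of_one_lt K (one_lt_two : (1 : ℝ) < 2)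
  refine ⟨C, κ, hC, fun n m => ?_⟩
  rw [rootLegendre, rootLegendre, ← Real.sqrt_mul (hu.legendre_pos _).le]
  have h2 : (0 : ℝ) ≤ C * 2 ^ (κ * m) := by positivity
  rw [← Real.sqrt_sq h2, ← Real.sqrt_mul (sq_nonneg _)]
  apply Real.sqrt_le_sqrt
  refine (h n m).trans ?_
  have := (hu.legendre_pos n).le
  gcongr
  rw [mul_pow]
  gcongr
  · exact le_self_pow₀ hC (by norm_num)
  · calc K ^ m ≤ (2 ^ κ) ^ m := by gcongr
      _ = 2 ^ (κ * m) := (pow_mul _ _ _).symm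
      _ ≤ _ := le_self_pow₀ (one_le_pow₀ (by norm_num)) (by norm_num)

end IsWeight

/-! ### Weights of multi-indices -/

/-- The weight `∏_k (2k+2)^{α_k}` of a multi-index. -/
def wt (α : ℕ →₀ ℕ) : ℝ := α.prod fun k m => (2 * (k : ℝ) + 2) ^ m

theorem wt_add (α β : ℕ →₀ ℕ) : wt (α + β) = wt α * wt β :=
  Finsupp.prod_add_index' (fun _ => pow_zero _) fun _ _ _ => pow_add _ _ _

theorem wt_single (k m : ℕ) : wt (Finsupp.single k m) = (2 * (k : ℝ) + 2) ^ m :=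
  Finsupp.prod_single_index (pow_zero _)

theorem wt_pos (α : ℕ →₀ ℕ) : 0 < wt α := Finset.prod_pos fun k _ => by positivity

/-- Every factor 2k+2 is at least 2. Geometric factors in |α| can therefore be paid for by raising
the exponent of the weight. -/
theorem two_pow_degree_le_wt (α : ℕ →₀ ℕ) : (2 : ℝ) ^ α.degree ≤ wt α := by
  rw [Finsupp.degree_apply, ← Finset.prod_pow_eq_pow_sum]
  refine Finset.prod_le_prod (fun _ _ => by positivity) fun k _ => ?_
  exact pow_le_pow_left₀ (by norm_num) (by linarith [(Nat.cast_nonneg k : (0 : ℝ) ≤ k)]) _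

theorem one_le_wt (α : ℕ →₀ ℕ) : 1 ≤ wt α :=
  (one_le_pow₀ one_le_two).trans (two_pow_degree_le_wt α)

theorem wt_mono {α β : ℕ →₀ ℕ} (h : α ≤ β) : wt α ≤ wt β := by
  rw [← add_tsub_cancel_of_le h, wt_add]
  exact le_mul_of_one_le_right (wt_pos α).le (one_le_wt _)

/-- The multi-index counting the values of a tuple. -/
def cnt {n : ℕ} (j : Fin n → ℕ) : ℕ →₀ ℕ := ∑ i, Finsupp.single (j i) 1

theorem cnt_apply {n : ℕ} (j : Fin n → ℕ) (k : ℕ) :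
    cnt j k = (Finset.univ.filter fun i => j i = k).card := by
  rw [cnt, Finsupp.finsetSum_apply, Finset.card_filter]
  exact Finset.sum_congr rfl fun i _ => by rw [Finsupp.single_apply]

theorem degree_cnt {n : ℕ} (j : Fin n → ℕ) : (cnt j).degree = n := by
  simp [cnt, map_sum]

theorem wt_cnt {n : ℕ} (j : Fin n → ℕ) : wt (cnt j) = ∏ i, (2 * (j i : ℝ) + 2) := by
  have h : ∀ s : Finset (Fin n), wt (∑ i ∈ s, Finsupp.single (j i) 1)
      = ∏ i ∈ s, (2 * (j i : ℝ) + 2) := by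
    intro s
    induction s using Finset.cons_induction with
    | empty => simp [wt]
    | cons a s ha ih => rw [Finset.sum_cons, Finset.prod_cons, wt_add, ih, wt_single, pow_one]
  exact h _

theorem cnt_cons {n : ℕ} (k : ℕ) (j : Fin n → ℕ) :
    cnt (Fin.cons k j : Fin (n + 1) → ℕ) = Finsupp.single k 1 + cnt j := by
  simp [cnt, Fin.sum_univ_succ]

theorem exists_cnt (α : ℕ →₀ ℕ) : ∃ j : Fin α.degree → ℕ, cnt j = α := by
  suffices h : ∀ n (α : ℕ →₀ ℕ), α.degree = n → ∃ j : Fin n → ℕ, cnt j = α from h _ α rfl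
  intro n
  induction n with
  | zero => intro α h; exact ⟨Fin.elim0, by rw [(Finsupp.degree_eq_zero_iff α).mp h]; simp [cnt]⟩
  | succ n ih =>
    intro α h
    have h0 : α ≠ 0 := by rintro rfl; simp at h
    obtain ⟨k, hk⟩ := Finsupp.ne_iff.mp h0
    have hle : Finsupp.single k 1 ≤ α := by
      rw [Finsupp.single_le_iff]; exact Nat.one_le_iff_ne_zero.mpr hk
    have hs := add_tsub_cancel_of_le hle
    have hd : (α - Finsupp.single k 1).degree = n := by
      have := congrArg Finsupp.degree hs
      rw [map_add, Finsupp.degree_single, h] at this; omega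
    obtain ⟨j, hj⟩ := ih _ hd
    exact ⟨Fin.cons k j, by rw [cnt_cons, hj, hs]⟩

/-- Equal counts give bijections between corresponding fibres of j' and j, and these glue to a
permutation. Hence a symmetric kernel depends on a tuple only through its counts. -/
theorem cnt_eq_iff {n : ℕ} {j j' : Fin n → ℕ} :
    cnt j = cnt j' ↔ ∃ σ : Equiv.Perm (Fin n), j' = j ∘ σ := by
  constructor
  · intro h
    have hc : ∀ k, Nonempty ({i // j' i = k} ≃ {i // j i = k}) := by
      intro k
      rw [← Fintype.card_eq]
      have := DFunLike.congr_fun h k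
      rw [cnt_apply, cnt_apply] at this
      rw [Fintype.card_subtype, Fintype.card_subtype, this]
    let E : Fin n ≃ Fin n := (Equiv.sigmaFiberEquiv j').symm.trans
      ((Equiv.sigmaCongrRight fun k => (hc k).some).trans (Equiv.sigmaFiberEquiv j))
    refine ⟨E, funext fun i => ?_⟩
    exact (((hc (j' i)).some ⟨i, rfl⟩).2).symm
  · rintro ⟨σ, rfl⟩
    exact (Equiv.sum_comp σ fun i => Finsupp.single (j i) 1).symm

/-- Tuples of natural numbers, of any length. -/
abbrev Tuple : Type := Σ n : ℕ, Fin n → ℕ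

/-! ### Summability of inverse squared weights, and multiplicities -/

/-- The sum is π²/24. That it is below 1 is what makes the sum over tuples of all lengths a
convergent geometric series. -/
theorem hasSum_inv_sq : ∃ s : ℝ,
    HasSum (fun k : ℕ => ((2 * (k : ℝ) + 2) ^ 2)⁻¹) s ∧ 0 < s ∧ s < 1 := by
  have h := (hasSum_nat_add_iff' 1).mpr hasSum_zeta_two
  simp only [Finset.range_one, Finset.sum_singleton, Nat.cast_zero] at h
  have h2 := h.mul_left (1 / 4)
  refine ⟨_, h2.congr_fun ?_, ?_, ?_⟩
  · intro k; push_cast; field_simp; ring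
  · have := Real.pi_gt_three
    norm_num; positivity
  · have := Real.pi_lt_four
    norm_num
    nlinarith [Real.pi_pos]

/-- For tuples of length n the sum factorizes into the n-th power of the sum over one index. -/
theorem summable_tuple_wt : Summable fun j : Tuple => (wt (cnt j.2) ^ 2)⁻¹ := by
  obtain ⟨s, hs, hs0, hs1⟩ := hasSum_inv_sq
  have key : ∀ n : ℕ, HasSum (fun j : Fin n → ℕ => (wt (cnt j) ^ 2)⁻¹) (s ^ n) := by
    intro n
    induction n with
    | zero =>
      have := hasSum_unique (fun j : Fin 0 → ℕ => (wt (cnt j) ^ 2)⁻¹)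
      convert this using 1
      simp [wt_cnt]
    | succ n ih =>
      rw [← (Fin.consEquiv fun _ : Fin (n + 1) => ℕ).hasSum_iff]
      have h2 := hs.mul ih (hs.summable.mul_of_nonneg ih.summable (fun _ => by positivity)
        fun _ => by positivity)
      rw [pow_succ']
      refine h2.congr_fun fun p => ?_
      show (wt (cnt (Fin.cons p.1 p.2)) ^ 2)⁻¹ = _
      rw [cnt_cons, wt_add, wt_single]
      rw [pow_one, mul_pow, mul_inv]
  rw [summable_sigma_of_nonneg fun _ => by positivity]
  refine ⟨fun n => (key n).summable, ?_⟩
  simp_rw [fun n => (key n).tsum_eq]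
  exact summable_geometric_of_lt_one hs0.le hs1

/-- Choosing one tuple for each multi-index makes this a subseries of the sum over tuples. -/
theorem summable_wt : Summable fun α : ℕ →₀ ℕ => (wt α ^ 2)⁻¹ := by
  choose j hj using exists_cnt
  have hinj : Function.Injective fun α : ℕ →₀ ℕ => (⟨α.degree, j α⟩ : Tuple) := by
    intro α β h
    have := congrArg (fun t : Tuple => cnt t.2) h
    simpa [hj] using this
  have := summable_tuple_wt.comp_injective hinj
  simpa [Function.comp_def, hj] using this

/-- The set of the tuples with a given counting multi-index. -/
def fiber (α : ℕ →₀ ℕ) : Set Tuple := {j | cnt j.2 = α}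

/-- All tuples with counts α contribute the same term wt(α)^{-2} to a convergent series. This bounds
the number of arrangements by a power of the weight, without multinomial coefficients. -/
theorem sum_fiber_le (α : ℕ →₀ ℕ) (s : Finset Tuple) (hs : ∀ j ∈ s, cnt j.2 = α) :
    (s.card : ℝ) ≤ (∑' j : Tuple, (wt (cnt j.2) ^ 2)⁻¹) * wt α ^ 2 := by
  have h := summable_tuple_wt.sum_le_tsum s fun _ _ => by positivity
  rw [Finset.sum_congr rfl fun j hj => by rw [hs j hj], Finset.sum_const, nsmul_eq_mul] at h
  have := wt_pos α
  rwa [← div_eq_mul_inv, div_le_iff₀ (by positivity)] at h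

theorem finite_fiber (α : ℕ →₀ ℕ) : (fiber α).Finite := by
  by_contra hinf
  obtain ⟨N, hN⟩ := exists_nat_gt ((∑' j : Tuple, (wt (cnt j.2) ^ 2)⁻¹) * wt α ^ 2)
  obtain ⟨s, hs, hc⟩ := Set.Infinite.exists_subset_card_eq hinf N
  have := sum_fiber_le α s fun j hj => hs hj
  rw [hc] at this
  linarith

instance (α : ℕ →₀ ℕ) : Fintype (fiber α) := (finite_fiber α).fintype

/-- The number of tuples with a given counting multi-index. -/
def mult (α : ℕ →₀ ℕ) : ℕ := Fintype.card (fiber α)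

theorem one_le_mult (α : ℕ →₀ ℕ) : 1 ≤ mult α := by
  obtain ⟨j, hj⟩ := exists_cnt α
  exact Fintype.card_pos_iff.mpr ⟨⟨⟨_, j⟩, hj⟩⟩

/-- The constant `∑_j ∏_i (2j_i+2)^{-2}`, the sum over all tuples. -/
def tupleSum : ℝ := ∑' j : Tuple, (wt (cnt j.2) ^ 2)⁻¹

theorem tupleSum_nonneg : 0 ≤ tupleSum := tsum_nonneg fun _ => by positivity

theorem mult_le (α : ℕ →₀ ℕ) : (mult α : ℝ) ≤ tupleSum * wt α ^ 2 := by
  have := sum_fiber_le α (Finset.univ.map (Function.Embedding.subtype (· ∈ fiber α))) (by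
    intro j hj
    obtain ⟨x, -, rfl⟩ := Finset.mem_map.mp hj
    exact x.2)
  rwa [Finset.card_map, Finset.card_univ] at this

/-- The decay condition `|c_α| ≤ M ℓ_u(|α|)^{1/2} ∏_k (2k+2)^{-q α_k}`. -/
def Decays (u : ℝ → ℝ) (q M : ℝ) (c : (ℕ →₀ ℕ) → ℂ) : Prop :=
  ∀ α, ‖c α‖ ≤ M * rootLegendre u α.degree * wt α ^ (-q)

theorem wt_rpow_neg_two (α : ℕ →₀ ℕ) : wt α ^ (-2 : ℝ) = (wt α ^ 2)⁻¹ := by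
  rw [Real.rpow_neg (wt_pos α).le, Real.rpow_two]

/-! ### Monomials and Hermite polynomials in one variable -/

/-- The growth condition on connection coefficients between monomials and Hermite polynomials. -/
def IsConnection (h : ℕ → ℕ → ℂ) : Prop :=
  ∀ n m, ‖h n m‖ ≤ n.choose m * Real.sqrt (n - m).factorial

/-- The two changes of basis satisfy the same recursion up to a sign, so one induction serves both.
With r = n-k-2, the second term is controlled by (k+2) C(n,k+2) = (r+1) C(n,k+1) and (r+1) √r! ≤
√(r+2)!; Pascal's rule then adds the two terms. -/
theorem isConnection_of_rec {h : ℕ → ℕ → ℂ} (h00 : ‖h 0 0‖ ≤ 1) (h0 : ∀ m, h 0 (m + 1) = 0)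
    (hz : ∀ n, ‖h (n + 1) 0‖ ≤ ‖h n 1‖)
    (hs : ∀ n k, ‖h (n + 1) (k + 1)‖ ≤ ‖h n k‖ + (k + 2) * ‖h n (k + 2)‖) : IsConnection h := by
  intro n
  induction n with
  | zero =>
    rintro (_ | m)
    · simpa using h00
    · simp [h0]
  | succ n ih =>
    rintro (_ | k)
    · refine (hz n).trans ((ih 1).trans ?_)
      rcases n with _ | n
      · simp
      · simp only [Nat.choose_one_right, Nat.choose_zero_right, Nat.cast_one, one_mul]
        apply Real.le_sqrt_of_sq_le
        rw [mul_pow, Real.sq_sqrt (by positivity)]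
        simp only [Nat.add_sub_cancel, Nat.sub_zero, Nat.factorial_succ]
        push_cast
        have : (0 : ℝ) ≤ n.factorial := by positivity
        nlinarith [mul_nonneg (Nat.cast_nonneg n : (0 : ℝ) ≤ n) this]
    · refine (hs n k).trans ?_
      have h2 : (k + 2 : ℝ) * (n.choose (k + 2) * Real.sqrt (n - (k + 2)).factorial)
          ≤ n.choose (k + 1) * Real.sqrt (n - k).factorial := by
        rcases lt_or_ge n (k + 2) with hlt | hle
        · rw [Nat.choose_eq_zero_of_lt hlt]; simp; positivity
        · obtain ⟨r, rfl⟩ := Nat.exists_eq_add_of_le hle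
          have e := Nat.choose_succ_right_eq (k + 2 + r) (k + 1)
          have e' : ((k + 2 + r).choose (k + 2) : ℝ) * (k + 2)
              = (k + 2 + r).choose (k + 1) * (r + 1) := by
            have h3 : k + 2 + r - (k + 1) = r + 1 := by omega
            rw [h3] at e
            have := congrArg (Nat.cast : ℕ → ℝ) e
            push_cast at this
            rw [← this]; ring
          have h4 : k + 2 + r - (k + 2) = r := by omega
          have h5 : k + 2 + r - k = r + 2 := by omega
          rw [h4, h5, ← mul_assoc, mul_comm (k + 2 : ℝ), e', mul_assoc]
          gcongr
          apply Real.le_sqrt_of_sq_le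
          rw [mul_pow, Real.sq_sqrt (by positivity), Nat.factorial_succ, Nat.factorial_succ]
          push_cast
          have : (0 : ℝ) ≤ r.factorial := by positivity
          nlinarith [mul_nonneg (Nat.cast_nonneg r : (0 : ℝ) ≤ r) this]
      calc ‖h n k‖ + (k + 2) * ‖h n (k + 2)‖
          ≤ n.choose k * Real.sqrt (n - k).factorial
            + (k + 2) * (n.choose (k + 2) * Real.sqrt (n - (k + 2)).factorial) := by
              gcongr
              · exact ih k
              · exact ih (k + 2)
        _ ≤ n.choose k * Real.sqrt (n - k).factorial
            + n.choose (k + 1) * Real.sqrt (n - k).factorial := by gcongr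
        _ = _ := by
          rw [Nat.choose_succ_succ, Nat.add_sub_add_right]; push_cast; ring

/-- The Hermite polynomial functions on `ℂ`. -/
def herm (n : ℕ) (z : ℂ) : ℂ := Polynomial.aeval z (Polynomial.hermite n)

theorem herm_zero (z : ℂ) : herm 0 z = 1 := by simp [herm, Polynomial.hermite_zero]

/-- The coefficients of the Hermite polynomials. -/
def hermCoeff (n m : ℕ) : ℂ := ((Polynomial.hermite n).coeff m : ℂ)

/-- The coefficients of the monomials in terms of the Hermite polynomials. -/
def powCoeff : ℕ → ℕ → ℂ
  | 0, 0 => 1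
  | 0, _ + 1 => 0
  | n + 1, 0 => powCoeff n 1
  | n + 1, k + 1 => powCoeff n k + (k + 2) * powCoeff n (k + 2)

theorem isConnection_hermCoeff : IsConnection hermCoeff := by
  refine isConnection_of_rec ?_ ?_ ?_ ?_
  · simp [hermCoeff]
  · intro m; simp [hermCoeff, Polynomial.coeff_one]
  · intro n; rw [hermCoeff, Polynomial.coeff_hermite_succ_zero]; simp [hermCoeff]
  · intro n k
    simp only [hermCoeff, Polynomial.coeff_hermite_succ_succ]
    push_cast
    refine (norm_sub_le _ _).trans (le_of_eq ?_)
    rw [norm_mul]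
    congr 2
    rw [show (k : ℂ) + 2 = ((k + 2 : ℝ) : ℂ) by push_cast; ring, Complex.norm_real]
    exact Real.norm_of_nonneg (by positivity)

theorem isConnection_powCoeff : IsConnection powCoeff := by
  refine isConnection_of_rec ?_ ?_ ?_ ?_
  · simp [powCoeff]
  · intro m; simp [powCoeff]
  · intro n; simp [powCoeff]
  · intro n k
    rw [powCoeff]
    refine (norm_add_le _ _).trans (le_of_eq ?_)
    rw [norm_mul]
    congr 2
    rw [show (k : ℂ) + 2 = ((k + 2 : ℝ) : ℂ) by push_cast; ring, Complex.norm_real]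
    exact Real.norm_of_nonneg (by positivity)

theorem IsConnection.eq_zero {h : ℕ → ℕ → ℂ} (hh : IsConnection h) {n m : ℕ} (hnm : n < m) :
    h n m = 0 := by
  have := hh n m
  rw [Nat.choose_eq_zero_of_lt hnm] at this
  simpa using this

theorem derivative_hermite_succ (n : ℕ) :
    Polynomial.derivative (Polynomial.hermite (n + 1))
      = ((n : ℤ) + 1) • Polynomial.hermite n := by
  induction n with
  | zero => simp [Polynomial.hermite_zero]
  | succ n ih =>
    rw [Polynomial.hermite_succ (n + 1), Polynomial.derivative_sub, Polynomial.derivative_mul,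
      Polynomial.derivative_X, ih, one_mul, Polynomial.derivative_smul]
    have e := Polynomial.hermite_succ n
    rw [add_sub_assoc, mul_smul_comm, ← smul_sub, ← e]
    push_cast
    module

/-- The three-term recurrence, from He_{m+2} = z He_{m+1} - He_{m+1}' and He_{m+1}' = (m+1) He_m. -/
theorem mul_herm (m : ℕ) (z : ℂ) : z * herm (m + 1) z = herm (m + 2) z + (m + 1) * herm m z := by
  have h := Polynomial.hermite_succ (m + 1)
  rw [derivative_hermite_succ] at h
  simp only [herm, h]
  simp

theorem herm_eq_sum (n : ℕ) (z : ℂ) :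
    herm n z = ∑ m ∈ Finset.range (n + 1), hermCoeff n m * z ^ m := by
  rw [herm, Polynomial.aeval_eq_sum_range, Polynomial.natDegree_hermite]
  simp [hermCoeff]

theorem pow_eq_sum (n : ℕ) (z : ℂ) :
    z ^ n = ∑ m ∈ Finset.range (n + 1), powCoeff n m * herm m z := by
  induction n with
  | zero => simp [powCoeff, herm_zero]
  | succ n ih =>
    have hz : ∀ {m}, n < m → powCoeff n m = 0 := fun h => isConnection_powCoeff.eq_zero h
    have h0 : z * herm 0 z = herm 1 z := by simp [herm, Polynomial.hermite_zero]
    rw [pow_succ', ih, Finset.sum_range_succ' _ (n + 1)]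
    simp only [powCoeff]
    have e0 : ∀ k : ℕ, (powCoeff n k + (k + 2) * powCoeff n (k + 2)) * herm (k + 1) z
        = powCoeff n k * herm (k + 1) z + (k + 2) * powCoeff n (k + 2) * herm (k + 1) z :=
      fun k => add_mul _ _ _
    simp_rw [e0, Finset.sum_add_distrib]
    -- The lowering terms are reindexed by one; the two extra terms at the top vanish because
    -- `powCoeff` is triangular.
    have e1 : ∑ k ∈ Finset.range (n + 1), ((k : ℂ) + 2) * powCoeff n (k + 2) * herm (k + 1) z
        + powCoeff n 1 * herm 0 z
        = ∑ k ∈ Finset.range n, ((k : ℂ) + 1) * powCoeff n (k + 1) * herm k z := by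
      have h1 : ∑ k ∈ Finset.range (n + 2), ((k : ℂ) + 1) * powCoeff n (k + 1) * herm k z
          = ∑ k ∈ Finset.range n, ((k : ℂ) + 1) * powCoeff n (k + 1) * herm k z := by
        rw [Finset.sum_range_succ, Finset.sum_range_succ, hz (m := n + 1) (by omega),
          hz (m := n + 1 + 1) (by omega)]
        simp
      rw [← h1, Finset.sum_range_succ' _ (n + 1)]
      congr 1
      · refine Finset.sum_congr rfl fun k _ => ?_
        rw [show k + 1 + 1 = k + 2 from rfl]; push_cast; ring
      · simp
    rw [add_assoc, e1, Finset.sum_range_succ', Finset.sum_range_succ', mul_add, Finset.mul_sum]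
    have e2 : ∀ k, z * (powCoeff n (k + 1) * herm (k + 1) z)
        = powCoeff n (k + 1) * herm (k + 1 + 1) z + (k + 1) * powCoeff n (k + 1) * herm k z := by
      intro k
      rw [mul_left_comm, mul_herm]; ring
    simp_rw [e2, Finset.sum_add_distrib]
    rw [mul_left_comm, h0]
    ring

/-! ### Several variables -/

/-- The product `∏_k P_{α_k}(x_k)`. -/
def mprod (P : ℕ → ℂ → ℂ) (x : ℕ → ℂ) (α : ℕ →₀ ℕ) : ℂ := α.prod fun k m => P m (x k)

/-- The monomials on `ℂ`. -/
def mono (n : ℕ) (z : ℂ) : ℂ := z ^ n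

/-- The connection coefficients in several variables. -/
def multiConn (h : ℕ → ℕ → ℂ) (β α : ℕ →₀ ℕ) : ℂ :=
  open Classical in if α ≤ β then ∏ k ∈ β.support, h (β k) (α k) else 0

theorem mem_finsupp_range {α β : ℕ →₀ ℕ} :
    α ∈ β.support.finsupp (fun k => Finset.range (β k + 1)) ↔ α ≤ β := by
  rw [Finset.mem_finsupp_iff]
  constructor
  · rintro ⟨h1, h2⟩ k
    by_cases hk : k ∈ β.support
    · have := h2 k hk
      rw [Finset.mem_range] at this; omega
    · have : k ∉ α.support := fun h => hk (h1 h)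
      rw [Finsupp.notMem_support_iff.mp this]; exact Nat.zero_le _
  · intro h
    exact ⟨Finsupp.support_mono h, fun k _ => Finset.mem_range.mpr (Nat.lt_succ_of_le (h k))⟩

/-- Multiplying out the one-variable expansions gives a finite sum over α ≤ β. The normalization Q 0
= 1 lets the product over the support of α be taken over the support of β. -/
theorem hasSum_multiConn {h : ℕ → ℕ → ℂ} {P Q : ℕ → ℂ → ℂ} (hQ : ∀ z, Q 0 z = 1)
    (hPQ : ∀ n z, P n z = ∑ m ∈ Finset.range (n + 1), h n m * Q m z) (x : ℕ → ℂ) (β : ℕ →₀ ℕ) :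
    HasSum (fun α => multiConn h β α * mprod Q x α) (mprod P x β) := by
  have e : mprod P x β = ∑ α ∈ β.support.finsupp (fun k => Finset.range (β k + 1)),
      multiConn h β α * mprod Q x α := by
    have e1 : ∀ α ∈ β.support.finsupp (fun k => Finset.range (β k + 1)),
        multiConn h β α * mprod Q x α = ∏ k ∈ β.support, h (β k) (α k) * Q (α k) (x k) := by
      intro α hα
      have hle := mem_finsupp_range.mp hα
      rw [multiConn, if_pos hle, Finset.prod_mul_distrib, mprod,
        Finsupp.prod_of_support_subset _ (Finsupp.support_mono hle) _ fun _ _ => hQ _]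
    rw [Finset.sum_congr rfl e1, mprod, Finsupp.prod]
    simp_rw [hPQ]
    rw [Finset.prod_sum, Finset.finsupp, Finset.sum_map]
    refine Finset.sum_congr (by congr!) fun p _ => ?_
    rw [← Finset.prod_attach β.support]
    refine Finset.prod_congr rfl fun k _ => ?_
    simp [Finsupp.indicator_of_mem k.2]
  rw [e]
  refine hasSum_sum_of_ne_finset_zero fun α hα => ?_
  rw [mem_finsupp_range] at hα
  rw [multiConn, if_neg hα, zero_mul]

/-- Binomial coefficients are at most powers of 2, and a product of factorials divides the factorial
of the sum. -/
theorem norm_multiConn_le {h : ℕ → ℕ → ℂ} (hh : IsConnection h) {β α : ℕ →₀ ℕ} (hle : α ≤ β) :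
    ‖multiConn h β α‖ ≤ 2 ^ β.degree * Real.sqrt (β - α).degree.factorial := by
  rw [multiConn, if_pos hle, norm_prod]
  have h1 : ∀ k ∈ β.support, ‖h (β k) (α k)‖ ≤ 2 ^ β k * Real.sqrt ((β - α) k).factorial := by
    intro k _
    refine (hh _ _).trans ?_
    gcongr
    · exact_mod_cast Nat.choose_le_two_pow _ _
    · rfl
  refine (Finset.prod_le_prod (fun _ _ => norm_nonneg _) h1).trans ?_
  rw [Finset.prod_mul_distrib, Finset.prod_pow_eq_pow_sum, ← Finsupp.degree_apply]
  gcongr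
  rw [← Real.sqrt_prod _ fun _ _ => by positivity]
  apply Real.sqrt_le_sqrt
  have h2 : (β - α).degree = ∑ k ∈ β.support, (β - α) k := by
    rw [Finsupp.degree_apply]
    refine Finset.sum_subset (Finsupp.support_mono tsub_le_self) fun k _ hk => ?_
    exact Finsupp.notMem_support_iff.mp hk
  rw [h2]
  exact_mod_cast Nat.le_of_dvd (Nat.factorial_pos _) (Nat.prod_factorial_dvd_factorial_sum _ _)

/-- The bound on connection coefficients relative to the weight function `u`. -/
def ConnBound (u : ℝ → ℝ) (C κ : ℝ) : Prop :=
  0 ≤ C ∧ 0 ≤ κ ∧ (∀ n m : ℕ, rootLegendre u (n + m) * Real.sqrt m.factorial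
      ≤ C * 2 ^ (κ * m) * rootLegendre u n) ∧
  ∀ h, IsConnection h → ∀ β α : ℕ →₀ ℕ,
    rootLegendre u β.degree * ‖multiConn h β α‖ ≤ C * wt β ^ κ * rootLegendre u α.degree

theorem IsWeight.exists_connBound {u : ℝ → ℝ} (hu : IsWeight u) : ∃ C κ, ConnBound u C κ := by
  obtain ⟨C, κ, hC, hb⟩ := hu.exists_rootLegendre_add_le
  -- The additional 1 pays for the factor 2^{|β|} from the binomial coefficients.
  refine ⟨C, κ + 1, by positivity, by positivity, ?_, ?_⟩
  · intro n m
    refine (hb n m).trans ?_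
    have := (hu.rootLegendre_pos n).le
    gcongr
    rw [← Real.rpow_natCast 2 (κ * m)]
    apply Real.rpow_le_rpow_of_exponent_le one_le_two
    push_cast
    nlinarith [(Nat.cast_nonneg m : (0 : ℝ) ≤ m)]
  intro h hh β α
  by_cases hle : α ≤ β
  · have hd : β.degree = α.degree + (β - α).degree := by
      rw [← map_add, add_tsub_cancel_of_le hle]
    have h1 := norm_multiConn_le hh hle
    have h2 := hb α.degree (β - α).degree
    rw [← hd] at h2
    have hG := (hu.rootLegendre_pos β.degree).le
    have hG' := (hu.rootLegendre_pos α.degree).le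
    calc rootLegendre u β.degree * ‖multiConn h β α‖
        ≤ rootLegendre u β.degree * (2 ^ β.degree * Real.sqrt (β - α).degree.factorial) := by gcongr
      _ = 2 ^ β.degree * (rootLegendre u β.degree * Real.sqrt (β - α).degree.factorial) := by ring
      _ ≤ 2 ^ β.degree * (C * 2 ^ (κ * (β - α).degree) * rootLegendre u α.degree) := by gcongr
      _ ≤ 2 ^ β.degree * (C * 2 ^ (κ * β.degree) * rootLegendre u α.degree) := by
          gcongr
          · exact one_le_two
          · omega
      _ = C * (2 ^ β.degree) ^ (κ + 1) * rootLegendre u α.degree := by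
          rw [mul_comm κ, pow_mul, pow_succ]; ring
      _ ≤ C * wt β ^ (κ + 1) * rootLegendre u α.degree := by
          gcongr; exact two_pow_degree_le_wt β
      _ = _ := by rw [← Real.rpow_natCast (wt β)]; push_cast; rfl
  · have := (hu.rootLegendre_pos α.degree).le
    have := wt_pos β
    rw [multiConn, if_neg hle, norm_zero, mul_zero]
    positivity

/-- The constant `∑_α ∏_k (2k+2)^{-2α_k}`. -/
def wtSum : ℝ := ∑' α : ℕ →₀ ℕ, (wt α ^ 2)⁻¹

theorem wtSum_nonneg : 0 ≤ wtSum := tsum_nonneg fun _ => by positivity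

/-- Change of coefficients between expansions in monomials and in Hermite polynomials. -/
def transform (h : ℕ → ℕ → ℂ) (d : (ℕ →₀ ℕ) → ℂ) (α : ℕ →₀ ℕ) : ℂ := ∑' β, d β * multiConn h β α

section transform

variable {u : ℝ → ℝ} {C κ : ℝ} {h : ℕ → ℕ → ℂ}

/-- The connection coefficient consumes κ of the decay in β. The remaining q is divided: the part r
passes to α, since wt(α) ≤ wt(β) when α ≤ β, and the part q - r is kept for summing over β. -/
theorem norm_mul_multiConn_le (hu : IsWeight u) (hb : ConnBound u C κ) (hh : IsConnection h)
    {q M : ℝ} {d : (ℕ →₀ ℕ) → ℂ} (hM : 0 ≤ M) (hd : Decays u (q + κ) M d)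
    {r : ℝ} (hr : 0 ≤ r) (β α : ℕ →₀ ℕ) :
    ‖d β * multiConn h β α‖
      ≤ M * C * rootLegendre u α.degree * (wt α ^ (-r) * wt β ^ (-(q - r))) := by
  have hα := (hu.rootLegendre_pos α.degree).le
  have hwβ := wt_pos β
  have hwα := wt_pos α
  by_cases hle : α ≤ β
  · rw [norm_mul]
    calc ‖d β‖ * ‖multiConn h β α‖
        ≤ (M * rootLegendre u β.degree * wt β ^ (-(q + κ))) * ‖multiConn h β α‖ := by
          gcongr; exact hd β
      _ = M * wt β ^ (-(q + κ)) * (rootLegendre u β.degree * ‖multiConn h β α‖) := by ring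
      _ ≤ M * wt β ^ (-(q + κ)) * (C * wt β ^ κ * rootLegendre u α.degree) := by
          refine mul_le_mul_of_nonneg_left (hb.2.2.2 h hh β α) ?_
          positivity
      _ = M * C * rootLegendre u α.degree * (wt β ^ (-(q + κ)) * wt β ^ κ) := by ring
      _ = M * C * rootLegendre u α.degree * (wt β ^ (-r) * wt β ^ (-(q - r))) := by
          rw [← Real.rpow_add hwβ, ← Real.rpow_add hwβ]; congr 2; ring
      _ ≤ _ := by
          have := hb.1
          gcongr M * C * rootLegendre u α.degree * (?_ * _)
          rw [Real.rpow_neg hwβ.le, Real.rpow_neg hwα.le]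
          gcongr
          exact wt_mono hle
  · rw [multiConn, if_neg hle, mul_zero, norm_zero]
    have := hb.1
    positivity

/-- The loss is κ for the connection coefficients and 2 for the sum over β. -/
theorem Decays.transform (hu : IsWeight u) (hb : ConnBound u C κ) (hh : IsConnection h)
    {q M : ℝ} {d : (ℕ →₀ ℕ) → ℂ} (hM : 0 ≤ M) (hd : Decays u (q + 2 + κ) M d) (hq : 0 ≤ q) :
    Decays u q (M * C * wtSum) (transform h d) := by
  intro α
  refine (tsum_of_norm_bounded ((summable_wt.hasSum.mul_left
    (M * C * rootLegendre u α.degree * wt α ^ (-q)))) fun β => ?_).trans (le_of_eq ?_)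
  · refine (norm_mul_multiConn_le hu hb hh hM hd hq β α).trans
      (le_of_eq ?_)
    rw [show -(q + 2 - q) = -2 by ring, wt_rpow_neg_two]; ring
  · rw [wtSum]; ring

/-- Fubini for the absolutely convergent double series over (β, α). The exponent p + 4 + κ allows p
for the size of the Q-products at x, 2 for each of the two sums, and κ for the connection
coefficients. -/
theorem exists_hasSum_transform (hu : IsWeight u) (hb : ConnBound u C κ) (hh : IsConnection h)
    {P Q : ℕ → ℂ → ℂ} (hQ : ∀ z, Q 0 z = 1)
    (hPQ : ∀ n z, P n z = ∑ m ∈ Finset.range (n + 1), h n m * Q m z) {x : ℕ → ℂ}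
    {p B : ℝ} (hp : 0 ≤ p)
    (hx : ∀ α, rootLegendre u α.degree * ‖mprod Q x α‖ ≤ B * wt α ^ p)
    {M : ℝ} {d : (ℕ →₀ ℕ) → ℂ} (hM : 0 ≤ M) (hd : Decays u (p + 4 + κ) M d) :
    ∃ S, HasSum (fun β => d β * mprod P x β) S ∧
      HasSum (fun α => WhiteNoise.transform h d α * mprod Q x α) S := by
  have hbound : ∀ β α, ‖d β * multiConn h β α * mprod Q x α‖
      ≤ M * C * B * ((wt β ^ 2)⁻¹ * (wt α ^ 2)⁻¹) := by
    intro β α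
    have hC := hb.1
    rw [norm_mul]
    refine (mul_le_mul_of_nonneg_right (norm_mul_multiConn_le hu hb hh hM hd
      (r := p + 2) (by linarith) β α) (norm_nonneg _)).trans ?_
    have hwα := wt_pos α
    have hwβ := wt_pos β
    calc _ = M * C * (wt α ^ (-(p + 2)) * wt β ^ (-(p + 4 - (p + 2))))
          * (rootLegendre u α.degree * ‖mprod Q x α‖) := by ring
      _ ≤ M * C * (wt α ^ (-(p + 2)) * wt β ^ (-(p + 4 - (p + 2)))) * (B * wt α ^ p) := by
          refine mul_le_mul_of_nonneg_left (hx α) ?_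
          positivity
      _ = M * C * B * ((wt α ^ (-(p + 2)) * wt α ^ p) * wt β ^ (-(p + 4 - (p + 2)))) := by ring
      _ = _ := by
          rw [← Real.rpow_add hwα, show -(p + 2) + p = -2 by ring,
            show -(p + 4 - (p + 2)) = -2 by ring, wt_rpow_neg_two, wt_rpow_neg_two]; ring
  have hsum : Summable fun z : (ℕ →₀ ℕ) × (ℕ →₀ ℕ) =>
      d z.1 * multiConn h z.1 z.2 * mprod Q x z.2 := by
    refine Summable.of_norm_bounded (g := fun z : (ℕ →₀ ℕ) × (ℕ →₀ ℕ) =>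
      M * C * B * ((wt z.1 ^ 2)⁻¹ * (wt z.2 ^ 2)⁻¹)) ?_ fun z => hbound z.1 z.2
    have h0 : (0 : (ℕ →₀ ℕ) → ℝ) ≤ fun α => (wt α ^ 2)⁻¹ := fun _ => inv_nonneg.mpr (sq_nonneg _)
    exact (summable_wt.mul_of_nonneg summable_wt h0 h0).mul_left _
  obtain ⟨S, hS⟩ := hsum
  refine ⟨S, hS.prod_fiberwise fun β => ?_, ?_⟩
  · have := (hasSum_multiConn hQ hPQ x β).mul_left (d β)
    simpa only [mul_assoc] using this
  · have h2 : HasSum (fun z : (ℕ →₀ ℕ) × (ℕ →₀ ℕ) =>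
        d z.2 * multiConn h z.2 z.1 * mprod Q x z.1) S :=
      (Equiv.prodComm (ℕ →₀ ℕ) (ℕ →₀ ℕ)).hasSum_iff.mpr hS
    refine h2.prod_fiberwise fun α => ?_
    have h3 : Summable fun β => d β * multiConn h β α := by
      refine Summable.of_norm_bounded (summable_wt.mul_left
        (M * C * rootLegendre u α.degree * wt α ^ (-(p + 2)))) fun β => ?_
      refine (norm_mul_multiConn_le hu hb hh hM hd
        (r := p + 2) (by linarith) β α).trans (le_of_eq ?_)
      rw [show -(p + 4 - (p + 2)) = -2 by ring, wt_rpow_neg_two]; ring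
    have h4 := h3.hasSum.mul_right (mprod Q x α)
    unfold WhiteNoise.transform
    exact h4

/-- Carries a pointwise bound at x from the Q-products to the P-products. It supplies the bound on
Hermite products that Fubini needs, starting from the direct bound on monomials. -/
theorem mprod_bound (hu : IsWeight u) (hb : ConnBound u C κ) (hh : IsConnection h)
    {P Q : ℕ → ℂ → ℂ} (hQ : ∀ z, Q 0 z = 1)
    (hPQ : ∀ n z, P n z = ∑ m ∈ Finset.range (n + 1), h n m * Q m z) {x : ℕ → ℂ}
    {p B : ℝ} (hp : 0 ≤ p) (hB : 0 ≤ B)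
    (hx : ∀ α, rootLegendre u α.degree * ‖mprod Q x α‖ ≤ B * wt α ^ p) (β : ℕ →₀ ℕ) :
    rootLegendre u β.degree * ‖mprod P x β‖ ≤ C * B * wtSum * wt β ^ (κ + p + 2) := by
  have hC := hb.1
  have hwβ := wt_pos β
  have hG := (hu.rootLegendre_pos β.degree).le
  rw [← Real.norm_of_nonneg hG, ← Complex.norm_real, ← norm_mul,
    ← ((hasSum_multiConn hQ hPQ x β).mul_left (rootLegendre u β.degree : ℂ)).tsum_eq]
  refine (tsum_of_norm_bounded (summable_wt.hasSum.mul_left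
    (C * B * wt β ^ (κ + p + 2))) fun α => ?_).trans (le_of_eq ?_)
  · have hwα := wt_pos α
    by_cases hle : α ≤ β
    · rw [norm_mul, norm_mul, Complex.norm_real, Real.norm_of_nonneg hG]
      calc _ = (rootLegendre u β.degree * ‖multiConn h β α‖) * ‖mprod Q x α‖ := by ring
        _ ≤ (C * wt β ^ κ * rootLegendre u α.degree) * ‖mprod Q x α‖ := by
            exact mul_le_mul_of_nonneg_right (hb.2.2.2 h hh β α) (norm_nonneg _)
        _ = C * wt β ^ κ * (rootLegendre u α.degree * ‖mprod Q x α‖) := by ring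
        _ ≤ C * wt β ^ κ * (B * wt α ^ p) := by
            refine mul_le_mul_of_nonneg_left (hx α) ?_
            positivity
        -- A summable factor in α is created at the price of two more powers, which are moved to β.
        _ = C * B * wt β ^ κ * (wt α ^ (p + 2) * wt α ^ (-2 : ℝ)) := by
            rw [← Real.rpow_add hwα, show p + 2 + -2 = p by ring]; ring
        _ ≤ C * B * wt β ^ κ * (wt β ^ (p + 2) * wt α ^ (-2 : ℝ)) := by
            gcongr; exact wt_mono hle
        _ = _ := by
            rw [wt_rpow_neg_two, add_assoc, Real.rpow_add hwβ κ]; ring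
    · rw [multiConn, if_neg hle, zero_mul, mul_zero, norm_zero]
      positivity
  · rw [wtSum]; ring

end transform

/-! ### Power series of entire functions of several variables -/

theorem hasSum_geometric_pi : ∀ {N : ℕ} (x : Fin N → ℂ), (∀ k, ‖x k‖ < 1) →
    Summable (fun β : Fin N → ℕ => ‖∏ k, x k ^ β k‖) ∧
    HasSum (fun β : Fin N → ℕ => ∏ k, x k ^ β k) (∏ k, (1 - x k)⁻¹) := by
  intro N
  induction N with
  | zero =>
    intro x _
    refine ⟨(hasSum_fintype _).summable, ?_⟩
    convert hasSum_fintype (fun β : Fin 0 → ℕ => ∏ k, x k ^ β k) using 1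
    simp
  | succ N ih =>
    intro x hx
    obtain ⟨h1, h2⟩ := ih (fun k => x k.succ) fun k => hx _
    have g1 : Summable fun n : ℕ => ‖x 0 ^ n‖ := by
      simpa using summable_geometric_of_lt_one (norm_nonneg _) (hx 0)
    have e : ∀ p : ℕ × (Fin N → ℕ),
        ∏ k, x k ^ ((Fin.consEquiv fun _ : Fin (N + 1) => ℕ) p) k
          = x 0 ^ p.1 * ∏ k, x (Fin.succ k) ^ p.2 k := by
      intro p
      rw [Fin.prod_univ_succ]
      simp [Fin.consEquiv]
    constructor
    · rw [← (Fin.consEquiv fun _ : Fin (N + 1) => ℕ).summable_iff]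
      refine (g1.mul_norm h1).congr fun p => ?_
      simp only [Function.comp_apply, e]
    · rw [← (Fin.consEquiv fun _ : Fin (N + 1) => ℕ).hasSum_iff, Fin.prod_univ_succ]
      have g2 := hasSum_geometric_of_norm_lt_one (hx 0)
      have g3 : Summable fun p : ℕ × (Fin N → ℕ) => x 0 ^ p.1 * ∏ k, x (Fin.succ k) ^ p.2 k :=
        summable_mul_of_summable_norm (f := fun n : ℕ => x 0 ^ n)
          (g := fun β : Fin N → ℕ => ∏ k, x (Fin.succ k) ^ β k) g1 h1
      have h3 : HasSum (fun p : ℕ × (Fin N → ℕ) => x 0 ^ p.1 * ∏ k, x (Fin.succ k) ^ p.2 k)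
          ((1 - x 0)⁻¹ * ∏ k : Fin N, (1 - x k.succ)⁻¹) := 
        HasSum.mul (f := fun n : ℕ => x 0 ^ n)
          (g := fun β : Fin N → ℕ => ∏ k, x (Fin.succ k) ^ β k) g2 h2 g3
      refine h3.congr_fun fun p => ?_
      simp only [Function.comp_apply, e]

theorem norm_torusMap {N : ℕ} {R : Fin N → ℝ} (hR : ∀ k, 0 < R k) (θ : Fin N → ℝ) (k : Fin N) :
    ‖torusMap 0 R θ k‖ = R k := by
  simp [torusMap, Complex.norm_exp_ofReal_mul_I, abs_of_pos (hR k)]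

theorem continuous_torusMap {N : ℕ} (R : Fin N → ℝ) : Continuous (torusMap 0 R) := by
  unfold torusMap
  fun_prop

/-- Cauchy's formula in one variable, applied successively to the coordinates. -/
theorem torusIntegral_cauchy : ∀ {N : ℕ} {f : (Fin N → ℂ) → ℂ} (_ : Differentiable ℂ f)
    {R : Fin N → ℝ} (_ : ∀ k, 0 < R k) {z : Fin N → ℂ} (_ : ∀ k, ‖z k‖ < R k),
    torusIntegral (fun w => (∏ k, (w k - z k)⁻¹) * f w) 0 R
      = (2 * Real.pi * Complex.I) ^ N * f z := by
  intro N
  induction N with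
  | zero =>
    intro f _ R _ z _
    rw [torusIntegral_dim0]
    simp [Subsingleton.elim z 0]
  | succ N ih =>
    intro f hf R hR z hz
    rw [torusIntegral_succ]
    · have h1 : ∀ w : ℂ, torusIntegral (fun y : Fin N → ℂ =>
          (∏ k, ((Fin.cons w y : Fin (N + 1) → ℂ) k - z k)⁻¹) * f (Fin.cons w y))
          ((0 : Fin (N + 1) → ℂ) ∘ Fin.succ) (R ∘ Fin.succ)
          = (w - z 0)⁻¹ * ((2 * Real.pi * Complex.I) ^ N * f (Fin.cons w fun k => z k.succ)) := by
        intro w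
        have hd : Differentiable ℂ fun y : Fin N → ℂ => f (Fin.cons w y) := by
          refine hf.comp (differentiable_pi.mpr fun k => ?_)
          refine Fin.cases ?_ (fun k => ?_) k
          · simp
          · simp only [Fin.cons_succ]; fun_prop
        rw [← ih hd (R := R ∘ Fin.succ) (fun k => hR _) fun k => hz _, ← torusIntegral_const_mul]
        congr 1
        ext y
        rw [Fin.prod_univ_succ]
        simp only [Fin.cons_zero, Fin.cons_succ, mul_assoc]
      simp_rw [h1]
      have hd : Differentiable ℂ fun w : ℂ =>
          (2 * Real.pi * Complex.I) ^ N * f (Fin.cons w fun k => z k.succ) := by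
        refine (hf.comp (differentiable_pi.mpr fun k => ?_)).const_mul _
        refine Fin.cases ?_ (fun k => ?_) k
        · simp only [Fin.cons_zero]; fun_prop
        · simp
      have h2 := hd.differentiableOn.circleIntegral_sub_inv_smul (c := 0) (R := R 0) (w := z 0)
        (by simpa using hz 0)
      simp only [smul_eq_mul] at h2
      simp only [Pi.zero_apply]
      rw [h2, pow_succ', ← mul_assoc]
      congr 2
      exact Fin.cons_self_tail z
    · refine Continuous.integrableOn_Icc ?_
      have hc := continuous_torusMap R
      refine Continuous.mul (continuous_finsetProd _ fun k _ => Continuous.inv₀ ?_ fun θ => ?_)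
        (hf.continuous.comp hc)
      · exact ((continuous_apply k).comp hc).sub continuous_const
      · rw [sub_ne_zero]
        intro h
        have := norm_torusMap hR θ k
        rw [h] at this
        exact (hz k).ne this

/-- The Taylor coefficients, given by the Cauchy integrals over a torus. -/
def cauchyCoeff {N : ℕ} (f : (Fin N → ℂ) → ℂ) (R : Fin N → ℝ) (β : Fin N → ℕ) : ℂ :=
  ((2 * Real.pi * Complex.I) ^ N)⁻¹ *
    torusIntegral (fun w => (∏ k, (w k ^ (β k + 1))⁻¹) * f w) 0 R

theorem norm_cauchyCoeff_le {N : ℕ} {f : (Fin N → ℂ) → ℂ} {R : Fin N → ℝ} (hR : ∀ k, 0 < R k)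
    {M : ℝ} (hM : ∀ z, (∀ k, ‖z k‖ = R k) → ‖f z‖ ≤ M) (β : Fin N → ℕ) :
    ‖cauchyCoeff f R β‖ * ∏ k, R k ^ β k ≤ M := by
  have hp : 0 < ∏ k, R k ^ β k := Finset.prod_pos fun k _ => pow_pos (hR k) _
  have hp1 : 0 < ∏ k, R k := Finset.prod_pos fun k _ => hR k
  have h := norm_torusIntegral_le_of_norm_le_const (c := 0) (R := R)
    (f := fun w => (∏ k, (w k ^ (β k + 1))⁻¹) * f w) (C := (∏ k, R k ^ (β k + 1))⁻¹ * M) (by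
      intro θ
      have h1 := norm_torusMap hR θ
      rw [norm_mul, norm_prod]
      simp only [norm_inv, norm_pow, h1, Finset.prod_inv_distrib]
      have : 0 < ∏ k, R k ^ (β k + 1) := Finset.prod_pos fun k _ => pow_pos (hR k) _
      gcongr
      exact hM _ h1)
  have h2 : ∏ k, |R k| = ∏ k, R k := Finset.prod_congr rfl fun k _ => abs_of_pos (hR k)
  have h3 : ∏ k, R k ^ (β k + 1) = (∏ k, R k ^ β k) * ∏ k, R k := by
    rw [← Finset.prod_mul_distrib]; rfl
  rw [h2, h3] at h
  rw [cauchyCoeff, norm_mul, norm_inv, norm_pow]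
  have h4 : ‖(2 * Real.pi * Complex.I : ℂ)‖ = 2 * Real.pi := by
    simp [abs_of_pos Real.pi_pos]
  rw [h4]
  have hπ : (0 : ℝ) < (2 * Real.pi) ^ N := by have := Real.pi_pos; positivity
  calc _ ≤ ((2 * Real.pi) ^ N)⁻¹ * ((2 * Real.pi) ^ N * (∏ k, R k)
        * (((∏ k, R k ^ β k) * ∏ k, R k)⁻¹ * M)) * ∏ k, R k ^ β k := by gcongr
    _ = M := by field_simp

/-- The Cauchy kernel is expanded in a multiple geometric series in z_k/w_k, and dominated
convergence integrates it term by term over the torus. -/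
theorem hasSum_cauchyCoeff {N : ℕ} {f : (Fin N → ℂ) → ℂ} (hf : Differentiable ℂ f)
    {R : Fin N → ℝ} (hR : ∀ k, 0 < R k) {M : ℝ} (hM : ∀ z, (∀ k, ‖z k‖ = R k) → ‖f z‖ ≤ M)
    {z : Fin N → ℂ} (hz : ∀ k, ‖z k‖ < R k) :
    HasSum (fun β => cauchyCoeff f R β * ∏ k, z k ^ β k) (f z) := by
  have hπ : ((2 * Real.pi * Complex.I : ℂ) ^ N) ≠ 0 := by
    have : (Real.pi : ℂ) ≠ 0 := by exact_mod_cast Real.pi_ne_zero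
    simp [this]
  have hgeo : ∀ θ, HasSum (fun β : Fin N → ℕ => ∏ k, (z k / torusMap 0 R θ k) ^ β k)
      (∏ k, (1 - z k / torusMap 0 R θ k)⁻¹) := fun θ => (hasSum_geometric_pi _ fun k => by
        rw [norm_div, norm_torusMap hR, div_lt_one (hR k)]; exact hz k).2
  have hgeo2 : Summable fun β : Fin N → ℕ => ∏ k, (‖z k‖ / R k) ^ β k := by
    have := (hasSum_geometric_pi (fun k => z k / R k) fun k => by
        rw [norm_div, Complex.norm_real, Real.norm_of_nonneg (hR k).le, div_lt_one (hR k)]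
        exact hz k).1
    refine this.congr fun β => ?_
    rw [norm_prod]
    refine Finset.prod_congr rfl fun k _ => ?_
    rw [norm_pow, norm_div, Complex.norm_real, Real.norm_of_nonneg (hR k).le]
  have hc := continuous_torusMap R
  have hne : ∀ θ k, torusMap 0 R θ k ≠ 0 := fun θ k h => by
    have := norm_torusMap hR θ k
    rw [h, norm_zero] at this
    exact (hR k).ne this
  have key : HasSum (fun β : Fin N → ℕ =>
      torusIntegral (fun w => (∏ k, (w k ^ (β k + 1))⁻¹) * f w) 0 R * ∏ k, z k ^ β k)
      (torusIntegral (fun w => (∏ k, (w k - z k)⁻¹) * f w) 0 R) := by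
    have e : ∀ β : Fin N → ℕ,
        torusIntegral (fun w => (∏ k, (w k ^ (β k + 1))⁻¹) * f w) 0 R * ∏ k, z k ^ β k
        = torusIntegral (fun w => (∏ k, (z k / w k) ^ β k) * ((∏ k, (w k)⁻¹) * f w)) 0 R := by
      intro β
      rw [mul_comm, ← torusIntegral_const_mul]
      congr 1
      ext w
      rw [← mul_assoc, ← mul_assoc, ← Finset.prod_mul_distrib, ← Finset.prod_mul_distrib]
      congr 1
      refine Finset.prod_congr rfl fun k _ => ?_
      rw [div_pow, div_eq_mul_inv, pow_succ, mul_inv, mul_assoc]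
    simp_rw [e]
    refine hasSum_integral_of_dominated_convergence
      (fun β _ => (∏ k, (‖z k‖ / R k) ^ β k) * M) (fun β => ?_) (fun β => ?_) ?_ ?_ ?_
    · refine Continuous.aestronglyMeasurable ?_
      have hs : Continuous fun θ : Fin N → ℝ =>
          ∏ i, (R i * Complex.exp (θ i * Complex.I) * Complex.I : ℂ) :=
        continuous_finsetProd _ fun k _ => by fun_prop
      show Continuous fun θ : Fin N → ℝ =>
        (∏ i, (R i * Complex.exp (θ i * Complex.I) * Complex.I : ℂ)) •
          ((∏ k, (z k / torusMap 0 R θ k) ^ β k) *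
            ((∏ k, (torusMap 0 R θ k)⁻¹) * f (torusMap 0 R θ)))
      refine hs.smul (Continuous.mul ?_ (Continuous.mul ?_
        (hf.continuous.comp hc)))
      · exact continuous_finsetProd _ fun k _ =>
          (continuous_const.div ((continuous_apply k).comp hc) fun θ => hne θ k).pow _
      · exact continuous_finsetProd _ fun k _ =>
          ((continuous_apply k).comp hc).inv₀ fun θ => hne θ k
    · refine ae_of_all _ fun θ => ?_
      have h1 := norm_torusMap hR θ
      rw [norm_smul, norm_mul, norm_mul, norm_prod, norm_prod, norm_prod]
      simp only [norm_mul, norm_pow, norm_div, norm_inv, h1, Complex.norm_I, mul_one,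
        Complex.norm_exp_ofReal_mul_I, Complex.norm_real, Finset.prod_inv_distrib]
      have h2 : ∏ k, ‖R k‖ = ∏ k, R k :=
        Finset.prod_congr rfl fun k _ => Real.norm_of_nonneg (hR k).le
      rw [h2]
      have hp1 : 0 < ∏ k, R k := Finset.prod_pos fun k _ => hR k
      have hp2 : 0 ≤ ∏ k, (‖z k‖ / R k) ^ β k := Finset.prod_nonneg fun k _ => by
        have := hR k; positivity
      calc _ = (∏ k, (‖z k‖ / R k) ^ β k) * ‖f (torusMap 0 R θ)‖ := by field_simp
        _ ≤ _ := by gcongr; exact hM _ h1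
    · exact ae_of_all _ fun θ => hgeo2.mul_right _
    · exact continuous_const.integrableOn_Icc
    · refine ae_of_all _ fun θ => HasSum.const_smul _ ?_
      have h3 := (hgeo θ).mul_right ((∏ k, (torusMap 0 R θ k)⁻¹) * f (torusMap 0 R θ))
      rw [← mul_assoc, ← Finset.prod_mul_distrib] at h3
      have e3 : ∀ k, (1 - z k / torusMap 0 R θ k)⁻¹ * (torusMap 0 R θ k)⁻¹
          = (torusMap 0 R θ k - z k)⁻¹ := fun k => by
        rw [← mul_inv, sub_mul, one_mul, div_mul_cancel₀ _ (hne θ k)]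
      simp_rw [e3] at h3
      exact h3
  rw [torusIntegral_cauchy hf hR hz] at key
  have h5 := key.mul_left ((2 * Real.pi * Complex.I : ℂ) ^ N)⁻¹
  rw [inv_mul_cancel_left₀ hπ] at h5
  simpa only [cauchyCoeff, mul_assoc] using h5

theorem eq_zero_of_hasSum_pow {a : ℕ → ℂ} {ρ : ℝ} (hρ : 0 < ρ)
    (h : ∀ w : ℂ, ‖w‖ < ρ → HasSum (fun m => a m * w ^ m) 0) : a = 0 := by
  have h1 : HasFPowerSeriesAt (0 : ℂ → ℂ) (FormalMultilinearSeries.ofScalars ℂ a) 0 := by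
    rw [hasFPowerSeriesAt_iff]
    filter_upwards [Metric.ball_mem_nhds (0 : ℂ) hρ] with w hw
    have := h w (by simpa using hw)
    simpa [FormalMultilinearSeries.coeff_ofScalars, mul_comm] using this
  have h2 := h1.eq_zero
  ext m
  rw [← FormalMultilinearSeries.coeff_ofScalars (𝕜 := ℂ) (p := a), h2]
  rfl

/-- Summing first over the other variables leaves a power series in the first one, whose
coefficients vanish; induction applies to each of them. -/
theorem eq_zero_of_hasSum_multi : ∀ {N : ℕ} {d : (Fin N → ℕ) → ℂ} {ρ : Fin N → ℝ}
    (_ : ∀ k, 0 < ρ k)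
    (_ : ∀ z : Fin N → ℂ, (∀ k, ‖z k‖ < ρ k) → HasSum (fun β => d β * ∏ k, z k ^ β k) 0),
    d = 0 := by
  intro N
  induction N with
  | zero =>
    intro d ρ _ h
    have h1 := h 0 fun k => k.elim0
    have h2 := h1.unique (hasSum_unique _)
    ext β
    rw [Finset.univ_eq_empty, Finset.prod_empty, mul_one] at h2
    exact (congrArg d (Subsingleton.elim _ _)).trans h2.symm
  | succ N ih =>
    intro d ρ hρ h
    have h1 : ∀ (w : ℂ) (z : Fin N → ℂ), ‖w‖ < ρ 0 → (∀ k, ‖z k‖ < ρ k.succ) →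
        HasSum (fun p : ℕ × (Fin N → ℕ) =>
          (d (Fin.cons p.1 p.2) * ∏ k, z k ^ p.2 k) * w ^ p.1) 0 := by
      intro w z hw hz
      have := h (Fin.cons w z) fun k => by
        refine Fin.cases ?_ (fun k => ?_) k
        · simpa using hw
        · simpa using hz k
      rw [← (Fin.consEquiv fun _ : Fin (N + 1) => ℕ).hasSum_iff] at this
      refine this.congr_fun fun p => ?_
      rw [Function.comp_apply, Fin.prod_univ_succ]
      simp only [Fin.consEquiv, Equiv.coe_fn_mk, Fin.cons_zero, Fin.cons_succ]
      ring
    have hs : ∀ (z : Fin N → ℂ), (∀ k, ‖z k‖ < ρ k.succ) → ∀ m,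
        HasSum (fun β : Fin N → ℕ => d (Fin.cons m β) * ∏ k, z k ^ β k) 0 := by
      intro z hz
      have hsum : ∀ m, Summable fun β : Fin N → ℕ => d (Fin.cons m β) * ∏ k, z k ^ β k := by
        intro m
        have h0 : (0 : ℝ) < ρ 0 / 2 := by have := hρ 0; positivity
        have h2 := (h1 ((ρ 0 / 2 : ℝ) : ℂ) z (by
          rw [Complex.norm_real, Real.norm_of_nonneg h0.le]; linarith [hρ 0]) hz).summable
        have h3 := h2.prod_factor m
        have hne : (((ρ 0 / 2 : ℝ) : ℂ)) ^ m ≠ 0 := pow_ne_zero _ (by exact_mod_cast h0.ne')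
        exact (summable_mul_right_iff hne).mp h3
      have h4 := eq_zero_of_hasSum_pow (hρ 0) fun w hw =>
        (h1 w z hw hz).prod_fiberwise fun m => (hsum m).hasSum.mul_right (w ^ m)
      intro m
      have h5 := congrFun h4 m
      have h6 := (hsum m).hasSum
      rwa [h5] at h6
    ext β
    have h7 := ih (d := fun β' => d (Fin.cons (β 0) β')) (ρ := fun k => ρ k.succ)
      (fun k => hρ _) fun z hz => hs z hz (β 0)
    have h8 := congrFun h7 (Fin.tail β)
    rwa [Fin.cons_self_tail] at h8

theorem exists_bound_torus {N : ℕ} {f : (Fin N → ℂ) → ℂ} (hf : Continuous f) (R : Fin N → ℝ) :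
    ∃ M, ∀ z, (∀ k, ‖z k‖ = R k) → ‖f z‖ ≤ M := by
  obtain ⟨M, hM⟩ := (isCompact_univ_pi fun k : Fin N =>
    isCompact_closedBall (0 : ℂ) (R k)).exists_bound_of_continuousOn hf.continuousOn
  exact ⟨M, fun z hz => hM z fun k _ => by simp [hz k]⟩

/-- An entire function on `ℂ^N` is the sum of its Taylor series, and satisfies the Cauchy estimates
on all tori. -/
theorem exists_taylor {N : ℕ} {f : (Fin N → ℂ) → ℂ} (hf : Differentiable ℂ f) :
    ∃ d : (Fin N → ℕ) → ℂ, (∀ z, HasSum (fun β => d β * ∏ k, z k ^ β k) (f z)) ∧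
      ∀ (R : Fin N → ℝ) (M : ℝ), (∀ k, 0 < R k) → (∀ z, (∀ k, ‖z k‖ = R k) → ‖f z‖ ≤ M) →
        ∀ β, ‖d β‖ * ∏ k, R k ^ β k ≤ M := by
  -- Coefficients computed on two tori represent f on a common polydisc, hence coincide. A single
  -- family thus obeys the estimates for all radii, which the later optimization requires.
  have hind : ∀ R : Fin N → ℝ, (∀ k, 0 < R k) → cauchyCoeff f R = cauchyCoeff f fun _ => 1 := by
    intro R hR
    obtain ⟨M, hM⟩ := exists_bound_torus hf.continuous R
    obtain ⟨M', hM'⟩ := exists_bound_torus hf.continuous fun _ => 1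
    rw [← sub_eq_zero]
    refine eq_zero_of_hasSum_multi (ρ := fun k => min (R k) 1)
      (fun k => lt_min (hR k) one_pos) fun z hz => ?_
    have h1 := hasSum_cauchyCoeff hf hR hM fun k => (hz k).trans_le (min_le_left _ _)
    have h2 := hasSum_cauchyCoeff hf (fun _ => one_pos) hM' fun k =>
      (hz k).trans_le (min_le_right _ _)
    have h3 := h1.sub h2
    rw [sub_self] at h3
    refine h3.congr_fun fun β => ?_
    rw [Pi.sub_apply, sub_mul]
  refine ⟨cauchyCoeff f fun _ => 1, fun z => ?_, fun R M hR hM => ?_⟩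
  · have hR : ∀ k, 0 < ‖z k‖ + 1 := fun k => by positivity
    obtain ⟨M, hM⟩ := exists_bound_torus hf.continuous fun k => ‖z k‖ + 1
    rw [← hind _ hR]
    exact hasSum_cauchyCoeff hf hR hM fun k => lt_add_one _
  · rw [← hind R hR]
    exact norm_cauchyCoeff_le hR hM

/-! ### Series of holomorphic functions on normed spaces -/

/-- The one-variable Cauchy estimate on the complex line x + zv, with |z| = 1/‖v‖. -/
theorem norm_fderiv_le_of_ball {V : Type*} [NormedAddCommGroup V] [NormedSpace ℂ V] {g : V → ℂ}
    (hg : Differentiable ℂ g) {x : V} {B : ℝ} (hB : ∀ y, ‖y - x‖ ≤ 1 → ‖g y‖ ≤ B) :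
    ‖fderiv ℂ g x‖ ≤ B := by
  have hB0 : 0 ≤ B := (norm_nonneg _).trans (hB x (by simp))
  refine ContinuousLinearMap.opNorm_le_bound _ hB0 fun v => ?_
  rcases eq_or_ne v 0 with rfl | hv
  · simp
  have hv' : 0 < ‖v‖ := norm_pos_iff.mpr hv
  have h1 : HasDerivAt (fun z : ℂ => g (x + z • v)) (fderiv ℂ g x v) 0 := by
    have h2 : HasDerivAt (fun z : ℂ => x + z • v) v 0 := by
      simpa using ((hasDerivAt_id (0 : ℂ)).smul_const v).const_add x
    have h3 : HasFDerivAt g (fderiv ℂ g x) (x + (0 : ℂ) • v) := by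
      simpa using (hg x).hasFDerivAt
    exact h3.comp_hasDerivAt 0 h2
  have h4 := Complex.norm_deriv_le_of_forall_mem_sphere_norm_le (c := 0) (R := ‖v‖⁻¹) (C := B)
    (f := fun z : ℂ => g (x + z • v)) (by positivity)
    (Differentiable.diffContOnCl (by fun_prop)) fun z hz => by
      refine hB _ ?_
      rw [add_sub_cancel_left, norm_smul]
      have : ‖z‖ = ‖v‖⁻¹ := by simpa using hz
      rw [this, inv_mul_cancel₀ hv'.ne']
  rw [h1.deriv] at h4
  simpa using h4

/-- The summable bound on the ball of radius ‖x‖ + 2 also bounds the derivatives on the ball of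
radius ‖x‖ + 1, so the series may be differentiated term by term. -/
theorem differentiable_tsum_of_bound {V ι : Type*} [NormedAddCommGroup V] [NormedSpace ℂ V]
    {g : ι → V → ℂ} (hg : ∀ i, Differentiable ℂ (g i))
    (hb : ∀ R : ℝ, 0 ≤ R → ∃ b : ι → ℝ, Summable b ∧ ∀ i x, ‖x‖ ≤ R → ‖g i x‖ ≤ b i) :
    Differentiable ℂ fun x => ∑' i, g i x := by
  intro x
  obtain ⟨b, hb1, hb2⟩ := hb (‖x‖ + 2) (by positivity)
  have hx : x ∈ Metric.ball (0 : V) (‖x‖ + 1) := by simp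
  refine (hasFDerivAt_tsum_of_isPreconnected (𝕜 := ℂ) hb1 Metric.isOpen_ball
    (f' := fun i y => fderiv ℂ (g i) y)
    (Metric.isPreconnected_ball (x := (0 : V)) (r := ‖x‖ + 1)) (fun i y _ => (hg i y).hasFDerivAt)
    (fun i y hy => norm_fderiv_le_of_ball (hg i) fun w hw => hb2 i w ?_) hx
    (Summable.of_norm_bounded hb1 fun i => hb2 i x (by linarith)) hx).differentiableAt
  have h1 : ‖y‖ < ‖x‖ + 1 := by simpa using hy
  have h2 : ‖w‖ ≤ ‖w - y‖ + ‖y‖ := by simpa using norm_add_le (w - y) y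
  linarith

/-! ### Coordinates on the spaces `E*_{p,c}` -/

/-- The Hermite coordinates of `x ∈ E*_c`. -/
def hcoord (x : DistC) (k : ℕ) : ℂ := x (hermiteFun k)

/-- Continuity forces polynomial growth of ⟨x, e_j⟩. Otherwise some indices j_m satisfy |⟨x,
e_{j_m}⟩| > (2j_m+2)^m; the functions e_{j_m}/|⟨x, e_{j_m}⟩| then tend to 0 in S(ℝ), while x has
modulus 1 on each of them. -/
theorem exists_mem_distCp (x : DistC) : ∃ p : ℝ, 0 ≤ p ∧ x ∈ distCpSubmodule p := by
  have key : ∃ m : ℕ, ∀ j : ℕ, ‖x (hermiteFun j)‖ ≤ (2 * (j : ℝ) + 2) ^ m := by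
    by_contra! hcon
    choose j hj using hcon
    have hpos : ∀ m, 0 < ‖x (hermiteFun (j m))‖ := fun m => lt_trans (by positivity) (hj m)
    set F : ℕ → 𝓢(ℝ, ℝ) := fun m => (‖x (hermiteFun (j m))‖)⁻¹ • hermiteFun (j m) with hF
    have hnull : IsNull F := by
      intro p
      have hw : ∀ k, weightedSq p (hermiteFun k) = ENNReal.ofReal ((2 * (k : ℝ) + 2) ^ p) := by
        intro k
        rw [weightedSq, tsum_eq_single k]
        · rw [dotp_hermiteFun_self, one_pow, mul_one]
        · intro i hi
          rw [dotp_hermiteFun_ne hi.symm]; simp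
      have hle : ∀ m, p ≤ m → weightedSq p (F m) ≤ ENNReal.ofReal ((1 / 2) ^ m) := by
        intro m hm
        rw [hF, weightedSq_smul, hw, ← ENNReal.ofReal_mul (sq_nonneg _)]
        apply ENNReal.ofReal_le_ofReal
        have h2 : (2 : ℝ) ≤ 2 * (j m : ℝ) + 2 := by linarith [(Nat.cast_nonneg (j m) : (0:ℝ) ≤ j m)]
        set l : ℝ := 2 * (j m : ℝ) + 2
        have h1 : l ^ m ≤ ‖x (hermiteFun (j m))‖ := (hj m).le
        have h0 : (0 : ℝ) < l := by linarith
        calc (‖x (hermiteFun (j m))‖⁻¹) ^ 2 * l ^ p ≤ ((l ^ m)⁻¹) ^ 2 * l ^ m := by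
              gcongr
              linarith
          _ = (1 / l) ^ m := by 
              have : l ^ m ≠ 0 := by positivity
              rw [one_div, inv_pow l]; field_simp
          _ ≤ _ := by gcongr
      have hlim : Tendsto (fun m : ℕ => ENNReal.ofReal ((1 / 2 : ℝ) ^ m)) atTop (𝓝 0) := by
        rw [← ENNReal.ofReal_zero]
        exact ENNReal.tendsto_ofReal (tendsto_pow_atTop_nhds_zero_of_lt_one (by norm_num)
          (by norm_num))
      refine tendsto_of_tendsto_of_tendsto_of_le_of_le' tendsto_const_nhds hlim
        (Eventually.of_forall fun _ => zero_le) ?_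
      filter_upwards [eventually_ge_atTop p] with m hm using hle m hm
    have h1 := ((x.continuous.norm).tendsto 0).comp hnull.tendsto
    rw [map_zero, norm_zero] at h1
    have h2 : ∀ m, ‖x (F m)‖ = 1 := by
      intro m
      rw [hF]
      simp only [map_smul, norm_smul, norm_inv, norm_norm]
      exact inv_mul_cancel₀ (hpos m).ne'
    have h3 := tendsto_nhds_unique h1 (tendsto_const_nhds.congr fun m => (h2 m).symm)
    exact one_ne_zero h3.symm
  obtain ⟨m, hm⟩ := key
  -- One more power than the growth exponent leaves the square-summable sequence (2j+2)^{-1}.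
  refine ⟨m + 1, by positivity, ?_⟩
  obtain ⟨s, hs, -⟩ := hasSum_inv_sq
  refine memℓp_gen (Summable.of_nonneg_of_le (fun _ => by positivity) (fun j => ?_) hs.summable)
  have hj : (0 : ℝ) < 2 * (j : ℝ) + 2 := by positivity
  rw [ENNReal.toReal_ofNat, Real.rpow_two, norm_mul, Complex.norm_real,
    Real.norm_of_nonneg (by positivity), ← inv_pow]
  gcongr
  calc (2 * (j : ℝ) + 2) ^ (-((m : ℝ) + 1)) * ‖x (hermiteFun j)‖
      ≤ (2 * (j : ℝ) + 2) ^ (-((m : ℝ) + 1)) * (2 * (j : ℝ) + 2) ^ m := by gcongr; exact hm j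
    _ = _ := by
      rw [← Real.rpow_natCast, ← Real.rpow_add hj, ← Real.rpow_neg_one]; congr 1; ring

namespace DistCp

variable {p : ℝ}

theorem summable_norm_sq (x : DistCp p) :
    Summable fun j : ℕ => (2 * (j : ℝ) + 2) ^ (-2 * p) * ‖incl x (hermiteFun j)‖ ^ 2 := by
  have h := (memℓp_gen_iff (by norm_num)).mp x.2
  refine h.congr fun j => ?_
  rw [ENNReal.toReal_ofNat, Real.rpow_two]
  show ‖(((2 * (j : ℝ) + 2) ^ (-p) : ℝ) : ℂ) * incl x (hermiteFun j)‖ ^ 2 = _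
  rw [norm_mul, mul_pow, Complex.norm_real, Real.norm_of_nonneg (by positivity),
    ← Real.rpow_natCast, ← Real.rpow_mul (by positivity)]
  congr 2; push_cast; ring

theorem norm_sq_hcoord (x : DistCp p) :
    ‖x‖ ^ 2 = ∑' j : ℕ, (2 * (j : ℝ) + 2) ^ (-2 * p) * ‖hcoord x.incl j‖ ^ 2 := norm_sq x

theorem norm_hcoord_le (x : DistCp p) (k : ℕ) :
    ‖hcoord x.incl k‖ ≤ (2 * (k : ℝ) + 2) ^ p * ‖x‖ := by
  have hk : (0 : ℝ) < 2 * (k : ℝ) + 2 := by positivity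
  have h := (summable_norm_sq x).le_tsum k fun _ _ => by positivity
  rw [← norm_sq] at h
  rw [← abs_of_nonneg (norm_nonneg (hcoord x.incl k))]
  apply abs_le_of_sq_le_sq _ (by positivity)
  rw [mul_pow]
  calc ‖hcoord x.incl k‖ ^ 2
      = ((2 * (k : ℝ) + 2) ^ p) ^ 2 * ((2 * (k : ℝ) + 2) ^ (-2 * p) * ‖hcoord x.incl k‖ ^ 2) := by
        rw [← Real.rpow_two (_ ^ p), ← Real.rpow_mul hk.le, ← mul_assoc, ← Real.rpow_add hk,
          show p * 2 + -2 * p = 0 by ring, Real.rpow_zero, one_mul]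
    _ ≤ _ := by gcongr; exact h

/-- The Hermite coordinates as continuous linear functionals. -/
def coordCLM (p : ℝ) (k : ℕ) : DistCp p →L[ℂ] ℂ :=
  LinearMap.mkContinuous
    { toFun := fun x => hcoord x.incl k
      map_add' := fun _ _ => rfl
      map_smul' := fun _ _ => rfl } ((2 * (k : ℝ) + 2) ^ p) fun x => norm_hcoord_le x k

theorem coordCLM_apply (x : DistCp p) (k : ℕ) : coordCLM p k x = hcoord x.incl k := rfl

theorem norm_mprod_mono_le (x : DistCp p) (α : ℕ →₀ ℕ) :
    ‖mprod mono (hcoord x.incl) α‖ ≤ wt α ^ p * ‖x‖ ^ α.degree := by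
  rw [mprod, Finsupp.prod, norm_prod, Finsupp.degree_apply, ← Finset.prod_pow_eq_pow_sum, wt,
    Finsupp.prod, ← Real.finsetProd_rpow _ _ fun _ _ => by positivity, ← Finset.prod_mul_distrib]
  refine Finset.prod_le_prod (fun _ _ => norm_nonneg _) fun k _ => ?_
  have e : ((2 * (k : ℝ) + 2) ^ α k) ^ p = ((2 * (k : ℝ) + 2) ^ p) ^ α k := by
    rw [← Real.rpow_natCast, ← Real.rpow_mul (by positivity), mul_comm (α k : ℝ),
      Real.rpow_mul (by positivity), Real.rpow_natCast]
  rw [mono, norm_pow, e, ← mul_pow]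
  gcongr
  exact norm_hcoord_le x k

theorem mono_bound {u : ℝ → ℝ} (hu : IsWeight u) (x : DistCp p) (α : ℕ →₀ ℕ) :
    rootLegendre u α.degree * ‖mprod mono (hcoord x.incl) α‖
      ≤ Real.sqrt (u (‖x‖ ^ 2)) * wt α ^ p := by
  have h1 := (hu.rootLegendre_pos α.degree).le
  have h2 := wt_pos α
  calc _ ≤ rootLegendre u α.degree * (wt α ^ p * ‖x‖ ^ α.degree) := by
        gcongr; exact norm_mprod_mono_le x α
    _ = (rootLegendre u α.degree * ‖x‖ ^ α.degree) * wt α ^ p := by ring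
    _ ≤ _ := by gcongr; exact hu.rootLegendre_mul_pow_le _ (norm_nonneg x)

/-- Of the exponent p + 2, p cancels the weight of the monomial on E*_{p,c} and 2 remains for
summation; G(|α|) absorbs R^{|α|}. The bound is uniform on the ball of radius R. -/
theorem norm_mul_mono_le {u : ℝ → ℝ} (hu : IsWeight u) {M : ℝ} (hM : 0 ≤ M)
    {d : (ℕ →₀ ℕ) → ℂ} (hd : Decays u (p + 2) M d) {R : ℝ} (x : DistCp p) (hx : ‖x‖ ≤ R)
    (α : ℕ →₀ ℕ) :
    ‖d α * mprod mono (hcoord x.incl) α‖ ≤ M * Real.sqrt (u (R ^ 2)) * (wt α ^ 2)⁻¹ := by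
  have h1 := (hu.rootLegendre_pos α.degree).le
  have h2 := wt_pos α
  rw [norm_mul]
  calc _ ≤ (M * rootLegendre u α.degree * wt α ^ (-(p + 2))) * (wt α ^ p * R ^ α.degree) := by
        gcongr
        · exact hd α
        · exact (norm_mprod_mono_le x α).trans (by gcongr)
    _ = M * (rootLegendre u α.degree * R ^ α.degree) * (wt α ^ (-(p + 2)) * wt α ^ p) := by ring
    _ ≤ M * Real.sqrt (u (R ^ 2)) * (wt α ^ (-(p + 2)) * wt α ^ p) := by
        gcongr; exact hu.rootLegendre_mul_pow_le _ ((norm_nonneg x).trans hx)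
    _ = _ := by
        rw [← Real.rpow_add h2, show -(p + 2) + p = -2 by ring, wt_rpow_neg_two]

end DistCp

/-! ### Power series on `E*_c` -/

/-- The sum of the power series with the given coefficients. -/
def powerSum (d : (ℕ →₀ ℕ) → ℂ) (x : DistC) : ℂ := ∑' α, d α * mprod mono (hcoord x) α

section powerSum

variable {u : ℝ → ℝ} {p M : ℝ} {d : (ℕ →₀ ℕ) → ℂ}

theorem norm_powerSum_le (hu : IsWeight u) (hM : 0 ≤ M) (hd : Decays u (p + 2) M d)
    (x : DistCp p) : ‖powerSum d x.incl‖ ≤ M * wtSum * Real.sqrt (u (‖x‖ ^ 2)) := by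
  refine (tsum_of_norm_bounded (summable_wt.hasSum.mul_left _)
    fun α => DistCp.norm_mul_mono_le hu hM hd x le_rfl α).trans (le_of_eq ?_)
  rw [wtSum]; ring

theorem memA_powerSum (hu : IsWeight u) (hM : 0 ≤ M) (hd : Decays u (p + 2) M d) :
    MemA u p (powerSum d) := by
  constructor
  · refine differentiable_tsum_of_bound (g := fun α (x : DistCp p) =>
      d α * mprod mono (hcoord x.incl) α) (fun α => ?_) fun R hR =>
      ⟨fun α => M * Real.sqrt (u (R ^ 2)) * (wt α ^ 2)⁻¹, summable_wt.mul_left _,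
        fun α x hx => DistCp.norm_mul_mono_le hu hM hd x hx α⟩
    refine Differentiable.const_mul ?_ _
    show Differentiable ℂ fun x : DistCp p => ∏ k ∈ α.support, (DistCp.coordCLM p k x) ^ α k
    exact fun x => (HasFDerivAt.finsetProd fun k _ =>
      ((DistCp.coordCLM p k).differentiable.fun_pow (α k) x).hasFDerivAt).differentiableAt
  · refine ⟨(M * wtSum) ^ 2, by positivity, fun x => ?_⟩
    have h := norm_powerSum_le hu hM hd x
    have h2 := (hu.pos _ (sq_nonneg ‖x‖)).le
    calc _ ≤ (M * wtSum * Real.sqrt (u (‖x‖ ^ 2))) ^ 2 := by gcongr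
      _ = _ := by rw [mul_pow, Real.sq_sqrt h2]

theorem powerSum_mem (hu : IsWeight u) (hd : ∀ q : ℝ, 0 ≤ q → ∃ M, 0 ≤ M ∧ Decays u q M d) :
    powerSum d ∈ analyticSpace u := by
  intro p hp
  obtain ⟨M, hM, h⟩ := hd (p + 2) (by linarith)
  exact memA_powerSum hu hM h

end powerSum

/-! ### Finite-dimensional sections -/

theorem memℓp_of_support {f : ℕ → ℂ} (s : Finset ℕ) (h : ∀ j, j ∉ s → f j = 0) : Memℓp f 2 :=
  memℓp_gen (summable_of_ne_finset_zero (s := s) fun j hj => by simp [h j hj])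

/-- The Hermite function `e_k`, as an element of `E*_c`. -/
def basisDist (k : ℕ) : DistC :=
  Complex.ofRealCLM.comp ((innerSL ℝ (hermiteL2 k)).comp (SchwartzMap.toLpCLM ℝ ℝ 2 volume))

theorem hcoord_basisDist (k j : ℕ) : hcoord (basisDist k) j = if k = j then 1 else 0 := by
  have h : hcoord (basisDist k) j = ((inner ℝ (hermiteL2 k) (hermiteL2 j) : ℝ) : ℂ) := rfl
  rw [h, orthonormal_iff_ite.mp orthonormal_hermiteL2]
  split_ifs <;> simp

theorem basisDist_mem (p : ℝ) (k : ℕ) : basisDist k ∈ distCpSubmodule p :=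
  memℓp_of_support {k} fun j hj => by
    have h : hcoord (basisDist k) j = 0 := by
      rw [hcoord_basisDist, if_neg fun h => hj (by simp [h])]
    rw [hcoord] at h
    rw [h, mul_zero]

/-- The Hermite function `e_k`, as an element of `E*_{p,c}`. -/
def basisCp (p : ℝ) (k : ℕ) : DistCp p := ⟨basisDist k, basisDist_mem p k⟩

/-- The embedding of `ℂ^N` into `E*_{p,c}` as the span of the first Hermite functions. -/
def emb (p : ℝ) (N : ℕ) (z : Fin N → ℂ) : DistCp p :=
  ∑ k, z k • basisCp p k

theorem differentiable_emb (p : ℝ) (N : ℕ) : Differentiable ℂ (emb p N) := by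
  unfold emb
  fun_prop

theorem incl_emb (p : ℝ) (N : ℕ) (z : Fin N → ℂ) :
    (emb p N z).incl = ∑ k : Fin N, z k • basisDist k := by
  rw [emb, map_sum]
  refine Finset.sum_congr rfl fun k _ => ?_
  rw [map_smul]; rfl

theorem hcoord_emb (p : ℝ) (N : ℕ) (z : Fin N → ℂ) (j : ℕ) :
    hcoord (emb p N z).incl j = if h : j < N then z ⟨j, h⟩ else 0 := by
  rw [← DistCp.coordCLM_apply, emb, map_sum]
  have h : ∀ k : Fin N, DistCp.coordCLM p j (z k • basisCp p k)
      = if (k : ℕ) = j then z k else 0 := by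
    intro k
    rw [map_smul, DistCp.coordCLM_apply]
    show z k • hcoord (basisDist k) j = _
    rw [hcoord_basisDist]; split_ifs <;> simp
  simp_rw [h]
  split_ifs with hj
  · rw [Finset.sum_eq_single ⟨j, hj⟩]
    · simp
    · intro b _ hb
      rw [if_neg]
      intro h; exact hb (Fin.ext h)
    · simp
  · refine Finset.sum_eq_zero fun k _ => if_neg fun h => hj ?_
    rw [← h]; exact k.2

theorem norm_emb_sq (p : ℝ) (N : ℕ) (z : Fin N → ℂ) :
    ‖emb p N z‖ ^ 2 = ∑ k : Fin N, (2 * (k : ℝ) + 2) ^ (-2 * p) * ‖z k‖ ^ 2 := by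
  rw [DistCp.norm_sq_hcoord, tsum_eq_sum (s := Finset.range N), ← Fin.sum_univ_eq_sum_range
    (fun j : ℕ => (2 * (j : ℝ) + 2) ^ (-2 * p) * ‖hcoord (emb p N z).incl j‖ ^ 2) N]
  · refine Finset.sum_congr rfl fun k _ => ?_
    rw [hcoord_emb, dif_pos k.2]
  · intro j hj
    rw [hcoord_emb, dif_neg (by simpa using hj)]; simp

/-- The truncation of `x` to its first coordinates. -/
def trunc {p : ℝ} (x : DistCp p) (N : ℕ) : DistCp p := emb p N fun k => hcoord x.incl k

/-- The squared distance is the tail of the series defining |x|_{-p}². -/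
theorem tendsto_trunc {p : ℝ} (x : DistCp p) : Tendsto (trunc x) atTop (𝓝 x) := by
  rw [tendsto_iff_norm_sub_tendsto_zero]
  have h1 : ∀ N, ‖trunc x N - x‖ ^ 2 = ∑' j : ℕ,
      (2 * ((j + N : ℕ) : ℝ) + 2) ^ (-2 * p) * ‖hcoord x.incl (j + N)‖ ^ 2 := by
    intro N
    have hc : ∀ j, hcoord (trunc x N - x).incl j = if j < N then 0 else - hcoord x.incl j := by
      intro j
      have : hcoord (trunc x N - x).incl j = hcoord (trunc x N).incl j - hcoord x.incl j := by
        rw [← DistCp.coordCLM_apply, map_sub]; rfl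
      rw [this, trunc, hcoord_emb]
      split_ifs <;> simp
    have hs : Summable fun j : ℕ =>
        (2 * (j : ℝ) + 2) ^ (-2 * p) * ‖hcoord (trunc x N - x).incl j‖ ^ 2 :=
      DistCp.summable_norm_sq (trunc x N - x)
    rw [DistCp.norm_sq_hcoord, ← hs.sum_add_tsum_nat_add N, Finset.sum_eq_zero, zero_add]
    · refine tsum_congr fun j => ?_
      rw [hc, if_neg (by omega), norm_neg]
    · intro j hj
      rw [hc, if_pos (Finset.mem_range.mp hj)]; simp
  have h2 := tendsto_sum_nat_add fun j : ℕ =>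
    (2 * (j : ℝ) + 2) ^ (-2 * p) * ‖hcoord x.incl j‖ ^ 2
  have h3 : Tendsto (fun N => ‖trunc x N - x‖ ^ 2) atTop (𝓝 0) := h2.congr fun N => (h1 N).symm
  have h4 := (Real.continuous_sqrt.tendsto 0).comp h3
  rw [Real.sqrt_zero] at h4
  exact h4.congr fun N => Real.sqrt_sq (norm_nonneg _)

/-- Extension by zero of a multi-index. -/
def extendIdx {N : ℕ} (β : Fin N → ℕ) : ℕ →₀ ℕ :=
  Finsupp.onFinset (Finset.range N) (fun j => if h : j < N then β ⟨j, h⟩ else 0) fun j hj => by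
    by_contra h
    exact hj (dif_neg (by simpa using h))

theorem extendIdx_apply {N : ℕ} (β : Fin N → ℕ) (k : Fin N) : extendIdx β k = β k := by
  simp [extendIdx]

theorem extendIdx_injective {N : ℕ} : Function.Injective (extendIdx (N := N)) := by
  intro β γ h
  ext k
  rw [← extendIdx_apply β, h, extendIdx_apply]

theorem support_extendIdx {N : ℕ} (β : Fin N → ℕ) : (extendIdx β).support ⊆ Finset.range N :=
  Finsupp.support_onFinset_subset

theorem prod_extendIdx {N : ℕ} {M : Type*} [CommMonoid M] (β : Fin N → ℕ) (g : ℕ → ℕ → M)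
    (hg : ∀ k, g k 0 = 1) : (extendIdx β).prod g = ∏ k : Fin N, g k (β k) := by
  rw [Finsupp.prod_of_support_subset _ (support_extendIdx β) _ fun k _ => hg k,
    ← Fin.prod_univ_eq_prod_range (fun k => g k (extendIdx β k))]
  simp_rw [extendIdx_apply]

theorem degree_extendIdx {N : ℕ} (β : Fin N → ℕ) : (extendIdx β).degree = ∑ k, β k := by
  rw [Finsupp.degree_apply, Finset.sum_subset (support_extendIdx β) fun k _ hk =>
    Finsupp.notMem_support_iff.mp hk, ← Fin.sum_univ_eq_sum_range (fun k => extendIdx β k)]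
  simp_rw [extendIdx_apply]

theorem mem_range_extendIdx {N : ℕ} {α : ℕ →₀ ℕ} (h : α.support ⊆ Finset.range N) :
    α ∈ Set.range (extendIdx (N := N)) := by
  refine ⟨fun k => α k, Finsupp.ext fun j => ?_⟩
  by_cases hj : j < N
  · exact extendIdx_apply _ ⟨j, hj⟩
  · have h1 : j ∉ α.support := fun h2 => hj (by simpa using h h2)
    have h2 : j ∉ (extendIdx fun k : Fin N => α k).support :=
      fun h2 => hj (by simpa using support_extendIdx _ h2)
    rw [Finsupp.notMem_support_iff.mp h1, Finsupp.notMem_support_iff.mp h2]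

/-! ### Taylor expansion of the functions in `A_u` -/

/-- Squaring and taking the infimum over t: this is the optimization over radii that turns Cauchy's
estimates into G(n). -/
theorem IsWeight.le_mul_rootLegendre {u : ℝ → ℝ} (hu : IsWeight u) {a M : ℝ} (ha : 0 ≤ a)
    (hM : 0 ≤ M) (n : ℕ)
    (h : ∀ t : ℝ, 0 < t → a * Real.sqrt t ^ n ≤ M * Real.sqrt (u t)) :
    a ≤ M * rootLegendre u n := by
  rcases hM.eq_or_lt with rfl | hM'
  · simpa using h 1 one_pos
  have key : (a / M) ^ 2 ≤ legendre u n := by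
    refine IsWeight.le_legendre n fun t ht => ?_
    have h1 := pow_le_pow_left₀ (by positivity) (h t ht) 2
    rw [mul_pow, mul_pow, Real.sq_sqrt (hu.pos t ht.le).le, ← pow_mul, mul_comm n, pow_mul,
      Real.sq_sqrt ht.le] at h1
    rw [div_pow, div_le_div_iff₀ (by positivity) (by positivity)]
    linarith
  have h2 : a / M ≤ rootLegendre u n := Real.le_sqrt_of_sq_le key
  rwa [div_le_iff₀ hM', mul_comm] at h2

section taylor

variable {u : ℝ → ℝ} {Φ : DistC → ℂ}

theorem MemA.exists_norm_le {p : ℝ} (h : MemA u p Φ) :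
    ∃ M, 0 ≤ M ∧ ∀ x : DistCp p, ‖Φ x.incl‖ ≤ M * Real.sqrt (u (‖x‖ ^ 2)) := by
  obtain ⟨C, hC, hg⟩ := h.growth
  refine ⟨Real.sqrt C, Real.sqrt_nonneg _, fun x => ?_⟩
  rw [← Real.sqrt_mul hC]
  exact Real.le_sqrt_of_sq_le (hg x)

/-- The restriction of a function on `E*_c` to the span of the first Hermite functions. -/
def sectionMap (Φ : DistC → ℂ) (N : ℕ) (z : Fin N → ℂ) : ℂ := Φ (∑ k : Fin N, z k • basisDist k)

theorem sectionMap_eq (Φ : DistC → ℂ) (p : ℝ) (N : ℕ) (z : Fin N → ℂ) :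
    sectionMap Φ N z = Φ (emb p N z).incl := by rw [sectionMap, incl_emb]

theorem differentiable_section {p : ℝ} (h : MemA u p Φ) (N : ℕ) :
    Differentiable ℂ (sectionMap Φ N) := by
  have e : sectionMap Φ N = fun z => Φ (emb p N z).incl := funext fun z => sectionMap_eq Φ p N z
  rw [e]
  exact h.analytic.comp (differentiable_emb p N)

/-- Taylor coefficients on `ℂ^N`, extended by zero to all multi-indices. -/
def extendCoeff {N : ℕ} (d : (Fin N → ℕ) → ℂ) (α : ℕ →₀ ℕ) : ℂ :=
  if α.support ⊆ Finset.range N then d fun k => α k else 0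

theorem extendCoeff_extendIdx {N : ℕ} (d : (Fin N → ℕ) → ℂ) (β : Fin N → ℕ) :
    extendCoeff d (extendIdx β) = d β := by
  rw [extendCoeff, if_pos (support_extendIdx β)]
  congr 1
  ext k
  exact extendIdx_apply β k

theorem extendCoeff_of_notMem {N : ℕ} (d : (Fin N → ℕ) → ℂ) {α : ℕ →₀ ℕ}
    (h : α ∉ Set.range (extendIdx (N := N))) : extendCoeff d α = 0 :=
  if_neg fun h2 => h (mem_range_extendIdx h2)

theorem hasSum_extendCoeff {p : ℝ} {N : ℕ} {d : (Fin N → ℕ) → ℂ}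
    (hd : ∀ z, HasSum (fun β => d β * ∏ k, z k ^ β k) (sectionMap Φ N z)) (x : DistCp p) :
    HasSum (fun α => extendCoeff d α * mprod mono (hcoord x.incl) α) (Φ (trunc x N).incl) := by
  rw [← (extendIdx_injective (N := N)).hasSum_iff]
  · rw [trunc, ← sectionMap_eq Φ]
    refine (hd _).congr_fun fun β => ?_
    rw [Function.comp_apply, extendCoeff_extendIdx, mprod,
      prod_extendIdx _ _ fun _ => by simp [mono]]
    rfl
  · intro α hα
    rw [extendCoeff_of_notMem d hα, zero_mul]

/-- With R_k = √(t/σ) (2k+2)^{p-1} and σ the partial sum of Σ (2k+2)^{-2}, every point of the torus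
has squared norm exactly t in E*_{p,c}. Cauchy's estimate there, optimized over t, costs one power
of the weight; as σ ≤ 1, the constant does not depend on the dimension. -/
theorem decays_extendCoeff (hu : IsWeight u) {p M : ℝ} (hM : 0 ≤ M)
    (hΦ : ∀ x : DistCp p, ‖Φ x.incl‖ ≤ M * Real.sqrt (u (‖x‖ ^ 2))) {N : ℕ}
    {d : (Fin (N + 1) → ℕ) → ℂ} (hd : ∀ (R : Fin (N + 1) → ℝ) (M : ℝ), (∀ k, 0 < R k) →
      (∀ z, (∀ k, ‖z k‖ = R k) → ‖sectionMap Φ (N + 1) z‖ ≤ M) → ∀ β, ‖d β‖ * ∏ k, R k ^ β k ≤ M) :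
    Decays u (p - 1) M (extendCoeff d) := by
  intro α
  have hG := (hu.rootLegendre_pos α.degree).le
  have hw := wt_pos α
  by_cases hα : α ∈ Set.range (extendIdx (N := N + 1))
  swap
  · rw [extendCoeff_of_notMem d hα, norm_zero]; positivity
  obtain ⟨β, rfl⟩ := hα
  rw [extendCoeff_extendIdx, Real.rpow_neg hw.le, ← div_eq_mul_inv, le_div_iff₀ (by positivity)]
  refine hu.le_mul_rootLegendre (by positivity) hM _ fun t ht => ?_
  set σ : ℝ := ∑ k : Fin (N + 1), ((2 * (k : ℝ) + 2) ^ 2)⁻¹ with hσ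
  -- Positivity of σ is the reason for working in dimension N + 1.
  have hσ0 : 0 < σ := Finset.sum_pos (fun k _ => by positivity) ⟨0, Finset.mem_univ _⟩
  have hσ1 : σ ≤ 1 := by
    obtain ⟨s, hs, -, hs1⟩ := hasSum_inv_sq
    refine le_trans ?_ hs1.le
    rw [hσ, Fin.sum_univ_eq_sum_range (fun k : ℕ => ((2 * (k : ℝ) + 2) ^ 2)⁻¹), ← hs.tsum_eq]
    exact hs.summable.sum_le_tsum _ fun _ _ => by positivity
  have h1 := hd (fun k => Real.sqrt (t / σ) * (2 * (k : ℝ) + 2) ^ (p - 1)) (M * Real.sqrt (u t))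
    (fun k => by positivity) (fun z hz => by
      rw [sectionMap_eq Φ p]
      refine (hΦ _).trans (le_of_eq ?_)
      congr 3
      rw [norm_emb_sq]
      have h2 : ∀ k : Fin (N + 1), (2 * (k : ℝ) + 2) ^ (-2 * p) * ‖z k‖ ^ 2
          = t / σ * ((2 * (k : ℝ) + 2) ^ 2)⁻¹ := by
        intro k
        have hk : (0 : ℝ) < 2 * (k : ℝ) + 2 := by positivity
        rw [hz, mul_pow, Real.sq_sqrt (by positivity), ← Real.rpow_two (_ ^ _),
          ← Real.rpow_mul hk.le, mul_left_comm, ← Real.rpow_add hk,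
          show -2 * p + (p - 1) * 2 = -2 by ring, Real.rpow_neg hk.le, Real.rpow_two]
      simp_rw [h2]
      rw [← Finset.mul_sum, ← hσ, div_mul_cancel₀ _ hσ0.ne']) β
  have h3 : ∏ k : Fin (N + 1), (Real.sqrt (t / σ) * (2 * (k : ℝ) + 2) ^ (p - 1)) ^ β k
      = Real.sqrt (t / σ) ^ (extendIdx β).degree * wt (extendIdx β) ^ (p - 1) := by
    rw [degree_extendIdx, wt, prod_extendIdx _ _ fun _ => pow_zero _,
      ← Real.finsetProd_rpow _ _ fun _ _ => by positivity, ← Finset.prod_pow_eq_pow_sum,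
      ← Finset.prod_mul_distrib]
    refine Finset.prod_congr rfl fun k _ => ?_
    rw [mul_pow, ← Real.rpow_natCast (2 * (k : ℝ) + 2), ← Real.rpow_mul (by positivity),
      mul_comm (β k : ℝ), Real.rpow_mul (by positivity), Real.rpow_natCast]
  rw [h3] at h1
  refine le_trans ?_ h1
  calc _ = ‖d β‖ * (Real.sqrt t ^ (extendIdx β).degree * wt (extendIdx β) ^ (p - 1)) := by ring
    _ ≤ _ := by
      gcongr
      rw [le_div_iff₀ hσ0]
      exact mul_le_of_le_one_right ht.le hσ1

/-- Every function in `A_u` is the sum of its Taylor series, with the Cauchy estimates for the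
coefficients. -/
theorem exists_coeff (hu : IsWeight u) (hΦ : Φ ∈ analyticSpace u) :
    ∃ d : (ℕ →₀ ℕ) → ℂ, (∀ x, HasSum (fun α => d α * mprod mono (hcoord x) α) (Φ x)) ∧
      ∀ p M : ℝ, 0 ≤ M → (∀ x : DistCp p, ‖Φ x.incl‖ ≤ M * Real.sqrt (u (‖x‖ ^ 2))) →
        Decays u (p - 1) M d := by
  choose D hDsum hDbd using fun N =>
    exists_taylor (differentiable_section (hΦ 0 le_rfl) (N + 1))
  have hdec : ∀ p M : ℝ, 0 ≤ M → (∀ x : DistCp p, ‖Φ x.incl‖ ≤ M * Real.sqrt (u (‖x‖ ^ 2))) →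
      ∀ N, Decays u (p - 1) M (extendCoeff (D N)) :=
    fun p M hM h N => decays_extendCoeff hu hM h (hDbd N)
  -- The coefficients for a fixed α are bounded in N, so they converge along an ultrafilter; no
  -- compatibility between different sections has to be checked.
  let U : Ultrafilter ℕ := hyperfilter ℕ
  have hU : (U : Filter ℕ) ≤ atTop := Nat.hyperfilter_le_atTop
  have hlim : ∀ α, ∃ c : ℂ, Tendsto (fun N => extendCoeff (D N) α) U (𝓝 c) := by
    intro α
    obtain ⟨M, hM, h⟩ := (hΦ 1 zero_le_one).exists_norm_le
    obtain ⟨c, -, hc⟩ := (isCompact_closedBall (0 : ℂ)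
      (M * rootLegendre u α.degree * wt α ^ (-((1 : ℝ) - 1)))).ultrafilter_le_nhds
        (U.map fun N => extendCoeff (D N) α) (by
          rw [Ultrafilter.coe_map, le_principal_iff]
          refine mem_map.mpr (Filter.Eventually.of_forall fun N => ?_)
          rw [mem_closedBall_zero_iff]
          exact hdec 1 M hM h N α)
    exact ⟨c, hc⟩
  choose d hd using hlim
  refine ⟨d, fun x => ?_, fun p M hM h α =>
    le_of_tendsto (hd α).norm (Eventually.of_forall fun N => hdec p M hM h N α)⟩
  obtain ⟨p, hp, hx⟩ := exists_mem_distCp x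
  obtain ⟨x, rfl⟩ : ∃ y : DistCp p, y.incl = x := ⟨⟨x, hx⟩, rfl⟩
  obtain ⟨M, hM, h⟩ := (hΦ (p + 3) (by linarith)).exists_norm_le
  have hdec' : ∀ N, Decays u (p + 2) M (extendCoeff (D N)) := fun N => by
    have := hdec (p + 3) M hM h N
    rwa [show p + 3 - 1 = p + 2 by ring] at this
  have hb : ∀ N α, ‖extendCoeff (D N) α * mprod mono (hcoord x.incl) α‖
      ≤ M * Real.sqrt (u (‖x‖ ^ 2)) * (wt α ^ 2)⁻¹ := fun N α =>
    DistCp.norm_mul_mono_le hu hM (hdec' N) x le_rfl α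
  have hterm : ∀ α, Tendsto (fun N => extendCoeff (D N) α * mprod mono (hcoord x.incl) α) U
      (𝓝 (d α * mprod mono (hcoord x.incl) α)) := fun α => (hd α).mul_const _
  -- The bounds are uniform in N, so the sum of the limit series is the limit of Φ at the
  -- truncations of x, which is Φ(x) by continuity on E*_{p,c}.
  have h1 := tendsto_tsum_of_dominated_convergence (summable_wt.mul_left _) hterm
    (Eventually.of_forall fun N => hb N)
  have h2 : Tendsto (fun N => Φ (trunc x (N + 1)).incl) U (𝓝 (Φ x.incl)) :=
    (((hΦ p hp).analytic.continuous.tendsto x).comp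
      ((tendsto_trunc x).comp (tendsto_add_atTop_nat 1))).mono_left hU
  have h3 := tendsto_nhds_unique h1 (h2.congr fun N =>
    (hasSum_extendCoeff (hDsum N) x).tsum_eq.symm)
  rw [← h3]
  refine (Summable.of_norm_bounded (summable_wt.mul_left (M * Real.sqrt (u (‖x‖ ^ 2))))
    fun α => ?_).hasSum
  exact le_of_tendsto (hterm α).norm (Eventually.of_forall fun N => hb N α)

end taylor

/-! ### Orthogonality of the Hermite polynomials -/

theorem integrable_eval_gaussian (P : Polynomial ℝ) :
    Integrable (fun t => P.eval t) (gaussianReal 0 1) := by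
  simp_rw [Polynomial.eval_eq_sum, Polynomial.sum]
  refine integrable_finsetSum _ fun i _ => Integrable.const_mul ?_ _
  have h := (memLp_id_gaussianReal (μ := 0) (v := 1) i).integrable_norm_pow'
  refine (integrable_norm_iff (by fun_prop)).mp ?_
  simpa using h

theorem integrable_mul_eval_gaussian (P : Polynomial ℝ) :
    Integrable (fun t => t * P.eval t) (gaussianReal 0 1) :=
  (integrable_eval_gaussian (Polynomial.X * P)).congr (ae_of_all _ fun t => by simp)

theorem integrable_eval_mul_exp (P : Polynomial ℝ) :
    Integrable fun t : ℝ => P.eval t * Real.exp (-(t ^ 2 / 2)) := by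
  have h := integrable_eval_gaussian P
  rw [gaussianReal_of_var_ne_zero _ one_ne_zero,
    integrable_withDensity_iff (by fun_prop) (ae_of_all _ fun _ => by simp [gaussianPDF])] at h
  refine (h.mul_const (Real.sqrt (2 * Real.pi))).congr (ae_of_all _ fun t => ?_)
  have : Real.sqrt (2 * Real.pi) ≠ 0 := by positivity
  simp only [gaussianPDF, gaussianPDFReal, NNReal.coe_one, mul_one, sub_zero]
  rw [ENNReal.toReal_ofReal (by positivity), neg_div]
  field_simp

/-- Gaussian integration by parts: the derivative of P(t) exp(-t²/2) has integral zero. -/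
theorem integral_X_mul_gaussian (P : Polynomial ℝ) :
    ∫ t, t * P.eval t ∂gaussianReal 0 1 = ∫ t, P.derivative.eval t ∂gaussianReal 0 1 := by
  have hd : ∀ t : ℝ, HasDerivAt (fun t => P.eval t * Real.exp (-(t ^ 2 / 2)))
      ((P.derivative - Polynomial.X * P).eval t * Real.exp (-(t ^ 2 / 2))) t := by
    intro t
    have h1 : HasDerivAt (fun t : ℝ => -(t ^ 2 / 2)) (-t) t :=
      ((hasDerivAt_pow 2 t).div_const 2).neg.congr_deriv (by simp)
    refine ((P.hasDerivAt t).mul h1.exp).congr_deriv ?_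
    simp only [Polynomial.eval_sub, Polynomial.eval_mul, Polynomial.eval_X]
    ring
  have h0 := integral_eq_zero_of_hasDerivAt_of_integrable hd (integrable_eval_mul_exp _)
    (integrable_eval_mul_exp _)
  rw [eq_comm, ← sub_eq_zero, ← integral_sub (integrable_eval_gaussian _)
    (integrable_mul_eval_gaussian P),
    integral_gaussianReal_eq_integral_smul one_ne_zero]
  calc _ = ∫ t, (Real.sqrt (2 * Real.pi))⁻¹ *
        ((P.derivative - Polynomial.X * P).eval t * Real.exp (-(t ^ 2 / 2))) := by
        congr 1; ext t
        simp only [gaussianPDFReal, NNReal.coe_one, mul_one, sub_zero, smul_eq_mul, neg_div,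
          Polynomial.eval_sub, Polynomial.eval_mul, Polynomial.eval_X]
        ring
    _ = 0 := by rw [integral_const_mul, h0, mul_zero]

/-- The Hermite polynomials with real coefficients. -/
def hermiteR (n : ℕ) : Polynomial ℝ := (Polynomial.hermite n).map (Int.castRingHom ℝ)

theorem derivative_hermiteR_succ (n : ℕ) :
    (hermiteR (n + 1)).derivative = ((n : ℝ) + 1) • hermiteR n := by
  rw [hermiteR, Polynomial.derivative_map, derivative_hermite_succ, hermiteR]
  ext k
  rw [Polynomial.coeff_map, Polynomial.coeff_smul, Polynomial.coeff_smul, Polynomial.coeff_map]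
  simp

theorem hermiteR_succ (n : ℕ) :
    hermiteR (n + 1) = Polynomial.X * hermiteR n - (hermiteR n).derivative := by
  simp [hermiteR, Polynomial.hermite_succ, Polynomial.derivative_map]

/-- The operator t - d/dt, which raises Hermite polynomials, is the adjoint of d/dt for the Gaussian
measure. Iteration gives orthogonality and the norms √n!. -/
theorem integral_hermiteR_succ_mul (n : ℕ) (Q : Polynomial ℝ) :
    ∫ t, (hermiteR (n + 1) * Q).eval t ∂gaussianReal 0 1
      = ∫ t, (hermiteR n * Q.derivative).eval t ∂gaussianReal 0 1 := by
  have h := integral_X_mul_gaussian (hermiteR n * Q)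
  rw [← sub_eq_zero, ← integral_sub
    (integrable_mul_eval_gaussian _)
    (integrable_eval_gaussian _)] at h
  rw [← sub_eq_zero, ← integral_sub (integrable_eval_gaussian _) (integrable_eval_gaussian _)]
  refine Eq.trans ?_ h
  refine integral_congr_ae (ae_of_all _ fun t => ?_)
  simp only [hermiteR_succ, Polynomial.derivative_mul, Polynomial.eval_mul, Polynomial.eval_sub,
    Polynomial.eval_add, Polynomial.eval_X]
  ring

theorem integral_hermiteR_mul (n m : ℕ) :
    ∫ t, (hermiteR n * hermiteR m).eval t ∂gaussianReal 0 1
      = if n = m then (n.factorial : ℝ) else 0 := by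
  induction n generalizing m with
  | zero =>
    cases m with
    | zero => simp [hermiteR, Polynomial.hermite_zero]
    | succ m =>
      rw [mul_comm, integral_hermiteR_succ_mul]
      simp [hermiteR, Polynomial.hermite_zero]
  | succ n ih =>
    rw [integral_hermiteR_succ_mul]
    cases m with
    | zero => simp [hermiteR, Polynomial.hermite_zero]
    | succ m =>
      rw [derivative_hermiteR_succ]
      simp only [mul_smul_comm, Polynomial.eval_smul, smul_eq_mul]
      rw [integral_const_mul, ih m]
      by_cases h : n = m
      · subst h; simp [Nat.factorial_succ]
      · rw [if_neg h, if_neg (by omega), mul_zero]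

theorem integral_prod_iidGaussian (s : Finset ℕ) {g : ℕ → ℝ → ℝ}
    (hg : ∀ k, Integrable (g k) (gaussianReal 0 1)) :
    Integrable (fun z => ∏ k ∈ s, g k (z k)) iidGaussian ∧
      ∫ z, ∏ k ∈ s, g k (z k) ∂iidGaussian = ∏ k ∈ s, ∫ t, g k t ∂gaussianReal 0 1 := by
  set f : (s → ℝ) → ℝ := fun y => ∏ i : s, g i (y i) with hf
  have hfi : Integrable f (Measure.pi fun _ : s => gaussianReal 0 1) :=
    Integrable.fintype_prod (μ := fun _ : s => gaussianReal 0 1) (f := fun i : s => g i)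
      fun i => hg i
  have e : (fun z : ℕ → ℝ => ∏ k ∈ s, g k (z k)) = fun z => f (s.restrict z) := by
    ext z
    exact (Finset.prod_coe_sort s fun k => g k (z k)).symm
  have hmap : iidGaussian.map s.restrict = Measure.pi fun _ : s => gaussianReal 0 1 :=
    Measure.infinitePi_map_restrict _
  have hm : Measurable (s.restrict : (ℕ → ℝ) → (s → ℝ)) := by fun_prop
  rw [e]
  constructor
  · rw [← hmap] at hfi
    exact hfi.comp_measurable hm
  · have := integral_map (μ := iidGaussian) (f := f) hm.aemeasurable
      (by rw [hmap]; exact hfi.aestronglyMeasurable)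
    rw [← this, hmap, hf, integral_fintype_prod_eq_prod (f := fun i : s => g i)]
    exact Finset.prod_coe_sort s fun k => ∫ t, g k t ∂gaussianReal 0 1

/-- The Hermite polynomial with multi-index `α` in the Hermite coordinates. -/
def wickMulti (α : ℕ →₀ ℕ) (x : Dist) : ℝ :=
  α.prod fun k m => Polynomial.aeval (x (hermiteFun k)) (Polynomial.hermite m)

theorem wick_eq {n : ℕ} (j : Fin n → ℕ) (x : Dist) : wick j x = wickMulti (cnt j) x := by
  have hs : (cnt j).support = Finset.univ.image j := by
    ext k
    rw [Finsupp.mem_support_iff, cnt_apply, Finset.card_ne_zero]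
    simp [Finset.Nonempty]
  rw [wick, wickMulti, Finsupp.prod, hs]
  simp only [cnt_apply]

theorem ofReal_wickMulti (α : ℕ →₀ ℕ) (x : Dist) :
    (wickMulti α x : ℂ) = mprod herm (hcoord x.toC) α := by
  rw [wickMulti, mprod, Finsupp.prod, Finsupp.prod, Complex.ofReal_prod]
  refine Finset.prod_congr rfl fun k _ => ?_
  exact (Polynomial.aeval_algebraMap_apply ℂ (x (hermiteFun k)) _).symm

theorem measurable_wickMulti (α : ℕ →₀ ℕ) : Measurable (wickMulti α) := by
  unfold wickMulti Finsupp.prod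
  refine Finset.measurable_prod _ fun k _ => ?_
  exact (Polynomial.continuous_aeval _).measurable.comp (measurable_eval _)

theorem synth_hermiteFun {z : ℕ → ℝ} (h : Memℓp (fun j : ℕ => z j / (2 * j + 2)) 2) (k : ℕ) :
    synth z (hermiteFun k) = z k := by
  refine (hasSum_synth h _).unique ?_
  have := hasSum_single (f := fun j => z j * dotp (hermiteFun k) (hermiteFun j)) k
    fun j hj => by rw [dotp_hermiteFun_ne (Ne.symm hj), mul_zero]
  simpa [dotp_hermiteFun_self] using this

/-- The factorial of a multi-index. -/
def factorialMulti (α : ℕ →₀ ℕ) : ℕ := α.prod fun _ m => m.factorial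

/-- Under μ the Hermite coordinates are independent standard normals, so the integral is a product
of one-dimensional ones; if α ≠ β, a coordinate where they differ gives the factor 0. -/
theorem integral_wickMulti_mul (α β : ℕ →₀ ℕ) :
    Integrable (fun x => wickMulti α x * wickMulti β x) whiteNoise ∧
      ∫ x, wickMulti α x * wickMulti β x ∂whiteNoise
        = if α = β then (factorialMulti α : ℝ) else 0 := by
  set s := α.support ∪ β.support
  set g : ℕ → ℝ → ℝ := fun k t => (hermiteR (α k) * hermiteR (β k)).eval t
  have hgi : ∀ k, Integrable (g k) (gaussianReal 0 1) := fun k => integrable_eval_gaussian _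
  have hm : Measurable fun x => wickMulti α x * wickMulti β x :=
    (measurable_wickMulti α).mul (measurable_wickMulti β)
  have e : (fun z => wickMulti α (synth z) * wickMulti β (synth z))
      =ᵐ[iidGaussian] fun z => ∏ k ∈ s, g k (z k) := by
    filter_upwards [ae_memlp] with z hz
    rw [wickMulti, wickMulti, Finsupp.prod_of_support_subset α Finset.subset_union_left _
      (fun k _ => by simp [Polynomial.hermite_zero]),
      Finsupp.prod_of_support_subset β (Finset.subset_union_right (s₁ := α.support)) _
      (fun k _ => by simp [Polynomial.hermite_zero]), ← Finset.prod_mul_distrib]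
    refine Finset.prod_congr rfl fun k _ => ?_
    simp only [g, Polynomial.eval_mul, synth_hermiteFun hz, hermiteR, Polynomial.eval_map,
      Polynomial.aeval_def]
    rfl
  obtain ⟨h1, h2⟩ := integral_prod_iidGaussian s hgi
  constructor
  · rw [whiteNoise, integrable_map_measure hm.aestronglyMeasurable measurable_synth.aemeasurable]
    exact h1.congr e.symm
  · rw [whiteNoise, integral_map measurable_synth.aemeasurable hm.aestronglyMeasurable,
      integral_congr_ae e, h2]
    simp only [g, integral_hermiteR_mul]
    split_ifs with h
    · subst h
      simp only [if_true]
      rw [factorialMulti, Finsupp.prod, Nat.cast_prod]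
      simp [s]
    · obtain ⟨k, hk⟩ := not_forall.mp (mt Finsupp.ext h)
      refine Finset.prod_eq_zero (i := k) ?_ (if_neg hk)
      simp only [s, Finset.mem_union, Finsupp.mem_support_iff]
      omega

/-! ### The Hermite polynomials in `L²(μ)` and the Wiener–Itô expansion -/

theorem memLp_wickMulti (α : ℕ →₀ ℕ) : MemLp (fun x => (wickMulti α x : ℂ)) 2 whiteNoise := by
  have h : MemLp (wickMulti α) 2 whiteNoise := by
    rw [memLp_two_iff_integrable_sq (measurable_wickMulti α).aestronglyMeasurable]
    exact (integral_wickMulti_mul α α).1.congr (ae_of_all _ fun x => (sq _).symm)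
  exact h.ofReal

/-- The Hermite polynomial with multi-index `α` as an element of `L²(μ)`. -/
def heL (α : ℕ →₀ ℕ) : Lp ℂ 2 whiteNoise := (memLp_wickMulti α).toLp

theorem coeFn_heL (α : ℕ →₀ ℕ) : heL α =ᵐ[whiteNoise] fun x => (wickMulti α x : ℂ) :=
  (memLp_wickMulti α).coeFn_toLp

theorem inner_heL (α β : ℕ →₀ ℕ) :
    inner ℂ (heL α) (heL β) = if α = β then (factorialMulti α : ℂ) else 0 := by
  rw [L2.inner_def]
  have : ∫ x, inner ℂ (heL α x) (heL β x) ∂whiteNoise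
      = ∫ x, ((wickMulti α x * wickMulti β x : ℝ) : ℂ) ∂whiteNoise := by
    apply integral_congr_ae
    filter_upwards [coeFn_heL α, coeFn_heL β] with x h1 h2
    rw [h1, h2]
    simp [mul_comm]
  rw [this, integral_complex_ofReal, (integral_wickMulti_mul α β).2]
  split_ifs <;> simp

theorem norm_heL_sq (α : ℕ →₀ ℕ) : ‖heL α‖ ^ 2 = factorialMulti α := by
  have := inner_self_eq_norm_sq_to_K (𝕜 := ℂ) (heL α)
  rw [inner_heL, if_pos rfl] at this
  apply Complex.ofReal_injective
  push_cast
  exact this.symm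

theorem one_le_factorialMulti (α : ℕ →₀ ℕ) : 1 ≤ factorialMulti α :=
  Finset.prod_pos fun _ _ => Nat.factorial_pos _

theorem one_le_norm_heL (α : ℕ →₀ ℕ) : 1 ≤ ‖heL α‖ := by
  rw [← one_le_sq_iff₀ (norm_nonneg _), norm_heL_sq]
  exact_mod_cast one_le_factorialMulti α

theorem norm_heL_le (α : ℕ →₀ ℕ) : ‖heL α‖ ≤ Real.sqrt α.degree.factorial := by
  apply Real.le_sqrt_of_sq_le
  rw [norm_heL_sq]
  exact_mod_cast Nat.le_of_dvd (Nat.factorial_pos _) (Nat.prod_factorial_dvd_factorial_sum _ _)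

/-- Identifies the defining limit with unconditional summability in L²(μ), so that continuous
functionals can be applied term by term. -/
theorem isWienerIntegral_iff {n : ℕ} {a : (Fin n → ℕ) → ℂ} {ψ : Lp ℂ 2 whiteNoise} :
    IsWienerIntegral a ψ ↔ HasSum (fun j => a j • heL (cnt j)) ψ := by
  rw [HasSum, SummationFilter.unconditional_filter, Lp.tendsto_Lp_iff_tendsto_eLpNorm',
    IsWienerIntegral]
  have e : ∀ s : Finset (Fin n → ℕ),
      eLpNorm (fun x => ψ x - ∑ j ∈ s, a j * (wick j x : ℂ)) 2 whiteNoise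
        = eLpNorm (⇑(∑ j ∈ s, a j • heL (cnt j)) - ⇑ψ) 2 whiteNoise := by
    intro s
    rw [eLpNorm_sub_comm]
    apply eLpNorm_congr_ae
    have h : ∀ᵐ x ∂whiteNoise, ∀ j : Fin n → ℕ, (a j • heL (cnt j) : Lp ℂ 2 whiteNoise) x
        = a j * (wick j x : ℂ) := by
      rw [ae_all_iff]
      intro j
      filter_upwards [Lp.coeFn_smul (a j) (heL (cnt j)), coeFn_heL (cnt j)] with x h1 h2
      rw [h1, Pi.smul_apply, h2, wick_eq, smul_eq_mul]
    filter_upwards [h, Lp.coeFn_finsetSum s fun j => a j • heL (cnt j)] with x h1 h2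
    simp only [Pi.sub_apply, h2, Finset.sum_apply, h1]
  simp_rw [e]

/-- Pairing with the Hermite product of a tuple j removes all other degrees. In degree n only
rearrangements of j survive, and by symmetry all carry the coefficient of j. If it were nonzero,
dividing by it would leave a nonnegative series with sum 0 and a positive term. -/
theorem IsWienerIto.eq_zero {f : (n : ℕ) → (Fin n → ℕ) → ℂ} (h : IsWienerIto 0 f) : f = 0 := by
  obtain ⟨hk, ψ, hψ, hs⟩ := h
  have hψ' : ∀ n, HasSum (fun j => f n j • heL (cnt j)) (ψ n) :=
    fun n => isWienerIntegral_iff.mp (hψ n)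
  ext n j
  by_contra hne
  have h1 : ∀ m, HasSum (fun j' : Fin m → ℕ => f m j' * inner ℂ (heL (cnt j)) (heL (cnt j')))
      (inner ℂ (heL (cnt j)) (ψ m)) := by
    intro m
    refine ((innerSL ℂ (heL (cnt j))).hasSum (hψ' m)).congr_fun fun j' => ?_
    rw [innerSL_apply_apply, inner_smul_right]
  have h2 : HasSum (fun m => inner ℂ (heL (cnt j)) (ψ m)) 0 := by
    have := (innerSL ℂ (heL (cnt j))).hasSum hs
    rwa [map_zero] at this
  have h3 : ∀ m, m ≠ n → inner ℂ (heL (cnt j)) (ψ m) = 0 := by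
    intro m hm
    refine (h1 m).unique (hasSum_zero.congr_fun fun j' => ?_)
    rw [inner_heL, if_neg, mul_zero]
    intro h
    apply hm
    rw [← degree_cnt j', ← h, degree_cnt]
  have h4 : inner ℂ (heL (cnt j)) (ψ n) = 0 := (hasSum_single n h3).unique h2
  have h5 := h1 n
  rw [h4] at h5
  have h6 : HasSum (fun j' : Fin n → ℕ =>
      f n j * ((if cnt j = cnt j' then (factorialMulti (cnt j) : ℝ) else 0 : ℝ) : ℂ))
      (f n j * 0) := by
    rw [mul_zero]
    refine h5.congr_fun fun j' => ?_
    rw [inner_heL]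
    split_ifs with h
    · obtain ⟨σ, rfl⟩ := cnt_eq_iff.mp h
      rw [(hk n).symm]; simp
    · simp
  rw [hasSum_mul_left_iff hne] at h6
  have h7 := Complex.hasSum_ofReal.mp (by rwa [Complex.ofReal_zero])
  rw [hasSum_zero_iff_of_nonneg (fun j' => by positivity)] at h7
  have h8 : (factorialMulti (cnt j) : ℝ) = 0 := by
    simpa only [if_true, Pi.zero_apply] using congrFun h7 j
  have := one_le_factorialMulti (cnt j)
  have h9 : factorialMulti (cnt j) = 0 := by exact_mod_cast h8
  omega

theorem IsWienerIto.unique {φ : Lp ℂ 2 whiteNoise} {f g : (n : ℕ) → (Fin n → ℕ) → ℂ}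
    (hf : IsWienerIto φ f) (hg : IsWienerIto φ g) : f = g := by
  have h := hf.add (hg.smul (-1))
  rw [neg_one_smul, add_neg_cancel, neg_one_smul] at h
  exact eq_of_sub_eq_zero (by rw [sub_eq_add_neg]; exact h.eq_zero)

theorem cksNorm_eq {u : ℝ → ℝ} {p : ℝ} {φ : Lp ℂ 2 whiteNoise} {f : (n : ℕ) → (Fin n → ℕ) → ℂ}
    (hf : IsWienerIto φ f) : cksNorm u p φ = kernelsNorm u p f := by
  apply le_antisymm
  · exact iInf₂_le f hf
  · exact le_iInf₂ fun g hg => by rw [hf.unique hg]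

/-! ### Kernels and coefficients of Hermite polynomials -/

/-- The symmetric kernels of the element of `L²(μ)` with Hermite coefficients `c`. -/
def kern (c : (ℕ →₀ ℕ) → ℂ) (n : ℕ) (j : Fin n → ℕ) : ℂ := c (cnt j) / mult (cnt j)

theorem mult_ne_zero (α : ℕ →₀ ℕ) : (mult α : ℂ) ≠ 0 := by
  have := one_le_mult α
  exact_mod_cast (by omega : mult α ≠ 0)

theorem norm_kern_le (c : (ℕ →₀ ℕ) → ℂ) (n : ℕ) (j : Fin n → ℕ) :
    ‖kern c n j‖ ≤ ‖c (cnt j)‖ := by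
  have : (1 : ℝ) ≤ mult (cnt j) := by exact_mod_cast one_le_mult (cnt j)
  rw [kern, norm_div, Complex.norm_natCast]
  exact div_le_self (norm_nonneg _) this

theorem kern_symm (c : (ℕ →₀ ℕ) → ℂ) (n : ℕ) (σ : Equiv.Perm (Fin n)) (j : Fin n → ℕ) :
    kern c n (j ∘ σ) = kern c n j := by
  have h : cnt j = cnt (j ∘ σ) := cnt_eq_iff.mpr ⟨σ, rfl⟩
  rw [kern, kern, h]

theorem kern_injective : Function.Injective kern := by
  intro c c' h
  ext α
  obtain ⟨j, hj⟩ := exists_cnt α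
  have := congrFun (congrFun h α.degree) j
  rw [kern, kern, hj] at this
  exact (div_left_inj' (mult_ne_zero α)).mp this

/-- A symmetric family is constant on tuples with equal counts, so multiplying its value by the
multiplicity recovers the Hermite coefficient. -/
theorem exists_kern_eq {f : (n : ℕ) → (Fin n → ℕ) → ℂ}
    (hf : ∀ (n : ℕ) (σ : Equiv.Perm (Fin n)) (j : Fin n → ℕ), f n (j ∘ σ) = f n j) :
    ∃ c, kern c = f := by
  choose s hs using exists_cnt
  refine ⟨fun α => mult α * f α.degree (s α), ?_⟩
  have key : ∀ (n m : ℕ) (j : Fin n → ℕ) (j' : Fin m → ℕ), cnt j = cnt j' → f n j = f m j' := by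
    intro n m j j' h
    have hnm : n = m := by rw [← degree_cnt j, h, degree_cnt]
    subst hnm
    obtain ⟨σ, rfl⟩ := cnt_eq_iff.mp h
    exact (hf _ _ _).symm
  ext n j
  rw [kern, mul_div_cancel_left₀ _ (mult_ne_zero _)]
  exact key _ _ _ _ (hs _)

section

variable {u : ℝ → ℝ} {C κ M : ℝ} {c : (ℕ →₀ ℕ) → ℂ}

/-- The norm of the Hermite product is at most √|α|!, and G(|α|) √|α|! is bounded geometrically by
the case n = 0 of the first inequality in `ConnBound`. -/
theorem norm_mul_norm_heL_le (hu : IsWeight u) (hb : ConnBound u C κ) (hM : 0 ≤ M)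
    (hc : Decays u (κ + 2) M c) (α : ℕ →₀ ℕ) :
    ‖c α‖ * ‖heL α‖ ≤ M * C * rootLegendre u 0 * (wt α ^ 2)⁻¹ := by
  obtain ⟨hC, hκ, hb, -⟩ := hb
  have h1 := hb 0 α.degree
  rw [zero_add] at h1
  have hG0 := (hu.rootLegendre_pos 0).le
  have hG := (hu.rootLegendre_pos α.degree).le
  have hw := wt_pos α
  calc ‖c α‖ * ‖heL α‖
      ≤ M * rootLegendre u α.degree * wt α ^ (-(κ + 2)) * Real.sqrt α.degree.factorial := by
        gcongr
        · exact hc α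
        · exact norm_heL_le α
    _ = M * wt α ^ (-(κ + 2)) * (rootLegendre u α.degree * Real.sqrt α.degree.factorial) := by ring
    _ ≤ M * wt α ^ (-(κ + 2)) * (C * 2 ^ (κ * α.degree) * rootLegendre u 0) := by gcongr
    _ ≤ M * wt α ^ (-(κ + 2)) * (C * wt α ^ κ * rootLegendre u 0) := by
        gcongr
        rw [mul_comm, Real.rpow_mul (by norm_num), Real.rpow_natCast]
        exact Real.rpow_le_rpow (by positivity) (two_pow_degree_le_wt α) hκ
    _ = M * C * rootLegendre u 0 * (wt α ^ (-(κ + 2)) * wt α ^ κ) := by ring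
    _ = _ := by
        rw [← Real.rpow_add hw, ← wt_rpow_neg_two]
        congr 2; ring

/-- The series over all tuples converges absolutely in L²(μ). Grouping by counts gives the Hermite
series; grouping by length gives the Wiener–Itô expansion. -/
theorem exists_isWienerIto_kern (hu : IsWeight u) (hb : ConnBound u C κ) (hM : 0 ≤ M)
    (hc : Decays u (κ + 2) M c) :
    ∃ S, HasSum (fun α => c α • heL α) S ∧ IsWienerIto S (kern c) := by
  have hbd := norm_mul_norm_heL_le hu hb hM hc
  set B := M * C * rootLegendre u 0
  have hB : 0 ≤ B := mul_nonneg (mul_nonneg hM hb.1) (hu.rootLegendre_pos 0).le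
  have ht : Summable fun j : Tuple => kern c j.1 j.2 • heL (cnt j.2) := by
    refine Summable.of_norm_bounded (summable_tuple_wt.mul_left B) fun j => ?_
    rw [norm_smul]
    exact (mul_le_mul_of_nonneg_right (norm_kern_le c _ _) (norm_nonneg _)).trans (hbd _)
  obtain ⟨S, hS⟩ := ht
  refine ⟨S, ?_, fun n => ⟨kern_symm c n, ?_⟩, fun n => ∑' j, kern c n j • heL (cnt j),
    fun n => ?_, ?_⟩
  · have h1 := (Equiv.sigmaFiberEquiv fun j : Tuple => cnt j.2).hasSum_iff.mpr hS
    refine h1.sigma fun α => ?_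
    have h2 := hasSum_fintype fun j : fiber α => kern c j.1.1 j.1.2 • heL (cnt j.1.2)
    have h3 : ∑ j : fiber α, kern c j.1.1 j.1.2 • heL (cnt j.1.2) = c α • heL α := by
      have : ∀ j : fiber α, kern c j.1.1 j.1.2 • heL (cnt j.1.2)
          = (c α / mult α) • heL α := by
        rintro ⟨j, hj⟩
        rw [kern, show cnt j.2 = α from hj]
      rw [Finset.sum_congr rfl fun j _ => this j, Finset.sum_const, Finset.card_univ,
        ← Nat.cast_smul_eq_nsmul ℂ,
        smul_smul]
      congr 1
      exact mul_div_cancel₀ _ (mult_ne_zero α)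
    rw [h3] at h2
    exact h2
  · have h1 := (summable_tuple_wt.sigma_factor n).mul_left (B ^ 2)
    refine Summable.of_nonneg_of_le (fun _ => by positivity) (fun j => ?_) h1
    have hw := one_le_wt (cnt j)
    have h2 : ‖kern c n j‖ ≤ B * (wt (cnt j) ^ 2)⁻¹ := by
      refine (norm_kern_le c n j).trans (le_trans ?_ (hbd _))
      exact le_mul_of_one_le_right (norm_nonneg _) (one_le_norm_heL _)
    have h3 : (wt (cnt j) ^ 2)⁻¹ ≤ 1 := inv_le_one_of_one_le₀ (one_le_pow₀ hw)
    have h4 : 0 ≤ (wt (cnt j) ^ 2)⁻¹ := by positivity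
    calc ‖kern c n j‖ ^ 2 ≤ (B * (wt (cnt j) ^ 2)⁻¹) ^ 2 := by gcongr
      _ = B ^ 2 * ((wt (cnt j) ^ 2)⁻¹ * (wt (cnt j) ^ 2)⁻¹) := by ring
      _ ≤ B ^ 2 * ((wt (cnt j) ^ 2)⁻¹ * 1) := by gcongr
      _ = _ := by rw [mul_one]
  · rw [isWienerIntegral_iff]
    exact (hS.summable.sigma_factor n).hasSum
  · exact hS.sigma fun n => (hS.summable.sigma_factor n).hasSum

/-- L² convergence gives almost everywhere convergence along a cofinal sequence of finite sets, and
the pointwise sums converge to F along the same sequence. -/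
theorem ae_eq_of_hasSum_heL {S : Lp ℂ 2 whiteNoise} (hS : HasSum (fun α => c α • heL α) S)
    {F : Dist → ℂ} (hF : ∀ x : Dist, HasSum (fun α => c α * mprod herm (hcoord x.toC) α) (F x)) :
    S =ᵐ[whiteNoise] F := by
  have h1 : Tendsto (fun s : Finset (ℕ →₀ ℕ) => ∑ α ∈ s, c α • heL α) atTop (𝓝 S) := hS
  obtain ⟨ns, hns, hae⟩ := (tendstoInMeasure_of_tendsto_Lp h1).exists_seq_tendsto_ae'
  have h : ∀ᵐ x ∂whiteNoise, ∀ α, (c α • heL α : Lp ℂ 2 whiteNoise) x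
      = c α * mprod herm (hcoord x.toC) α := by
    rw [ae_all_iff]
    intro α
    filter_upwards [Lp.coeFn_smul (c α) (heL α), coeFn_heL α] with x h1 h2
    rw [h1, Pi.smul_apply, h2, ofReal_wickMulti, smul_eq_mul]
  have h' : ∀ᵐ x ∂whiteNoise, ∀ i, (∑ α ∈ ns i, c α • heL α : Lp ℂ 2 whiteNoise) x
      = ∑ α ∈ ns i, (c α • heL α : Lp ℂ 2 whiteNoise) x := by
    rw [ae_all_iff]
    intro i
    filter_upwards [Lp.coeFn_finsetSum (ns i) fun α => c α • heL α] with x hx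
    rw [hx, Finset.sum_apply]
  filter_upwards [hae, h, h'] with x h2 h3 h4
  refine tendsto_nhds_unique h2 ?_
  simp_rw [h4, h3]
  have h5 : Tendsto (fun s : Finset (ℕ →₀ ℕ) => ∑ α ∈ s, c α * mprod herm (hcoord x.toC) α) atTop
      (𝓝 (F x)) := hF x
  exact h5.comp hns

end

/-! ### The norms `‖·‖_{u,p}` and the decay of the coefficients -/

theorem kernelsNorm_eq {u : ℝ → ℝ} (hu : IsWeight u) (p : ℝ) (f : (n : ℕ) → (Fin n → ℕ) → ℂ) :
    kernelsNorm u p f = (∑' j : Tuple, ENNReal.ofReal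
      ((wt (cnt j.2) ^ p * ‖f j.1 j.2‖ / rootLegendre u j.1) ^ 2)) ^ (1 / 2 : ℝ) := by
  rw [kernelsNorm, ENNReal.tsum_sigma']
  congr 2; ext n
  rw [kernelNormSq, ← ENNReal.tsum_mul_left]
  congr 1; ext j
  have hl := hu.legendre_pos n
  rw [← ENNReal.ofReal_mul (by positivity), norm_mul, Complex.norm_real,
    Real.norm_of_nonneg (Finset.prod_nonneg fun i _ => by positivity),
    Real.finsetProd_rpow _ _ (fun i _ => by positivity), ← wt_cnt, div_pow, rootLegendre,
    Real.sq_sqrt hl.le]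
  congr 1; ring

theorem kernelsNorm_kern_le {u : ℝ → ℝ} (hu : IsWeight u) {p M : ℝ} {c : (ℕ →₀ ℕ) → ℂ}
    (hM : 0 ≤ M) (hc : Decays u (p + 1) M c) :
    kernelsNorm u p (kern c) ≤ ENNReal.ofReal (M * Real.sqrt tupleSum) := by
  have h1 : ∀ j : Tuple, (wt (cnt j.2) ^ p * ‖kern c j.1 j.2‖ / rootLegendre u j.1) ^ 2
      ≤ M ^ 2 * (wt (cnt j.2) ^ 2)⁻¹ := by
    intro j
    have hG := hu.rootLegendre_pos j.1
    have hw := wt_pos (cnt j.2)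
    have h2 := (norm_kern_le c j.1 j.2).trans (hc (cnt j.2))
    -- Of the exponent p + 1, p cancels the weight in the norm; the extra 1 becomes, after squaring,
    -- the summable wt^{-2}.
    rw [degree_cnt] at h2
    have h3 : wt (cnt j.2) ^ p * ‖kern c j.1 j.2‖ / rootLegendre u j.1 ≤ M * (wt (cnt j.2))⁻¹ := by
      rw [div_le_iff₀ hG]
      calc wt (cnt j.2) ^ p * ‖kern c j.1 j.2‖
          ≤ wt (cnt j.2) ^ p * (M * rootLegendre u j.1 * wt (cnt j.2) ^ (-(p + 1))) := by gcongr
        _ = M * rootLegendre u j.1 * (wt (cnt j.2) ^ p * wt (cnt j.2) ^ (-(p + 1))) := by ring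
        _ = _ := by
          rw [← Real.rpow_add hw, ← Real.rpow_neg_one]
          ring_nf
    calc _ ≤ (M * (wt (cnt j.2))⁻¹) ^ 2 := by gcongr
      _ = _ := by rw [mul_pow, inv_pow]
  rw [kernelsNorm_eq hu]
  calc _ ≤ (∑' j : Tuple, ENNReal.ofReal (M ^ 2 * (wt (cnt j.2) ^ 2)⁻¹)) ^ (1 / 2 : ℝ) := by
        gcongr with j; exact h1 j
    _ = ENNReal.ofReal (M ^ 2 * tupleSum) ^ (1 / 2 : ℝ) := by
        rw [← ENNReal.ofReal_tsum_of_nonneg (fun _ => by positivity) (summable_tuple_wt.mul_left _),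
          tsum_mul_left, tupleSum]
    _ = _ := by
        rw [ENNReal.ofReal_rpow_of_nonneg (mul_nonneg (sq_nonneg _) tupleSum_nonneg) (by norm_num),
          ← Real.sqrt_eq_rpow, Real.sqrt_mul (sq_nonneg _), Real.sqrt_sq hM]

/-- A single term is bounded by the whole sum. Returning from the kernel to the Hermite coefficient
multiplies by the multiplicity, at most a constant times wt(α)²; hence the loss of 2. -/
theorem decays_of_kernelsNorm {u : ℝ → ℝ} (hu : IsWeight u) {q : ℝ} {c : (ℕ →₀ ℕ) → ℂ}
    (hc : kernelsNorm u q (kern c) ≠ ∞) :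
    Decays u (q - 2) (tupleSum * (kernelsNorm u q (kern c)).toReal) c := by
  intro α
  obtain ⟨j, hj⟩ := exists_cnt α
  set K := kernelsNorm u q (kern c) with hK
  have hG := hu.rootLegendre_pos α.degree
  have hw := wt_pos α
  have hm := mult_le α
  have hm1 : (1 : ℝ) ≤ mult α := by exact_mod_cast one_le_mult α
  have h1 : ENNReal.ofReal ((wt α ^ q * ‖kern c α.degree j‖ / rootLegendre u α.degree) ^ 2)
      ≤ K ^ (2 : ℝ) := by
    rw [hK, kernelsNorm_eq hu, ← ENNReal.rpow_mul]
    norm_num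
    have := ENNReal.le_tsum (f := fun j : Tuple => ENNReal.ofReal
      ((wt (cnt j.2) ^ q * ‖kern c j.1 j.2‖ / rootLegendre u j.1) ^ 2)) ⟨α.degree, j⟩
    simp only [hj] at this
    exact this
  have h2 : wt α ^ q * ‖kern c α.degree j‖ / rootLegendre u α.degree ≤ K.toReal := by
    rw [ENNReal.rpow_ofNat, ← ENNReal.ofReal_toReal hc, ← ENNReal.ofReal_pow ENNReal.toReal_nonneg,
      ENNReal.ofReal_le_ofReal_iff (by positivity)] at h1
    exact (pow_le_pow_iff_left₀ (by positivity) ENNReal.toReal_nonneg two_ne_zero).mp h1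
  rw [div_le_iff₀ hG, kern, hj, norm_div, Complex.norm_natCast, ← mul_div_assoc,
    div_le_iff₀ (by positivity)] at h2
  have h3 : ‖c α‖ = wt α ^ (-q) * (wt α ^ q * ‖c α‖) := by
    rw [← mul_assoc, ← Real.rpow_add hw]; simp
  have hK0 : 0 ≤ K.toReal := ENNReal.toReal_nonneg
  calc ‖c α‖ = wt α ^ (-q) * (wt α ^ q * ‖c α‖) := h3
    _ ≤ wt α ^ (-q) * (K.toReal * rootLegendre u α.degree * (tupleSum * wt α ^ 2)) := by
        refine mul_le_mul_of_nonneg_left (h2.trans ?_) (by positivity)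
        exact mul_le_mul_of_nonneg_left hm (by positivity)
    _ = tupleSum * K.toReal * rootLegendre u α.degree * (wt α ^ (-q) * wt α ^ (2 : ℝ)) := by
        rw [Real.rpow_ofNat]; ring
    _ = _ := by
        rw [← Real.rpow_add hw]
        congr 2; ring

/-! ### Hermite expansions of the functions in `A_u` -/

theorem analyticNorm_le_ofReal_iff {u : ℝ → ℝ} (hu : IsWeight u) {p M : ℝ} (hM : 0 ≤ M)
    {Φ : DistC → ℂ} : analyticNorm u p Φ ≤ ENNReal.ofReal M ↔
      ∀ x : DistCp p, ‖Φ x.incl‖ ≤ M * Real.sqrt (u (‖x‖ ^ 2)) := by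
  rw [analyticNorm, iSup_le_iff]
  refine forall_congr' fun x => ?_
  have h := hu.pos _ (sq_nonneg ‖x‖)
  rw [ENNReal.ofReal_le_ofReal_iff hM, Real.rpow_neg h.le, ← Real.sqrt_eq_rpow,
    ← div_eq_mul_inv, div_le_iff₀ (Real.sqrt_pos.mpr h)]

/-- The constant A + 1 in place of A keeps the right side infinite when b = ∞ and A = 0, because 0 ·
∞ = 0 in `ℝ≥0∞`. -/
theorem le_coe_mul_of_toReal {a b : ℝ≥0∞} {A : ℝ} (hA : 0 ≤ A)
    (h : b ≠ ∞ → a ≤ ENNReal.ofReal (A * b.toReal)) : a ≤ ((A + 1).toNNReal : ℝ≥0∞) * b := by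
  by_cases hb : b = ∞
  · have : (A + 1).toNNReal ≠ 0 := by
      rw [Ne, Real.toNNReal_eq_zero]; linarith
    rw [hb, ENNReal.mul_top (by exact_mod_cast this)]
    exact le_top
  · refine (h hb).trans ?_
    rw [ENNReal.ofReal_mul hA, ENNReal.ofReal_toReal hb]
    exact mul_le_mul_left (ENNReal.ofReal_le_ofReal (by linarith)) _

section

variable {u : ℝ → ℝ} {C κ : ℝ}

theorem exists_hermite_expansion (hu : IsWeight u) (hb : ConnBound u C κ) {Φ : DistC → ℂ}
    (hΦ : Φ ∈ analyticSpace u) : ∃ c : (ℕ →₀ ℕ) → ℂ,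
      (∀ x, HasSum (fun α => c α * mprod herm (hcoord x) α) (Φ x)) ∧
      ∀ q M : ℝ, 0 ≤ q → 0 ≤ M →
        (∀ x : DistCp (q + 3 + κ), ‖Φ x.incl‖ ≤ M * Real.sqrt (u (‖x‖ ^ 2))) →
        Decays u q (M * C * wtSum) c := by
  obtain ⟨d, hd, hdec⟩ := exists_coeff hu hΦ
  have hκ := hb.2.1
  refine ⟨transform powCoeff d, fun x => ?_, fun q M hq hM h => ?_⟩
  · obtain ⟨p, hp, hx⟩ := exists_mem_distCp x
    let y : DistCp p := ⟨x, hx⟩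
    have h1 := mprod_bound hu hb isConnection_hermCoeff (P := herm) (Q := mono)
      (fun z => pow_zero z) herm_eq_sum hp (Real.sqrt_nonneg _) (DistCp.mono_bound hu y)
    -- The Hermite products at x have exponent κ + p + 2 by `mprod_bound`; the interchange of sums
    -- needs 4 + κ more, and Cauchy's estimates lose 1.
    obtain ⟨M, hM, hbd⟩ := (hΦ (κ + p + 2 + 4 + κ + 1) (by positivity)).exists_norm_le
    have h2 := hdec _ M hM hbd
    rw [add_sub_cancel_right] at h2
    obtain ⟨S, hS1, hS2⟩ := exists_hasSum_transform hu hb isConnection_powCoeff (P := mono)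
      (Q := herm) herm_zero pow_eq_sum (by positivity) h1 hM h2
    rwa [hS1.unique (hd x)] at hS2
  -- Of the shift 3 + κ, Cauchy's estimates use 1 and the change of coefficients uses 2 + κ.
  · have h1 := hdec _ M hM h
    rw [show q + 3 + κ - 1 = q + 2 + κ by ring] at h1
    exact h1.transform hu hb isConnection_powCoeff hM hq

theorem exists_analytic_of_decays (hu : IsWeight u) (hb : ConnBound u C κ)
    {c : (ℕ →₀ ℕ) → ℂ} (hc : ∀ q : ℝ, 0 ≤ q → ∃ M, 0 ≤ M ∧ Decays u q M c) :
    ∃ Φ ∈ analyticSpace u, (∀ x, HasSum (fun α => c α * mprod herm (hcoord x) α) (Φ x)) ∧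
      ∀ p M : ℝ, 0 ≤ p → 0 ≤ M → Decays u (p + 4 + κ) M c →
        ∀ x : DistCp p, ‖Φ x.incl‖ ≤ M * C * wtSum * wtSum * Real.sqrt (u (‖x‖ ^ 2)) := by
  have hκ := hb.2.1
  have hC := hb.1
  have hw := wtSum_nonneg
  refine ⟨powerSum (transform hermCoeff c), powerSum_mem hu fun q hq => ?_, fun x => ?_,
    fun p M hp hM h x => ?_⟩
  · obtain ⟨M, hM, h⟩ := hc (q + 2 + κ) (by positivity)
    exact ⟨M * C * wtSum, by positivity, h.transform hu hb isConnection_hermCoeff hM hq⟩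
  · obtain ⟨p, hp, hx⟩ := exists_mem_distCp x
    obtain ⟨M, hM, h⟩ := hc (p + 4 + κ) (by positivity)
    let y : DistCp p := ⟨x, hx⟩
    obtain ⟨S, hS1, hS2⟩ := exists_hasSum_transform hu hb isConnection_hermCoeff (P := herm)
      (Q := mono) (fun z => pow_zero z) herm_eq_sum hp (DistCp.mono_bound hu y) hM h
    have : S = powerSum (transform hermCoeff c) x := hS2.tsum_eq.symm
    rwa [this] at hS1
  · rw [show p + 4 + κ = p + 2 + 2 + κ by ring] at h
    exact norm_powerSum_le hu (by positivity)
      (h.transform hu hb isConnection_hermCoeff hM (by positivity)) x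

theorem exists_restriction (hu : IsWeight u) (hb : ConnBound u C κ) {c : (ℕ →₀ ℕ) → ℂ}
    (hc : ∀ q : ℝ, 0 ≤ q → ∃ M, 0 ≤ M ∧ Decays u q M c) {Φ : DistC → ℂ}
    (hΦ : ∀ x, HasSum (fun α => c α * mprod herm (hcoord x) α) (Φ x)) :
    ∃ S ∈ testSpace u, IsWienerIto S (kern c) ∧ S =ᵐ[whiteNoise] fun x => Φ x.toC := by
  obtain ⟨M, hM, h⟩ := hc (κ + 2) (by have := hb.2.1; positivity)
  obtain ⟨S, hS, hI⟩ := exists_isWienerIto_kern hu hb hM h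
  refine ⟨S, fun p hp => ?_, hI, ae_eq_of_hasSum_heL hS fun x => hΦ x.toC⟩
  obtain ⟨M, hM, h⟩ := hc (p + 1) (by positivity)
  rw [cksNorm_eq hI]
  exact (kernelsNorm_kern_le hu hM h).trans_lt ENNReal.ofReal_lt_top

theorem exists_coeff_of_mem_testSpace (hu : IsWeight u) {φ : Lp ℂ 2 whiteNoise}
    (hφ : φ ∈ testSpace u) : ∃ c, IsWienerIto φ (kern c) ∧
      ∀ q : ℝ, 0 ≤ q → ∃ M, 0 ≤ M ∧ Decays u q M c := by
  -- Kernels found for one exponent serve for all of them, by uniqueness of the expansion.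
  obtain ⟨f, hf, -⟩ := cksNorm_lt_top.mp (hφ 0 le_rfl)
  obtain ⟨c, rfl⟩ := exists_kern_eq fun n => (hf.1 n).symm
  refine ⟨c, hf, fun q hq => ?_⟩
  have h := hφ (q + 2) (by positivity)
  rw [cksNorm_eq hf] at h
  have h2 := decays_of_kernelsNorm hu h.ne
  rw [add_sub_cancel_right] at h2
  exact ⟨_, mul_nonneg tupleSum_nonneg ENNReal.toReal_nonneg, h2⟩

/-- The Hermite coefficients of a function in `A_u`, with their decay, are those of its restriction
to `E*`. -/
theorem exists_expansion (hu : IsWeight u) (hb : ConnBound u C κ) {Φ : DistC → ℂ}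
    (hΦ : Φ ∈ analyticSpace u) : ∃ c : (ℕ →₀ ℕ) → ℂ,
      (∀ x, HasSum (fun α => c α * mprod herm (hcoord x) α) (Φ x)) ∧
      (∀ q : ℝ, 0 ≤ q → ∃ M, 0 ≤ M ∧ Decays u q M c) ∧
      (∀ q M : ℝ, 0 ≤ q → 0 ≤ M →
        (∀ x : DistCp (q + 3 + κ), ‖Φ x.incl‖ ≤ M * Real.sqrt (u (‖x‖ ^ 2))) →
        Decays u q (M * C * wtSum) c) ∧
      ∀ S : Lp ℂ 2 whiteNoise, (S =ᵐ[whiteNoise] fun x => Φ x.toC) →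
        S ∈ testSpace u ∧ IsWienerIto S (kern c) := by
  obtain ⟨c, h1, h2⟩ := exists_hermite_expansion hu hb hΦ
  have hκ := hb.2.1
  have hC := hb.1
  have hw := wtSum_nonneg
  have h3 : ∀ q : ℝ, 0 ≤ q → ∃ M, 0 ≤ M ∧ Decays u q M c := by
    intro q hq
    obtain ⟨M, hM, h⟩ := (hΦ (q + 3 + κ) (by positivity)).exists_norm_le
    exact ⟨_, by positivity, h2 q M hq hM h⟩
  refine ⟨c, h1, h3, h2, fun S hS => ?_⟩
  obtain ⟨S', hS', hI, hae⟩ := exists_restriction hu hb h3 h1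
  have : S = S' := Lp.ext (hS.trans hae.symm)
  rw [this]
  exact ⟨hS', hI⟩

/-! ### The restriction map as a linear bijection -/

theorem memLp_restriction (hu : IsWeight u) {Φ : DistC → ℂ} (hΦ : Φ ∈ analyticSpace u) :
    MemLp (fun x : Dist => Φ x.toC) 2 whiteNoise := by
  obtain ⟨C, κ, hb⟩ := hu.exists_connBound
  obtain ⟨c, h1, h3, -⟩ := exists_expansion hu hb hΦ
  obtain ⟨S, -, -, hae⟩ := exists_restriction hu hb h3 h1
  exact (memLp_congr_ae hae).mp (Lp.memLp S)

/-- The restriction of the functions in `A_u` to `E*`, as elements of `L²(μ)`. -/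
def restrictLp (hu : IsWeight u) : analyticSpace u →ₗ[ℂ] Lp ℂ 2 whiteNoise where
  toFun Φ := (memLp_restriction hu Φ.2).toLp
  map_add' Φ Ψ := MemLp.toLp_add (memLp_restriction hu Φ.2) (memLp_restriction hu Ψ.2)
  map_smul' a Φ := MemLp.toLp_const_smul a (memLp_restriction hu Φ.2)

theorem coeFn_restrictLp (hu : IsWeight u) (Φ : analyticSpace u) :
    restrictLp hu Φ =ᵐ[whiteNoise] fun x => (Φ : DistC → ℂ) x.toC :=
  (memLp_restriction hu Φ.2).coeFn_toLp

theorem restrictLp_mem (hu : IsWeight u) (Φ : analyticSpace u) : restrictLp hu Φ ∈ testSpace u := by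
  obtain ⟨C, κ, hb⟩ := hu.exists_connBound
  obtain ⟨c, -, -, -, h⟩ := exists_expansion hu hb Φ.2
  exact (h _ (coeFn_restrictLp hu Φ)).1

/-- If the restriction vanishes almost everywhere, its kernels vanish, hence so do the Hermite
coefficients; their series represents Φ on all of E*_c, not only on E*. -/
theorem restrictLp_injective (hu : IsWeight u) : Function.Injective (restrictLp hu) := by
  rw [injective_iff_map_eq_zero]
  intro Φ h0
  obtain ⟨C, κ, hb⟩ := hu.exists_connBound
  obtain ⟨c, h1, -, -, h⟩ := exists_expansion hu hb Φ.2
  have h2 := (h _ (coeFn_restrictLp hu Φ)).2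
  rw [h0] at h2
  have h3 : c = 0 := kern_injective (by
    rw [h2.eq_zero]; ext n j; simp [kern])
  ext x
  have h4 := h1 x
  simp only [h3, Pi.zero_apply, zero_mul] at h4
  exact h4.unique hasSum_zero

theorem exists_restrictLp_eq (hu : IsWeight u) {φ : Lp ℂ 2 whiteNoise} (hφ : φ ∈ testSpace u) :
    ∃ Φ, restrictLp hu Φ = φ := by
  obtain ⟨C, κ, hb⟩ := hu.exists_connBound
  obtain ⟨c, hI, hc⟩ := exists_coeff_of_mem_testSpace hu hφ
  obtain ⟨Φ, hΦ, hs, -⟩ := exists_analytic_of_decays hu hb hc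
  obtain ⟨M, hM, h⟩ := hc (κ + 2) (by have := hb.2.1; positivity)
  obtain ⟨S, hS, hI'⟩ := exists_isWienerIto_kern hu hb hM h
  have h1 : restrictLp hu ⟨Φ, hΦ⟩ = S :=
    Lp.ext ((coeFn_restrictLp hu _).trans (ae_eq_of_hasSum_heL hS fun x => hs x.toC).symm)
  refine ⟨⟨Φ, hΦ⟩, h1.trans ?_⟩
  obtain ⟨-, ψ, hψ, hsum⟩ := hI
  obtain ⟨-, ψ', hψ', hsum'⟩ := hI'
  -- Both elements have the same kernels, so their Wiener integrals agree degree by degree, and so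
  -- do the sums.
  have h2 : ψ = ψ' := funext fun n =>
    (isWienerIntegral_iff.mp (hψ n)).unique (isWienerIntegral_iff.mp (hψ' n))
  rw [← h2] at hsum'
  exact hsum'.unique hsum

/-- The restriction to `E*` as a linear bijection of `A_u` onto `[E]_u`. -/
def restrictEquiv (hu : IsWeight u) : analyticSpace u ≃ₗ[ℂ] testSpace u :=
  LinearEquiv.ofBijective ((restrictLp hu).codRestrict (testSpace u) (restrictLp_mem hu))
    ⟨fun _ _ h => restrictLp_injective hu (congrArg Subtype.val h), fun φ => by
      obtain ⟨Φ, h⟩ := exists_restrictLp_eq hu φ.2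
      exact ⟨Φ, Subtype.ext h⟩⟩

/-! ### Comparison of the two families of norms -/

theorem analyticNorm_le_cksNorm (hu : IsWeight u) (hb : ConnBound u C κ) {p : ℝ} (hp : 0 ≤ p)
    (Φ : analyticSpace u) : analyticNorm u p (Φ : DistC → ℂ)
      ≤ ((tupleSum * C * wtSum * wtSum + 1).toNNReal : ℝ≥0∞)
        * cksNorm u (p + 6 + κ) (restrictLp hu Φ) := by
  have hC := hb.1
  have hw := wtSum_nonneg
  have ht := tupleSum_nonneg
  refine le_coe_mul_of_toReal (by positivity) fun hfin => ?_
  obtain ⟨c, h1, hc, -, h⟩ := exists_expansion hu hb Φ.2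
  have hI := (h _ (coeFn_restrictLp hu Φ)).2
  rw [cksNorm_eq hI] at hfin ⊢
  have hK := ENNReal.toReal_nonneg (a := kernelsNorm u (p + 6 + κ) (kern c))
  -- Of the shift 6 + κ, 2 is lost to multiplicities, 2 + κ to the passage to Taylor coefficients,
  -- and 2 to the sum of the power series.
  have h2 := decays_of_kernelsNorm hu hfin
  rw [show p + 6 + κ - 2 = p + 4 + κ by ring] at h2
  obtain ⟨Ψ, -, h3, h4⟩ := exists_analytic_of_decays hu hb hc
  have h5 : (Φ : DistC → ℂ) = Ψ := funext fun x => (h1 x).unique (h3 x)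
  rw [analyticNorm_le_ofReal_iff hu (by positivity), h5]
  intro x
  refine (h4 p _ hp (by positivity) h2 x).trans (le_of_eq ?_)
  ring

theorem cksNorm_le_analyticNorm (hu : IsWeight u) (hb : ConnBound u C κ) {p : ℝ} (hp : 0 ≤ p)
    (Φ : analyticSpace u) : cksNorm u p (restrictLp hu Φ)
      ≤ ((C * wtSum * Real.sqrt tupleSum + 1).toNNReal : ℝ≥0∞)
        * analyticNorm u (p + 1 + 3 + κ) (Φ : DistC → ℂ) := by
  have hC := hb.1
  have hw := wtSum_nonneg
  refine le_coe_mul_of_toReal (by positivity) fun hfin => ?_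
  obtain ⟨c, -, -, h2, h⟩ := exists_expansion hu hb Φ.2
  rw [cksNorm_eq (h _ (coeFn_restrictLp hu Φ)).2]
  have hK := ENNReal.toReal_nonneg (a := analyticNorm u (p + 1 + 3 + κ) (Φ : DistC → ℂ))
  -- The exponent p + 1 is what `kernelsNorm_kern_le` needs; a further 3 + κ is lost between the
  -- growth of Φ and its Hermite coefficients.
  have h3 := h2 (p + 1) _ (by positivity) hK
    ((analyticNorm_le_ofReal_iff hu hK).mp (ENNReal.ofReal_toReal hfin).ge)
  refine (kernelsNorm_kern_le hu (by positivity) h3).trans (le_of_eq ?_)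
  congr 1; ring

end

end
end WhiteNoise

theorem proposition4p4 (u : ℝ → ℝ) (hu : WhiteNoise.IsWeight u) :
    ∃ T : WhiteNoise.analyticSpace u ≃ₗ[ℂ] WhiteNoise.testSpace u,
      (∀ Φ : WhiteNoise.analyticSpace u, ∀ᵐ x : WhiteNoise.Dist ∂WhiteNoise.whiteNoise,
        (T Φ : Lp ℂ 2 WhiteNoise.whiteNoise) x = (Φ : WhiteNoise.DistC → ℂ) x.toC) ∧
      WhiteNoise.EquivalentNormFamilies
        (fun (p : ℝ) (Φ : WhiteNoise.analyticSpace u) =>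
          WhiteNoise.analyticNorm u p (Φ : WhiteNoise.DistC → ℂ))
        (fun (p : ℝ) (Φ : WhiteNoise.analyticSpace u) =>
          WhiteNoise.cksNorm u p (T Φ : Lp ℂ 2 WhiteNoise.whiteNoise)) := by
  obtain ⟨C, κ, hb⟩ := hu.exists_connBound
  have hκ := hb.2.1
  refine ⟨WhiteNoise.restrictEquiv hu, WhiteNoise.coeFn_restrictLp hu, ?_, ?_⟩
  · exact fun p hp => ⟨p + 6 + κ, by linarith, _,
      WhiteNoise.analyticNorm_le_cksNorm hu hb (by linarith)⟩
  · exact fun p hp => ⟨p + 1 + 3 + κ, by linarith, _,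
      WhiteNoise.cksNorm_le_analyticNorm hu hb (by linarith)⟩
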